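/- Let $k$ be a commutative ring and $\mathfrak C$ a generalized $k$-linear Reedy category, that is, a small skeletal $k$-linear category with a degree function $d:\mathrm{Ob}(\mathfrak C)\to\lambda$ to an ordinal $\lambda$ and two $k$-linear subcategories $\mathfrak C^+,\mathfrak C^-$ with the same objects as $\mathfrak C$, such that (a) $\mathfrak C^+(x,y)\neq 0$ implies $x=y$ or $d(x)<d(y)$; (b) $\mathfrak C^-(x,y)\neq 0$ implies $x=y$ or $d(y)<d(x)$; (c) $\mathfrak C^+(x,x)=\mathfrak C^-(x,x)$ for all $x$; (d) with $\mathfrak C^0=\mathfrak C^+\cap\mathfrak C^-$ and $A_x^0=\mathfrak C^0(x,x)$, composition induces for all $x,y$ an isomorphism $\bigoplus_{z}\mathfrak C^+(z,y)\otimes_{A_z^0}\mathfrak C^-(x,z)\cong\mathfrak C(x,y)$. Let $\mathfrak C\text{-Mod}$ be the category of $k$-linear functors $\mathfrak C\to k\text{-Mod}$. For $x\in\mathrm{Ob}(\mathfrak C)$ with $d(x)=\alpha$ let $\mathfrak C_\alpha\subseteq\mathfrak C$ be the full subcategory of the objects of degree less than $\alpha$. For $Y\in\mathfrak C\text{-Mod}$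 consider the $A_x^0$-linear latching and matching maps $$l_Y(x):\ \mathfrak C(-,x)\otimes_{\mathfrak C_\alpha}Y|_{\mathfrak C_\alpha}\to Y(x),\quad \phi\otimes\xi\mapsto Y(\phi)(\xi),$$ $$m_Y(x):\ Y(x)\to\mathrm{Hom}_{\mathfrak C_\alpha}(\mathfrak C(x,-),Y|_{\mathfrak C_\alpha}),\quad \xi\mapsto[f\mapsto Y(f)(\xi)].$$ For a family $\mathcal S=\{\mathcal S_x\}_x$ of classes $\mathcal S_x$ of left $A_x^0$-modules put $$\Phi(\mathcal S)=\{Y:\ \text{for all }x,\ l_Y(x)\text{ is monic and }\mathrm{coker}\,l_Y(x)\in\mathcal S_x\},$$ $$\Psi(\mathcal S)=\{Y:\ \text{for all }x,\ m_Y(x)\text{ is epic and }\ker m_Y(x)\in\mathcal S_x\}.$$ A pair $(\mathcal C,\mathcal D)$ of classes of objects of an abelian category is a cotorsion pair if $\mathcal D=\{M:\mathrm{Ext}^1(C,M)=0\ \forall C\in\mathcal C\}$ and $\mathcal C=\{M:\mathrm{Ext}^1(M,D)=0\ \forall D\in\mathcal D\}$. It is complete if for every object $M$ there are short exact sequences $0\to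 D\to C\to M\to0$ and $0\to M\to D'\to C'\to0$ with $C,C'\in\mathcal C$ and $D,D'\in\mathcal D$. It is hereditary if $\mathcal C$ is closed under kernels of epimorphisms and $\mathcal D$ is closed under cokernels of monomorphisms. Theorem. Suppose that $\mathfrak C^+$ is a projective right $\mathfrak C^0$-module and $\mathfrak C^-$ is a projective left $\mathfrak C^0$-module. Let $\{(\mathcal C_x,\mathcal D_x)\}_{x\in\mathrm{Ob}(\mathfrak C)}$ be a family in which $(\mathcal C_x,\mathcal D_x)$ is a complete cotorsion pair in $A_x^0\text{-Mod}$ for every $x$. Then $(\Phi(\mathcal C),\Psi(\mathcal D))$ is a complete cotorsion pair in $\mathfrak C\text{-Mod}$. If moreover every $(\mathcal C_x,\mathcal D_x)$ is hereditary, then $(\Phi(\mathcal C),\Psi(\mathcal D))$ is hereditary. -/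

import Mathlib

open CategoryTheory CategoryTheory.Limits
open scoped TensorProduct DirectSum

universe u

set_option linter.unusedVariables false

noncomputable section

namespace ReedyGlue

/-! ## Linear subcategories, local algebras, and the balanced tensor product -/

section Subcategories

variable (k : Type u) [CommRing k] (C : Type u) [SmallCategory C] [Preadditive C] [Linear k C]

/-- A `k`-linear subcategory of `C` having the same objects as `C`. -/
@[ext]
structure LinearSubcategory where
  hom : ∀ x y : C, Submodule k (x ⟶ y)
  id_mem : ∀ x : C, 𝟙 x ∈ hom x x
  comp_mem : ∀ {x y z : C} {f : x ⟶ y} {g : y ⟶ z}, f ∈ hom x y → g ∈ hom y z → f ≫ g ∈ hom x z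

variable {k C}

namespace LinearSubcategory

/-- The intersection of two linear subcategories. -/
def inter (P M : LinearSubcategory k C) : LinearSubcategory k C where
  hom x y := P.hom x y ⊓ M.hom x y
  id_mem x := ⟨P.id_mem x, M.id_mem x⟩
  comp_mem hf hg := ⟨P.comp_mem hf.1 hg.1, M.comp_mem hf.2 hg.2⟩

/-- The endomorphism algebra of `x` in the subcategory `D`. In `End x` the product `a * b` is
"`a` after `b`", so that values of covariant functors are left modules. -/
def endAlg (D : LinearSubcategory k C) (x : C) : Subalgebra k (End x) where
  carrier := {a | (a : x ⟶ x) ∈ D.hom x x}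
  mul_mem' ha hb := D.comp_mem hb ha
  add_mem' ha hb := (D.hom x x).add_mem ha hb
  algebraMap_mem' r := by
    have h : (algebraMap k (End x) r : End x) = r • (𝟙 x : x ⟶ x) :=
      Algebra.algebraMap_eq_smul_one r
    change (algebraMap k (End x) r : End x) ∈ D.hom x x
    rw [h]
    exact (D.hom x x).smul_mem r (D.id_mem x)

/-- The algebra `A⁰_x = (P ∩ M)(x, x)`. -/
abbrev locAlg (P M : LinearSubcategory k C) (x : C) : Subalgebra k (End x) := (P.inter M).endAlg x

/-- `P(x, y)` is a right module over `A⁰_x`, by precomposition. -/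
instance rightModule (P M : LinearSubcategory k C) (x y : C) :
    Module (locAlg P M x)ᵐᵒᵖ (P.hom x y) where
  smul a g := ⟨(show x ⟶ x from a.unop.1) ≫ g.1, P.comp_mem a.unop.2.1 g.2⟩
  one_smul g := Subtype.ext (Category.id_comp _)
  mul_smul a b g := Subtype.ext (Category.assoc _ _ _)
  smul_zero a := Subtype.ext comp_zero
  smul_add a g h := Subtype.ext (Preadditive.comp_add _ _ _ _ _ _)
  add_smul a b g := Subtype.ext (Preadditive.add_comp _ _ _ _ _ _)
  zero_smul g := Subtype.ext zero_comp

/-- `M(x, y)` is a left module over `A⁰_y`, by postcomposition. -/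
instance leftModule (P M : LinearSubcategory k C) (x y : C) :
    Module (locAlg P M y) (M.hom x y) where
  smul a f := ⟨f.1 ≫ (show y ⟶ y from a.1), M.comp_mem f.2 a.2.2⟩
  one_smul f := Subtype.ext (Category.comp_id _)
  mul_smul a b f := Subtype.ext (Category.assoc _ _ _).symm
  smul_zero a := Subtype.ext zero_comp
  smul_add a f g := Subtype.ext (Preadditive.add_comp _ _ _ _ _ _)
  add_smul a b f := Subtype.ext (Preadditive.comp_add _ _ _ _ _ _)
  zero_smul f := Subtype.ext comp_zero

variable (P M : LinearSubcategory k C)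

/-- The relations `(g · a) ⊗ f = g ⊗ (a · f)`, for `a` in `A⁰_z`, on `P(z, y) ⊗_k M(x, z)`. -/
def balRel (x y z : C) : Submodule k (P.hom z y ⊗[k] M.hom x z) :=
  Submodule.span k {t | ∃ (g : P.hom z y) (a : locAlg P M z) (f : M.hom x z),
    t = (MulOpposite.op a • g) ⊗ₜ[k] f - g ⊗ₜ[k] (a • f)}

/-- The tensor product `P(z, y) ⊗ M(x, z)` over the (noncommutative) algebra `A⁰_z`. -/
abbrev BalTensor (x y z : C) : Type u := (P.hom z y ⊗[k] M.hom x z) ⧸ balRel P M x y z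

/-- The composition map `P(z, y) ⊗ M(x, z) ⟶ C(x, y)`, `g ⊗ f ↦ g ∘ f`, over `A⁰_z`. -/
def compMap (x y z : C) : BalTensor P M x y z →ₗ[k] (x ⟶ y) :=
  (balRel P M x y z).liftQ
    (TensorProduct.lift
      ((Linear.comp (S := k) x z y).flip.domRestrict₁₂ (P.hom z y) (M.hom x z)))
    (by
      refine Submodule.span_le.2 ?_
      rintro t ⟨g, a, f, rfl⟩
      change _ = _
      rw [map_sub, TensorProduct.lift.tmul, TensorProduct.lift.tmul, sub_eq_zero]
      exact (Category.assoc f.1 (show z ⟶ z from a.1) g.1).symm)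

open Classical in
/-- The composition map from `⨁_z P(z, y) ⊗ M(x, z)` (tensor products over `A⁰_z`)
to `C(x, y)`. -/
def totalCompMap (x y : C) : (⨁ z : C, BalTensor P M x y z) →ₗ[k] (x ⟶ y) :=
  DirectSum.toModule k C (x ⟶ y) fun z => compMap P M x y z

end LinearSubcategory

/-! ## Generalized `k`-linear Reedy categories -/

variable (k C)

/-- The structure of a generalized `k`-linear Reedy category on the small `k`-linear
category `C`. -/
structure ReedyStructure where
  /-- `C` is skeletal -/
  skeletal : Skeletal C
  /-- the ordinal in which the degree function takes its values -/
  lam : Ordinal.{u}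
  /-- the degree function -/
  deg : C → Ordinal.{u}
  deg_lt : ∀ x, deg x < lam
  /-- the subcategory `C⁺` -/
  plus : LinearSubcategory k C
  /-- the subcategory `C⁻` -/
  minus : LinearSubcategory k C
  plus_deg : ∀ x y, plus.hom x y ≠ ⊥ → x = y ∨ deg x < deg y
  minus_deg : ∀ x y, minus.hom x y ≠ ⊥ → x = y ∨ deg y < deg x
  plus_eq_minus : ∀ x, plus.hom x x = minus.hom x x
  /-- the Reedy factorization -/
  factorization : ∀ x y, Function.Bijective (plus.totalCompMap minus x y)

variable {k C}

namespace ReedyStructure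

variable (R : ReedyStructure k C)

/-- The local endomorphism algebra `A⁰_x = C⁰(x, x)`, where `C⁰ = C⁺ ∩ C⁻`. -/
abbrev A (x : C) : Subalgebra k (End x) := R.plus.locAlg R.minus x

open Classical in
/-- `C⁺` is a projective right `C⁰`-module. Since `C⁰` is the coproduct of the algebras `A⁰_x`,
a right `C⁰`-module is a family of right `A⁰_x`-modules, and the component at `x`
of `C⁺` is `⨁_y C⁺(x, y)`. -/
def PlusRightProjective : Prop :=
  ∀ x : C, Module.Projective (R.A x)ᵐᵒᵖ (⨁ y : C, R.plus.hom x y)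

open Classical in
/-- `C⁻` is a projective left `C⁰`-module: a left `C⁰`-module is a family of left
`A⁰_y`-modules, and the component at `y` of `C⁻` is `⨁_x C⁻(x, y)`. -/
def MinusLeftProjective : Prop :=
  ∀ y : C, Module.Projective (R.A y) (⨁ x : C, R.minus.hom x y)

end ReedyStructure

end Subcategories

/-! ## The category of left modules over a linear category -/

section Modules

variable (k : Type u) [CommRing k] (C : Type u) [SmallCategory C] [Preadditive C] [Linear k C]

/-- The property of being a `k`-linear functor from `C` to `k`-modules. -/
def isLinearFunctor : ObjectProperty (C ⥤ ModuleCat.{u} k) :=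
  fun F => F.Additive ∧ F.Linear k

/-- The category of left `C`-modules: `k`-linear functors from `C` to `k`-modules. -/
abbrev LMod : Type (u + 1) := (isLinearFunctor k C).FullSubcategory

instance : (isLinearFunctor k C).IsClosedUnderSubobjects where
  prop_of_mono {X Y} f _ hY := by
    obtain ⟨h₁, h₂⟩ := hY
    refine ⟨⟨fun {x y a b} => ?_⟩, ⟨fun {x y} a r => ?_⟩⟩
    · rw [← cancel_mono (f.app y)]
      simp
    · rw [← cancel_mono (f.app y)]
      simp

instance : (isLinearFunctor k C).IsClosedUnderQuotients where
  prop_of_epi {X Y} f _ hX := by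
    obtain ⟨h₁, h₂⟩ := hX
    refine ⟨⟨fun {x y a b} => ?_⟩, ⟨fun {x y} a r => ?_⟩⟩
    · rw [← cancel_epi (f.app x), ← f.naturality]
      simp
    · rw [← cancel_epi (f.app x), ← f.naturality]
      simp

instance (J : Type) [Category.{0} J] :
    (isLinearFunctor k C).IsClosedUnderLimitsOfShape J where
  limitsOfShape_le := by
    rintro X ⟨p⟩
    have hj := p.prop_diag_obj
    have hl := fun y : C => isLimitOfPreserves ((evaluation C (ModuleCat.{u} k)).obj y) p.isLimit
    have h₁ := fun j => (hj j).1
    have h₂ := fun j => (hj j).2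
    refine ⟨⟨fun {x y a b} => ?_⟩, ⟨fun {x y} a r => ?_⟩⟩
    · refine (hl y).hom_ext fun j => ?_
      change X.map (a + b) ≫ (p.π.app j).app y = (X.map a + X.map b) ≫ (p.π.app j).app y
      simp
    · refine (hl y).hom_ext fun j => ?_
      change X.map (r • a) ≫ (p.π.app j).app y = (r • X.map a) ≫ (p.π.app j).app y
      simp

instance : (isLinearFunctor k C).IsClosedUnderFiniteProducts where

instance : (isLinearFunctor k C).ContainsZero where
  exists_zero := ⟨_, isZero_zero _,
    (isLinearFunctor k C).prop_of_isTerminal _ (isZero_zero (C ⥤ ModuleCat.{u} k)).isTerminal⟩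

instance : Abelian (LMod k C) := inferInstance

variable {k C}

namespace LMod

/-- The value `Y(x)` of a `C`-module at `x`. -/
abbrev val (Y : LMod k C) (x : C) : Type u := Y.obj.obj x

/-- The action `Y(f) : Y(x) ⟶ Y(y)` of a morphism `f : x ⟶ y`. -/
abbrev act (Y : LMod k C) {x y : C} (f : x ⟶ y) : Y.val x →ₗ[k] Y.val y := (Y.obj.map f).hom

instance (Y : LMod k C) : Y.obj.Additive := Y.property.1

instance (Y : LMod k C) : Y.obj.Linear k := Y.property.2

lemma act_add (Y : LMod k C) {x y : C} (f g : x ⟶ y) (v : Y.val x) :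
    Y.act (f + g) v = Y.act f v + Y.act g v := by
  change (Y.obj.map (f + g)).hom v = _
  rw [Functor.map_add]
  rfl

lemma act_smul (Y : LMod k C) {x y : C} (r : k) (f : x ⟶ y) (v : Y.val x) :
    Y.act (r • f) v = r • Y.act f v := by
  change (Y.obj.map (r • f)).hom v = _
  rw [Functor.map_smul]
  rfl

lemma act_comp (Y : LMod k C) {x y z : C} (f : x ⟶ y) (g : y ⟶ z) (v : Y.val x) :
    Y.act (f ≫ g) v = Y.act g (Y.act f v) := by
  change (Y.obj.map (f ≫ g)).hom v = _
  rw [Functor.map_comp]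
  rfl

/-- `Y(x)` is a left module over `End x`, through `a • v = Y(a)(v)`. -/
instance endModule (Y : LMod k C) (x : C) : Module (End x) (Y.val x) where
  smul a v := Y.act (show x ⟶ x from a) v
  one_smul v := by
    change (Y.obj.map (𝟙 x)).hom v = v
    simp
  mul_smul a b v := by
    change (Y.obj.map ((show x ⟶ x from b) ≫ (show x ⟶ x from a))).hom v = _
    rw [Functor.map_comp]
    rfl
  smul_zero a := map_zero _
  smul_add a v w := map_add _ _ _
  add_smul a b v := by
    change (Y.obj.map ((show x ⟶ x from a) + (show x ⟶ x from b))).hom v = _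
    rw [Functor.map_add]
    rfl
  zero_smul v := by
    change (Y.obj.map (0 : x ⟶ x)).hom v = 0
    rw [Functor.map_zero]
    rfl

instance (Y : LMod k C) (x : C) : IsScalarTower k (End x) (Y.val x) where
  smul_assoc r a v := by
    change (Y.obj.map (r • (show x ⟶ x from a))).hom v = r • (Y.obj.map (show x ⟶ x from a)).hom v
    rw [Functor.map_smul]
    rfl

instance (Y : LMod k C) (x : C) : SMulCommClass k (End x) (Y.val x) where
  smul_comm r a v := (map_smul (Y.act (show x ⟶ x from a)) r v).symm

instance homTower (x y : C) : IsScalarTower k (End y) (x ⟶ y) where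
  smul_assoc r a f := Linear.comp_smul _ _ _ _ _ _

instance homComm (x y : C) : SMulCommClass k (End y) (x ⟶ y) where
  smul_comm r a f := (Linear.smul_comp _ _ _ _ _ _).symm

end LMod

end Modules

/-! ## Latching and matching morphisms -/

section LatchingMatching

variable {k : Type u} [CommRing k] {C : Type u} [SmallCategory C] [Preadditive C] [Linear k C]

namespace ReedyStructure

variable (R : ReedyStructure k C) (Y : LMod k C) (x : C)

/-- The objects of degree less than `d(x)`, that is, those of `C_α` with `α = d(x)`. -/
abbrev Below : Type u := {y : C // R.deg y < R.deg x}

open Classical in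
/-- The relations `(φ ∘ f) ⊗ ξ = φ ⊗ Y(f)(ξ)` for `f` in `C_α`, where `α = d(x)`. -/
def latchingRel : Submodule (R.A x) (⨁ y : R.Below x, (y.1 ⟶ x) ⊗[k] Y.val y.1) :=
  Submodule.span (R.A x) {t | ∃ (y z : R.Below x) (f : y.1 ⟶ z.1) (φ : z.1 ⟶ x) (ξ : Y.val y.1),
    t = DirectSum.lof (R.A x) _ (fun y : R.Below x => (y.1 ⟶ x) ⊗[k] Y.val y.1) y
          ((f ≫ φ) ⊗ₜ[k] ξ)
      - DirectSum.lof (R.A x) _ (fun y : R.Below x => (y.1 ⟶ x) ⊗[k] Y.val y.1) z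
          (φ ⊗ₜ[k] Y.act f ξ)}

/-- The latching object `C(-, x) ⊗ Y` of `Y` at `x`, with the tensor product taken over `C_α`,
`α = d(x)`; it is a left `A⁰_x`-module through the action on `C(-, x)`. -/
abbrev Latching : Type u :=
  (⨁ y : R.Below x, (y.1 ⟶ x) ⊗[k] Y.val y.1) ⧸ R.latchingRel Y x

/-- The pairing `C(y, x) ⊗_k Y(y) ⟶ Y(x)`, `φ ⊗ ξ ↦ Y(φ)(ξ)`. -/
def actTensor (y : C) : (y ⟶ x) ⊗[k] Y.val y →ₗ[R.A x] Y.val x :=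
  TensorProduct.AlgebraTensorModule.lift
    { toFun := fun φ => Y.act φ
      map_add' := fun φ ψ => LinearMap.ext fun v => Y.act_add φ ψ v
      map_smul' := fun a φ => LinearMap.ext fun v => Y.act_comp φ (show x ⟶ x from a.1) v }

open Classical in
/-- The latching morphism `l_Y(x)`, `φ ⊗ ξ ↦ Y(φ)(ξ)`. -/
def latchingMap : R.Latching Y x →ₗ[R.A x] Y.val x :=
  (R.latchingRel Y x).liftQ
    (DirectSum.toModule (R.A x) (R.Below x) (Y.val x) fun y => R.actTensor Y x y.1)
    (by
      refine Submodule.span_le.2 ?_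
      rintro t ⟨y, z, f, φ, ξ, rfl⟩
      change _ = _
      rw [map_sub, DirectSum.toModule_lof, DirectSum.toModule_lof, sub_eq_zero]
      exact Y.act_comp f φ ξ)

/-- The matching object of `Y` at `x`: the `k`-linear natural transformations
`C(x, -) ⟶ Y` of functors on `C_α`, where `α = d(x)`. -/
def Matching : Submodule k (∀ y : R.Below x, (x ⟶ y.1) →ₗ[k] Y.val y.1) where
  carrier := {h | ∀ (y z : R.Below x) (f : y.1 ⟶ z.1) (φ : x ⟶ y.1),
    h z (φ ≫ f) = Y.act f (h y φ)}
  add_mem' {g h} hg hh y z f φ := by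
    simp [hg y z f φ, hh y z f φ]
  zero_mem' y z f φ := by simp
  smul_mem' r h hh y z f φ := by
    simp [hh y z f φ]

/-- The left `A⁰_x`-module structure on the matching object: `(a • h)(φ) = h(φ ∘ a)`. -/
instance matchingModule : Module (R.A x) (R.Matching Y x) where
  smul a h := ⟨fun y => (h.1 y).comp (Linear.leftComp k y.1 (show x ⟶ x from a.1)), by
    intro y z f φ
    change h.1 z ((show x ⟶ x from a.1) ≫ φ ≫ f) = _
    rw [← Category.assoc]
    exact h.2 y z f _⟩
  one_smul h := by
    refine Subtype.ext (funext fun y => LinearMap.ext fun φ => ?_)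
    exact congrArg (h.1 y) (Category.id_comp φ)
  mul_smul a b h := by
    refine Subtype.ext (funext fun y => LinearMap.ext fun φ => ?_)
    exact congrArg (h.1 y) (Category.assoc _ _ _)
  smul_zero a := rfl
  smul_add a g h := rfl
  add_smul a b h := by
    refine Subtype.ext (funext fun y => LinearMap.ext fun φ => ?_)
    exact (congrArg (h.1 y) (Preadditive.add_comp _ _ _ _ _ _)).trans (map_add _ _ _)
  zero_smul h := by
    refine Subtype.ext (funext fun y => LinearMap.ext fun φ => ?_)
    exact (congrArg (h.1 y) zero_comp).trans (map_zero _)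

/-- The matching morphism `m_Y(x)`, `ξ ↦ (f ↦ Y(f)(ξ))`. -/
def matchingMap : Y.val x →ₗ[R.A x] R.Matching Y x where
  toFun ξ := ⟨fun y =>
    { toFun := fun f => Y.act f ξ
      map_add' := fun f g => Y.act_add f g ξ
      map_smul' := fun r f => Y.act_smul r f ξ }, fun y z f φ => Y.act_comp φ f ξ⟩
  map_add' ξ η := by
    refine Subtype.ext (funext fun y => LinearMap.ext fun φ => ?_)
    exact map_add (Y.act φ) ξ η
  map_smul' a ξ := by
    refine Subtype.ext (funext fun y => LinearMap.ext fun φ => ?_)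
    exact (Y.act_comp (show x ⟶ x from a.1) φ ξ).symm

/-- The class `Φ(S)`: at every object the latching morphism is monic, with cokernel in `S_x`. -/
def Phi (S : ∀ x : C, ObjectProperty (ModuleCat.{u} (R.A x))) : ObjectProperty (LMod k C) :=
  fun Y => ∀ x : C, Function.Injective (R.latchingMap Y x) ∧
    S x (ModuleCat.of (R.A x) (Y.val x ⧸ LinearMap.range (R.latchingMap Y x)))

/-- The class `Ψ(S)`: at every object the matching morphism is epic, with kernel in `S_x`. -/
def Psi (S : ∀ x : C, ObjectProperty (ModuleCat.{u} (R.A x))) : ObjectProperty (LMod k C) :=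
  fun Y => ∀ x : C, Function.Surjective (R.matchingMap Y x) ∧
    S x (ModuleCat.of (R.A x) (LinearMap.ker (R.matchingMap Y x)))

end ReedyStructure

end LatchingMatching

/-! ## Cotorsion pairs -/

section CotorsionPairs

universe v w

variable {𝒜 : Type w} [Category.{v} 𝒜] [Abelian 𝒜]

/-- `Ext¹(X, Y) = 0`. -/
def ExtOneVanishes (X Y : 𝒜) : Prop :=
  letI : HasExt.{max v w} 𝒜 := HasExt.standard 𝒜
  Subsingleton (Abelian.Ext.{max v w} X Y 1)

/-- `(P, Q)` is a cotorsion pair: each class is the `Ext¹`-orthogonal of the other one. -/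
structure IsCotorsionPair (P Q : ObjectProperty 𝒜) : Prop where
  right_iff : ∀ M, Q M ↔ ∀ X, P X → ExtOneVanishes X M
  left_iff : ∀ M, P M ↔ ∀ X, Q X → ExtOneVanishes M X

/-- `(P, Q)` is a complete cotorsion pair: every object `M` sits in short exact sequences
`0 ⟶ B ⟶ A ⟶ M ⟶ 0` and `0 ⟶ M ⟶ B ⟶ A ⟶ 0` with `A` in `P` and `B` in `Q`. -/
structure IsCompleteCotorsionPair (P Q : ObjectProperty 𝒜) : Prop
    extends IsCotorsionPair P Q where
  exists_left : ∀ M : 𝒜, ∃ (B A : 𝒜) (i : B ⟶ A) (p : A ⟶ M) (h : i ≫ p = 0),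
    (ShortComplex.mk i p h).ShortExact ∧ P A ∧ Q B
  exists_right : ∀ M : 𝒜, ∃ (B A : 𝒜) (i : M ⟶ B) (p : B ⟶ A) (h : i ≫ p = 0),
    (ShortComplex.mk i p h).ShortExact ∧ P A ∧ Q B

/-- The pair `(P, Q)` is hereditary: `P` is closed under kernels of epimorphisms and `Q` is
closed under cokernels of monomorphisms. -/
structure IsHereditary (P Q : ObjectProperty 𝒜) : Prop where
  resolving : ∀ S : ShortComplex 𝒜, S.ShortExact → P S.X₂ → P S.X₃ → P S.X₁
  coresolving : ∀ S : ShortComplex 𝒜, S.ShortExact → Q S.X₁ → Q S.X₂ → Q S.X₃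

end CotorsionPairs

end ReedyGlue

end

/-!
The proof treats one object of `C` at a time, in the order of increasing degree.

*Lifting.* To define a morphism `X ⟶ E` at an object `x`, when it is known at all objects of
smaller degree, is to fill a square from the latching morphism `L_x X ⟶ X(x)` to the matching
morphism `E(x) ⟶ M_x E`. If the former is injective, the latter is surjective, and their cokernel
and kernel are `Ext¹`-orthogonal, then this is possible (`exists_diagonal_lift`). The relative
version, for a morphism `p : E ⟶ B` and the relative matching object `M_x E ×_{M_x B} B(x)`, gives
`ReedyStructure.exists_lift`. The axiom on Reedy factorizations is used to see that only
compatibility with morphisms to and from objects of smaller degree has to be arranged, besides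
`A⁰_x`-linearity, and that the composition `C(x, -) ⊗ C(-, y) ⟶ C(x, y)` over the objects of degree
less than `β` is injective, with an explicit complement (`exists_linearMap_of_natural`,
`exists_minusProj`, `exists_plusProj`).

*Factorization.* Given `N`, a transfinite sequence of modules over `N` is built, starting from `0`.
In each step an object `x` of least degree is chosen at which the conditions of `Φ(𝒞)` and the
relative conditions of `Ψ(𝒟)` do not hold yet, the value of the module at `x` is replaced by the
middle term of a factorization of `X(x) ⟶ M_x X ×_{M_x N} N(x)` into an injection with cokernel in
`𝒞_x` and a surjection with kernel in `𝒟_x` (`IsCompleteCotorsionPair.exists_factorization`), and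
the module is extended freely to the objects of larger degree (`exists_isAttached`). Nothing
changes at the objects already treated, so that the sequence ends with a morphism `π : X ⟶ N` with
`X` in `Φ(𝒞)`, all of whose relative matching morphisms are surjective with kernel in `𝒟_x`
(`exists_good`). Its kernel is in `Ψ(𝒟)`.

*Projectivity.* That `C⁻` is projective on the left makes the cokernels of the latching morphisms
of the representable modules `C(x, -)` projective. Elements of matching objects therefore lift
along `π` (`exists_matching_lift`), hence `π` is an epimorphism; the same argument shows that
`Ψ(𝒟)` inherits closure under cokernels of monomorphisms. Dually, that `C⁺` is projective on the
right makes the kernels of the matching morphisms of `∏_x Hom(C(-, x), J_x)` injective, for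
injective `k`-modules `J_x`; so these injective modules lie in `Ψ(𝒟)` (`psi_cofree`), and every
module embeds into one.

Orthogonality of `Φ(𝒞)` and `Ψ(𝒟)` follows by lifting along `I ⟶ I / Y` for such an embedding of `Y`
into `I`, special preenvelopes follow from special precovers by a pullback, and the remaining
inclusions hold because both classes are closed under retracts.
-/

noncomputable section

namespace ReedyGlue

/-! ### Ext-orthogonality in abelian categories -/

section Orthogonality

universe v w

open Abelian

variable {𝒜 : Type w} [Category.{v} 𝒜] [Abelian 𝒜]

attribute [local instance] HasExt.standard

lemma ExtOneVanishes.eq_zero {X Y : 𝒜} (h : ExtOneVanishes X Y)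
    (e : Ext.{max v w} X Y 1) : e = 0 :=
  @Subsingleton.elim _ h _ _

lemma extOneVanishes_of_eq_zero {X Y : 𝒜} (h : ∀ e : Ext.{max v w} X Y 1, e = 0) :
    ExtOneVanishes X Y :=
  ⟨fun a b => (h a).trans (h b).symm⟩

lemma ExtOneVanishes.of_retract_left {X X' Y : 𝒜} (h : ExtOneVanishes X Y)
    (i : X' ⟶ X) (r : X ⟶ X') (hir : i ≫ r = 𝟙 X') : ExtOneVanishes X' Y := by
  refine extOneVanishes_of_eq_zero fun e => ?_
  have h₁ : (Ext.mk₀ r).comp e (zero_add 1) = 0 := h.eq_zero _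
  have h₂ := congrArg (fun t => (Ext.mk₀ i).comp t (zero_add 1)) h₁
  simpa [hir] using h₂

lemma ExtOneVanishes.of_retract_right {X Y Y' : 𝒜} (h : ExtOneVanishes X Y)
    (i : Y' ⟶ Y) (r : Y ⟶ Y') (hir : i ≫ r = 𝟙 Y') : ExtOneVanishes X Y' := by
  refine extOneVanishes_of_eq_zero fun e => ?_
  have h₁ : e.comp (Ext.mk₀ i) (add_zero 1) = 0 := h.eq_zero _
  have h₂ := congrArg (fun t => t.comp (Ext.mk₀ r) (add_zero 1)) h₁
  simpa [hir] using h₂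

lemma ExtOneVanishes.of_shortExact_left {S : ShortComplex 𝒜} (hS : S.ShortExact) {Y : 𝒜}
    (h₁ : ExtOneVanishes S.X₁ Y) (h₃ : ExtOneVanishes S.X₃ Y) : ExtOneVanishes S.X₂ Y := by
  refine extOneVanishes_of_eq_zero fun e => ?_
  obtain ⟨e', rfl⟩ := Ext.contravariant_sequence_exact₂ hS Y e (h₁.eq_zero _)
  rw [h₃.eq_zero e', Ext.comp_zero]

lemma ExtOneVanishes.of_shortExact_right {S : ShortComplex 𝒜} (hS : S.ShortExact) {X : 𝒜}
    (h₁ : ExtOneVanishes X S.X₁) (h₃ : ExtOneVanishes X S.X₃) : ExtOneVanishes X S.X₂ := by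
  refine extOneVanishes_of_eq_zero fun e => ?_
  obtain ⟨e', rfl⟩ := Ext.covariant_sequence_exact₂ X hS e (h₃.eq_zero _)
  rw [h₁.eq_zero e', Ext.zero_comp]

/-- Morphisms to `Y` extend along a monomorphism whose cokernel is orthogonal to `Y`. -/
lemma ExtOneVanishes.exists_extension {S : ShortComplex 𝒜} (hS : S.ShortExact) {Y : 𝒜}
    (h : ExtOneVanishes S.X₃ Y) (φ : S.X₁ ⟶ Y) : ∃ ψ : S.X₂ ⟶ Y, S.f ≫ ψ = φ := by
  obtain ⟨x, hx⟩ := Ext.contravariant_sequence_exact₁ hS Y (Ext.mk₀ φ) (add_zero 1)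
    (h.eq_zero _)
  obtain ⟨ψ, rfl⟩ := Ext.addEquiv₀.symm.surjective x
  refine ⟨ψ, Ext.addEquiv₀.symm.injective ?_⟩
  simpa using hx

/-- Morphisms from `X` lift along an epimorphism whose kernel is orthogonal to `X`. -/
lemma ExtOneVanishes.exists_lift {S : ShortComplex 𝒜} (hS : S.ShortExact) {X : 𝒜}
    (h : ExtOneVanishes X S.X₁) (φ : X ⟶ S.X₃) : ∃ ψ : X ⟶ S.X₂, ψ ≫ S.g = φ := by
  obtain ⟨x, hx⟩ := Ext.covariant_sequence_exact₃ X hS (Ext.mk₀ φ) (zero_add 1)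
    (h.eq_zero _)
  obtain ⟨ψ, rfl⟩ := Ext.addEquiv₀.symm.surjective x
  refine ⟨ψ, Ext.addEquiv₀.symm.injective ?_⟩
  simpa using hx

lemma extOneVanishes_of_injective (X Y : 𝒜) [Injective Y] : ExtOneVanishes X Y :=
  extOneVanishes_of_eq_zero fun e => e.eq_zero_of_injective

lemma extOneVanishes_of_projective (X Y : 𝒜) [Projective X] : ExtOneVanishes X Y :=
  extOneVanishes_of_eq_zero fun e => e.eq_zero_of_projective

/-- For an injective copresentation `0 ⟶ Y ⟶ I ⟶ Z ⟶ 0`, the group `Ext¹(X, Y)` is the cokernel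
of `Hom(X, I) ⟶ Hom(X, Z)`. -/
lemma extOneVanishes_of_lifts {S : ShortComplex 𝒜} (hS : S.ShortExact) [Injective S.X₂] {X : 𝒜}
    (h : ∀ φ : X ⟶ S.X₃, ∃ ψ : X ⟶ S.X₂, ψ ≫ S.g = φ) : ExtOneVanishes X S.X₁ := by
  refine extOneVanishes_of_eq_zero fun e => ?_
  obtain ⟨x, rfl⟩ := Ext.covariant_sequence_exact₁ X hS e
    ((extOneVanishes_of_injective X S.X₂).eq_zero _) (zero_add 1)
  obtain ⟨φ, rfl⟩ := Ext.addEquiv₀.symm.surjective x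
  obtain ⟨ψ, rfl⟩ := h φ
  change (Ext.mk₀ (ψ ≫ S.g)).comp hS.extClass (zero_add 1) = 0
  rw [← Ext.mk₀_comp_mk₀, Ext.comp_assoc_of_second_deg_zero, hS.comp_extClass, Ext.comp_zero]

variable {P Q : ObjectProperty 𝒜}

namespace IsCotorsionPair

variable (h : IsCotorsionPair P Q)

include h

lemma vanishes {X Y : 𝒜} (hX : P X) (hY : Q Y) : ExtOneVanishes X Y :=
  (h.right_iff Y).1 hY X hX

lemma right_of_retract {Y Y' : 𝒜} (hY : Q Y) (i : Y' ⟶ Y) (r : Y ⟶ Y') (hir : i ≫ r = 𝟙 Y') :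
    Q Y' :=
  (h.right_iff Y').2 fun _ hX => (h.vanishes hX hY).of_retract_right i r hir

lemma left_of_retract {X X' : 𝒜} (hX : P X) (i : X' ⟶ X) (r : X ⟶ X') (hir : i ≫ r = 𝟙 X') :
    P X' :=
  (h.left_iff X').2 fun _ hY => (h.vanishes hX hY).of_retract_left i r hir

lemma left_of_iso {X X' : 𝒜} (hX : P X) (e : X ≅ X') : P X' :=
  h.left_of_retract hX e.inv e.hom e.inv_hom_id

lemma right_of_iso {X X' : 𝒜} (hX : Q X) (e : X ≅ X') : Q X' :=
  h.right_of_retract hX e.inv e.hom e.inv_hom_id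

lemma left_of_shortExact {S : ShortComplex 𝒜} (hS : S.ShortExact) (h₁ : P S.X₁) (h₃ : P S.X₃) :
    P S.X₂ :=
  (h.left_iff _).2 fun _ hY => .of_shortExact_left hS (h.vanishes h₁ hY) (h.vanishes h₃ hY)

lemma right_of_shortExact {S : ShortComplex 𝒜} (hS : S.ShortExact) (h₁ : Q S.X₁) (h₃ : Q S.X₃) :
    Q S.X₂ :=
  (h.right_iff _).2 fun _ hX => .of_shortExact_right hS (h.vanishes hX h₁) (h.vanishes hX h₃)

end IsCotorsionPair

end Orthogonality

/-! ### Cotorsion pairs of modules -/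

section ModuleLemmas

variable {A : Type u} [Ring A]

lemma shortExact_of_linearMap {X Y Z : Type u} [AddCommGroup X] [Module A X] [AddCommGroup Y]
    [Module A Y] [AddCommGroup Z] [Module A Z] (f : X →ₗ[A] Y) (g : Y →ₗ[A] Z)
    (hf : Function.Injective f) (hg : Function.Surjective g)
    (hfg : ∀ y, g y = 0 ↔ ∃ x, f x = y) :
    ∃ w : ModuleCat.ofHom f ≫ ModuleCat.ofHom g = 0,
      (ShortComplex.mk (ModuleCat.ofHom f) (ModuleCat.ofHom g) w).ShortExact := by
  have w : ModuleCat.ofHom f ≫ ModuleCat.ofHom g = 0 := by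
    ext x
    exact (hfg (f x)).2 ⟨x, rfl⟩
  refine ⟨w, ?_⟩
  have := (ModuleCat.mono_iff_injective (ModuleCat.ofHom f)).2 hf
  have := (ModuleCat.epi_iff_surjective (ModuleCat.ofHom g)).2 hg
  exact { exact := (ShortComplex.moduleCat_exact_iff _).2 fun y hy => (hfg y).1 hy }

/-- Lifting against a surjection `p` along an injection `i`, when the cokernel of `i` and the
kernel of `p` are orthogonal. -/
lemma exists_diagonal_lift {L V E P : Type u} [AddCommGroup L] [Module A L] [AddCommGroup V]
    [Module A V] [AddCommGroup E] [Module A E] [AddCommGroup P] [Module A P]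
    (i : L →ₗ[A] V) (hi : Function.Injective i) (p : E →ₗ[A] P) (hp : Function.Surjective p)
    (hext : ExtOneVanishes (ModuleCat.of A (V ⧸ LinearMap.range i))
      (ModuleCat.of A (LinearMap.ker p)))
    (a : L →ₗ[A] E) (b : V →ₗ[A] P) (hab : ∀ l, p (a l) = b (i l)) :
    ∃ s : V →ₗ[A] E, (∀ l, s (i l) = a l) ∧ ∀ v, p (s v) = b v := by
  -- The pullback `T` of `p` and `b`, modulo the image of `L`, is an extension of the cokernel of
  -- `i` by the kernel of `p`; a retraction of this extension corrects an arbitrary lift of `b`.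
  let T : Submodule A (E × V) := LinearMap.ker (p.comp (LinearMap.fst A E V) -
    b.comp (LinearMap.snd A E V))
  have hT : ∀ t : E × V, t ∈ T ↔ p t.1 = b t.2 := fun t => by
    simp [T, LinearMap.mem_ker, sub_eq_zero]
  let j : L →ₗ[A] T := (a.prod i).codRestrict T fun l => (hT _).2 (hab l)
  let d : LinearMap.ker p →ₗ[A] T :=
    ((LinearMap.inl A E V).comp (LinearMap.ker p).subtype).codRestrict T
    fun x => (hT _).2 (by simp)
  let f : LinearMap.ker p →ₗ[A] T ⧸ LinearMap.range j := (LinearMap.range j).mkQ.comp d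
  let g : T ⧸ LinearMap.range j →ₗ[A] V ⧸ LinearMap.range i :=
    (LinearMap.range j).mapQ (LinearMap.range i) ((LinearMap.snd A E V).comp T.subtype) (by
      rintro _ ⟨l, rfl⟩
      exact ⟨l, rfl⟩)
  have hf : Function.Injective f := by
    refine (injective_iff_map_eq_zero f).2 fun x hx => ?_
    obtain ⟨l, hl⟩ := (Submodule.Quotient.mk_eq_zero _).1 hx
    have h1 : i l = 0 := congrArg (fun t : T => t.1.2) hl
    have h2 : a l = x.1 := congrArg (fun t : T => t.1.1) hl
    have h3 : l = 0 := hi (h1.trans (map_zero i).symm)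
    exact Subtype.ext (h2.symm.trans (by rw [h3, map_zero]; rfl))
  have hg : Function.Surjective g := by
    intro q
    obtain ⟨v, rfl⟩ := Submodule.Quotient.mk_surjective _ q
    obtain ⟨e, he⟩ := hp (b v)
    exact ⟨Submodule.Quotient.mk ⟨(e, v), (hT _).2 he⟩, rfl⟩
  have hfg : ∀ y, g y = 0 ↔ ∃ x, f x = y := by
    intro y
    obtain ⟨t, rfl⟩ := Submodule.Quotient.mk_surjective _ y
    constructor
    · intro h
      obtain ⟨l, hl⟩ := (Submodule.Quotient.mk_eq_zero _).1 h
      have ht := (hT t.1).1 t.2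
      change i l = t.1.2 at hl
      refine ⟨⟨t.1.1 - a l, ?_⟩, ?_⟩
      · rw [LinearMap.mem_ker, map_sub, ht, hab, hl, sub_self]
      · refine (Submodule.Quotient.eq _).2 ⟨-l, ?_⟩
        refine Subtype.ext (Prod.ext ?_ ?_)
        · change a (-l) = (t.1.1 - a l) - t.1.1
          rw [map_neg]; abel
        · change i (-l) = 0 - t.1.2
          rw [map_neg, hl, zero_sub]
    · rintro ⟨x, hx⟩
      rw [← hx]
      exact (Submodule.Quotient.mk_eq_zero _).2 ⟨0, by simp [d]⟩
  obtain ⟨w, hS⟩ := shortExact_of_linearMap f g hf hg hfg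
  obtain ⟨ψ, hψ⟩ := hext.exists_extension hS (𝟙 _)
  let r : T ⧸ LinearMap.range j →ₗ[A] LinearMap.ker p := ψ.hom
  have hr : ∀ x, r (f x) = x := fun x => congrArg (fun t => t.hom x) hψ
  let c : T →ₗ[A] E := (LinearMap.fst A E V).comp T.subtype -
    (LinearMap.ker p).subtype.comp (r.comp (LinearMap.range j).mkQ)
  let q : T →ₗ[A] V := (LinearMap.snd A E V).comp T.subtype
  have hq : Function.Surjective q := fun v => by
    obtain ⟨e, he⟩ := hp (b v)
    exact ⟨⟨(e, v), (hT _).2 he⟩, rfl⟩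
  have hc : LinearMap.ker q ≤ LinearMap.ker c := by
    intro t ht
    have h0 : t.1.2 = 0 := ht
    have h1 : p t.1.1 = 0 := by rw [(hT _).1 t.2, h0, map_zero]
    have h2 : t = d ⟨t.1.1, h1⟩ := Subtype.ext (Prod.ext rfl h0)
    change t.1.1 - (r (Submodule.Quotient.mk t)).1 = 0
    have h3 : r (Submodule.Quotient.mk t) = ⟨t.1.1, h1⟩ := by
      rw [← hr ⟨t.1.1, h1⟩]
      exact congrArg (fun t => r (Submodule.Quotient.mk t)) h2
    rw [h3, sub_self]
  let s : V →ₗ[A] E := ((LinearMap.ker q).liftQ c hc).comp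
    (q.quotKerEquivOfSurjective hq).symm.toLinearMap
  have hs : ∀ t : T, s t.1.2 = c t := by
    intro t
    have : (q.quotKerEquivOfSurjective hq).symm t.1.2 = Submodule.Quotient.mk t := by
      rw [LinearEquiv.symm_apply_eq]; rfl
    change (LinearMap.ker q).liftQ c hc _ = _
    rw [LinearEquiv.coe_coe, this]
    rfl
  refine ⟨s, fun l => ?_, fun v => ?_⟩
  · refine (hs (j l)).trans ?_
    change a l - (r (Submodule.Quotient.mk (j l))).1 = a l
    have h0 : (Submodule.Quotient.mk (j l) : T ⧸ LinearMap.range j) = 0 :=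
      (Submodule.Quotient.mk_eq_zero _).2 (LinearMap.mem_range_self j l)
    rw [h0, map_zero]
    exact sub_zero _
  · obtain ⟨e, he⟩ := hp (b v)
    rw [hs ⟨(e, v), (hT _).2 he⟩]
    change p (e - (r _).1) = _
    rw [map_sub, (r _).2, sub_zero, he]

variable {𝒞 𝒟 : ObjectProperty (ModuleCat.{u} A)}

/-- A complete cotorsion pair factors every linear map into an injection with cokernel in `𝒞`
followed by a surjection with kernel in `𝒟`. -/
lemma IsCompleteCotorsionPair.exists_factorization (h : IsCompleteCotorsionPair 𝒞 𝒟)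
    {L P : Type u} [AddCommGroup L] [Module A L] [AddCommGroup P] [Module A P] (l : L →ₗ[A] P) :
    ∃ (V : ModuleCat.{u} A) (i : L →ₗ[A] V) (p : V →ₗ[A] P), (∀ x, p (i x) = l x) ∧
      Function.Injective i ∧ 𝒞 (ModuleCat.of A (V ⧸ LinearMap.range i)) ∧
      Function.Surjective p ∧ 𝒟 (ModuleCat.of A (LinearMap.ker p)) := by
  -- `V` is the pushout of `L × G ← K → D`, where `G ⟶ P` is a special precover, `K` is the kernel
  -- of the surjection `L × G ⟶ P`, and `K ⟶ D` is a special preenvelope with cokernel `G'`.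
  obtain ⟨B, G, _, π, _, hS₁, hG, _⟩ := h.exists_left (ModuleCat.of A P)
  have hπ : Function.Surjective π.hom := (ModuleCat.epi_iff_surjective π).1 hS₁.epi_g
  let q : (L × G) →ₗ[A] P := l.coprod π.hom
  obtain ⟨D, G', ε, ρ, w, hS₂, hG', hD⟩ := h.exists_right (ModuleCat.of A (LinearMap.ker q))
  have hε : Function.Injective ε.hom := (ModuleCat.mono_iff_injective ε).1 hS₂.mono_f
  have hρ : Function.Surjective ρ.hom := (ModuleCat.epi_iff_surjective ρ).1 hS₂.epi_g
  have hερ : ∀ d : D, ρ.hom d = 0 → ∃ x, ε.hom x = d :=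
    (ShortComplex.moduleCat_exact_iff _).1 hS₂.exact
  have hρε : ∀ x, ρ.hom (ε.hom x) = 0 := fun x => congrArg (fun t => t.hom x) w
  let ε' : LinearMap.ker q →ₗ[A] D := ε.hom
  let ρ' : D →ₗ[A] G' := ρ.hom
  let κ : LinearMap.ker q →ₗ[A] (D × (L × G)) := (-ε').prod (LinearMap.ker q).subtype
  let N := LinearMap.range κ
  let i : L →ₗ[A] (D × (L × G)) ⧸ N :=
    N.mkQ.comp ((LinearMap.inr A D (L × G)).comp (LinearMap.inl A L G))
  let p : ((D × (L × G)) ⧸ N) →ₗ[A] P := N.liftQ (q.comp (LinearMap.snd A D (L × G))) (by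
    rintro _ ⟨x, rfl⟩
    exact x.2)
  refine ⟨ModuleCat.of A ((D × (L × G)) ⧸ N), i, p, fun x => ?_, ?_, ?_, ?_, ?_⟩
  · change l x + π.hom 0 = l x
    rw [map_zero, add_zero]
  · refine (injective_iff_map_eq_zero i).2 fun x hx => ?_
    obtain ⟨y, hy⟩ := (Submodule.Quotient.mk_eq_zero _).1 hx
    have h1 : -ε' y = 0 := congrArg Prod.fst hy
    have h2 : y = 0 := hε ((neg_eq_zero.1 h1).trans (map_zero _).symm)
    have h3 : (y.1 : L × G).1 = x := congrArg (fun t => t.2.1) hy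
    rw [← h3, h2]
    rfl
  · -- The cokernel of `i` is an extension of `G'` by `G`.
    let f : G →ₗ[A] ((D × (L × G)) ⧸ N) ⧸ LinearMap.range i :=
      (LinearMap.range i).mkQ.comp
        (N.mkQ.comp ((LinearMap.inr A D (L × G)).comp (LinearMap.inr A L G)))
    let g₀ : ((D × (L × G)) ⧸ N) →ₗ[A] G' := N.liftQ (ρ'.comp (LinearMap.fst A D (L × G))) (by
      rintro _ ⟨x, rfl⟩
      change ρ' (-ε' x) = 0
      rw [map_neg]
      exact neg_eq_zero.2 (hρε x))
    let g : (((D × (L × G)) ⧸ N) ⧸ LinearMap.range i) →ₗ[A] G' :=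
      (LinearMap.range i).liftQ g₀ (by
        rintro _ ⟨x, rfl⟩
        exact map_zero ρ')
    have hf : Function.Injective f := by
      refine (injective_iff_map_eq_zero f).2 fun x hx => ?_
      obtain ⟨t, ht⟩ := (Submodule.Quotient.mk_eq_zero _).1 hx
      obtain ⟨y, hy⟩ := (Submodule.Quotient.eq _).1 ht
      have h1 : -ε' y = 0 - 0 := congrArg Prod.fst hy
      have h2 : y = 0 := hε ((neg_eq_zero.1 (h1.trans (sub_zero _))).trans (map_zero _).symm)
      have h3 : (y.1 : L × G).2 = 0 - x := congrArg (fun t => t.2.2) hy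
      rw [h2] at h3
      have h4 : (0 : G) = 0 - x := h3
      rw [zero_sub] at h4
      exact neg_eq_zero.1 h4.symm
    have hg : Function.Surjective g := fun y => by
      obtain ⟨d, hd⟩ := hρ y
      exact ⟨Submodule.Quotient.mk (Submodule.Quotient.mk (d, 0)), hd⟩
    have hfg : ∀ y, g y = 0 ↔ ∃ x, f x = y := by
      intro y
      obtain ⟨y, rfl⟩ := Submodule.Quotient.mk_surjective _ y
      obtain ⟨⟨d, a, b⟩, rfl⟩ := Submodule.Quotient.mk_surjective _ y
      constructor
      · intro hy
        obtain ⟨x, hx⟩ := hερ d hy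
        refine ⟨b + x.1.2, (Submodule.Quotient.eq _).2 ⟨-a - x.1.1, ?_⟩⟩
        refine (Submodule.Quotient.eq _).2 ⟨-x, ?_⟩
        refine Prod.ext ?_ (Prod.ext ?_ ?_)
        · change -ε' (-x) = 0 - (0 - d)
          rw [map_neg, neg_neg, zero_sub, zero_sub, neg_neg]
          exact hx
        · change -x.1.1 = (-a - x.1.1) - (0 - a)
          abel
        · change -x.1.2 = 0 - ((b + x.1.2) - b)
          abel
      · rintro ⟨x, hx⟩
        rw [← hx]
        exact map_zero ρ'
    obtain ⟨_, hS⟩ := shortExact_of_linearMap f g hf hg hfg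
    exact h.left_of_shortExact hS hG hG'
  · intro y
    obtain ⟨c, hc⟩ := hπ y
    refine ⟨Submodule.Quotient.mk (0, 0, c), ?_⟩
    change l 0 + π.hom c = y
    rw [map_zero, zero_add, hc]
  · -- The kernel of `p` is a copy of `D`.
    let f : D →ₗ[A] LinearMap.ker p :=
      (N.mkQ.comp (LinearMap.inl A D (L × G))).codRestrict _ fun d => by
        change q 0 = 0
        exact map_zero q
    have hf : Function.Bijective f := by
      constructor
      · refine (injective_iff_map_eq_zero f).2 fun x hx => ?_
        obtain ⟨y, hy⟩ := (Submodule.Quotient.mk_eq_zero _).1 (congrArg Subtype.val hx)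
        have h1 : -ε' y = x := congrArg Prod.fst hy
        have h2 : y = 0 := Subtype.ext (congrArg Prod.snd hy)
        rw [← h1, h2, map_zero, neg_zero]
      · rintro ⟨y, hy⟩
        obtain ⟨⟨d, t⟩, rfl⟩ := Submodule.Quotient.mk_surjective _ y
        refine ⟨d + ε' ⟨t, hy⟩, Subtype.ext ((Submodule.Quotient.eq _).2 ⟨-⟨t, hy⟩, ?_⟩)⟩
        refine Prod.ext ?_ ?_
        · change -ε' (-⟨t, hy⟩) = d + ε' ⟨t, hy⟩ - d
          rw [map_neg]; abel
        · change -t = 0 - t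
          rw [zero_sub]
    exact h.right_of_iso hD (LinearEquiv.ofBijective f hf).toModuleIso

end ModuleLemmas

/-! ### Morphisms factoring through objects of small degree -/

namespace ReedyStructure

section Factorization

variable {k : Type u} [CommRing k] {C : Type u} [SmallCategory C] [Preadditive C] [Linear k C]
variable (R : ReedyStructure k C)

/-- The morphisms `x ⟶ y` that are sums of composites through objects of degree less than `β`. -/
def lower (β : Ordinal.{u}) (x y : C) : Submodule k (x ⟶ y) :=
  Submodule.span k {t | ∃ (z : C) (g : x ⟶ z) (f : z ⟶ y), R.deg z < β ∧ t = g ≫ f}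

variable {R}

lemma comp_mem_lower {β : Ordinal.{u}} {x y z : C} (hz : R.deg z < β) (g : x ⟶ z) (f : z ⟶ y) :
    g ≫ f ∈ R.lower β x y :=
  Submodule.subset_span ⟨z, g, f, hz, rfl⟩

lemma comp_lower {β : Ordinal.{u}} {x' x y : C} {t : x ⟶ y} (ht : t ∈ R.lower β x y)
    (e : x' ⟶ x) : e ≫ t ∈ R.lower β x' y := by
  have : R.lower β x y ≤ (R.lower β x' y).comap (Linear.leftComp k y e) := by
    refine Submodule.span_le.2 ?_
    rintro _ ⟨z, g, f, hz, rfl⟩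
    change e ≫ (g ≫ f) ∈ R.lower β x' y
    rw [← Category.assoc]
    exact comp_mem_lower hz _ _
  exact this ht

lemma minus_deg' {x y : C} {m : x ⟶ y} (hm : m ∈ R.minus.hom x y) :
    m = 0 ∨ y = x ∨ R.deg y < R.deg x := by
  by_cases h : R.minus.hom x y = ⊥
  · rw [h] at hm
    exact .inl hm
  · rcases R.minus_deg x y h with h | h
    · exact .inr (.inl h.symm)
    · exact .inr (.inr h)

lemma plus_deg' {x y : C} {p : x ⟶ y} (hp : p ∈ R.plus.hom x y) :
    p = 0 ∨ x = y ∨ R.deg x < R.deg y := by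
  by_cases h : R.plus.hom x y = ⊥
  · rw [h] at hp
    exact .inl hp
  · exact .inr (R.plus_deg x y h)

variable (R)

/-- Every morphism is a sum of Reedy factorizations `m ≫ p`. -/
lemma mem_span_factor {x y : C} (f : x ⟶ y) :
    f ∈ Submodule.span k {t : x ⟶ y | ∃ (z : C) (m : x ⟶ z) (p : z ⟶ y), m ∈ R.minus.hom x z ∧
      p ∈ R.plus.hom z y ∧ (z = x ∨ R.deg z < R.deg x) ∧ (z = y ∨ R.deg z < R.deg y) ∧
      t = m ≫ p} := by
  classical
  set N := Submodule.span k {t : x ⟶ y | ∃ (z : C) (m : x ⟶ z) (p : z ⟶ y),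
    m ∈ R.minus.hom x z ∧ p ∈ R.plus.hom z y ∧ (z = x ∨ R.deg z < R.deg x) ∧
    (z = y ∨ R.deg z < R.deg y) ∧ t = m ≫ p} with hN
  obtain ⟨t, rfl⟩ := (R.factorization x y).2 f
  induction t using DirectSum.induction_on with
  | zero => rw [map_zero]; exact N.zero_mem
  | add s t hs ht => rw [map_add]; exact N.add_mem hs ht
  | of z q =>
    have h1 : R.plus.totalCompMap R.minus x y (DirectSum.of _ z q) =
        R.plus.compMap R.minus x y z q := DirectSum.toModule_lof k z q
    rw [h1]
    clear h1
    obtain ⟨q, rfl⟩ := Submodule.Quotient.mk_surjective _ q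
    induction q using TensorProduct.induction_on with
    | zero => exact N.zero_mem
    | add s t hs ht =>
      rw [Submodule.Quotient.mk_add, map_add]
      exact N.add_mem hs ht
    | tmul p m =>
      change m.1 ≫ p.1 ∈ N
      rcases minus_deg' m.2 with h | h
      · rw [h, zero_comp]; exact N.zero_mem
      rcases plus_deg' p.2 with h' | h'
      · rw [h', comp_zero]; exact N.zero_mem
      exact Submodule.subset_span ⟨z, m.1, p.1, m.2, p.2, h, h', rfl⟩

/-- An additive property of morphisms holds if it holds for all Reedy factorizations `m ≫ p`. -/
lemma factor_induction {x y : C} {motive : (x ⟶ y) → Prop} (f : x ⟶ y) (h0 : motive 0)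
    (hadd : ∀ s t, motive s → motive t → motive (s + t))
    (hsmul : ∀ (r : k) t, motive t → motive (r • t))
    (h : ∀ (z : C) (m : x ⟶ z) (p : z ⟶ y), m ∈ R.minus.hom x z → p ∈ R.plus.hom z y →
      (z = x ∨ R.deg z < R.deg x) → (z = y ∨ R.deg z < R.deg y) → motive (m ≫ p)) :
    motive f := by
  refine Submodule.span_induction ?_ h0 (fun s t _ _ => hadd s t) (fun r t _ => hsmul r t)
    (R.mem_span_factor f)
  rintro _ ⟨z, m, p, hm, hp, h1, h2, rfl⟩
  exact h z m p hm hp h1 h2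

lemma lower_induction {β : Ordinal.{u}} {x y : C} {motive : (x ⟶ y) → Prop} {f : x ⟶ y}
    (hf : f ∈ R.lower β x y) (h0 : motive 0)
    (hadd : ∀ s t, motive s → motive t → motive (s + t))
    (hsmul : ∀ (r : k) t, motive t → motive (r • t))
    (h : ∀ (z : C) (g : x ⟶ z) (f : z ⟶ y), R.deg z < β → motive (g ≫ f)) :
    motive f := by
  refine Submodule.span_induction ?_ h0 (fun s t _ _ => hadd s t) (fun r t _ => hsmul r t) hf
  rintro _ ⟨z, g, f, hz, rfl⟩
  exact h z g f hz

/-- A morphism through an object of degree less than `β` is a sum of Reedy factorizations through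
objects of degree less than `β`. -/
lemma lower_factor_induction {β : Ordinal.{u}} {x y : C} {motive : (x ⟶ y) → Prop} {f : x ⟶ y}
    (hf : f ∈ R.lower β x y) (h0 : motive 0)
    (hadd : ∀ s t, motive s → motive t → motive (s + t))
    (hsmul : ∀ (r : k) t, motive t → motive (r • t))
    (h : ∀ (z : C) (m : x ⟶ z) (p : z ⟶ y), m ∈ R.minus.hom x z → p ∈ R.plus.hom z y →
      R.deg z < β → motive (m ≫ p)) :
    motive f := by
  refine R.lower_induction hf h0 hadd hsmul fun z g f hz => ?_
  -- `g = m ≫ p` through `z'`, and then `p ≫ f = m' ≫ p'` through `z''`.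
  refine R.factor_induction (motive := fun g => motive (g ≫ f)) g (by rwa [zero_comp])
    (fun s t hs ht => by rw [Preadditive.add_comp]; exact hadd _ _ hs ht)
    (fun r t ht => by rw [Linear.smul_comp]; exact hsmul _ _ ht) fun z' m p hm hp _ hz' => ?_
  rw [Category.assoc]
  have hz'β : R.deg z' < β := by
    rcases hz' with rfl | h
    · exact hz
    · exact h.trans hz
  refine R.factor_induction (motive := fun g => motive (m ≫ g)) (p ≫ f) (by rwa [comp_zero])
    (fun s t hs ht => by rw [Preadditive.comp_add]; exact hadd _ _ hs ht)
    (fun r t ht => by rw [Linear.comp_smul]; exact hsmul _ _ ht) fun z'' m' p' hm' hp' hz'' _ => ?_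
  rw [← Category.assoc]
  refine h z'' _ p' (R.minus.comp_mem hm hm') hp' ?_
  rcases hz'' with rfl | h
  · exact hz'β
  · exact h.trans hz'β

/-- A linear map out of `C(x, y)` is a family of balanced bilinear maps on Reedy
factorizations. -/
lemma exists_linearMap_of_balanced {x y : C} {J : Type u} [AddCommGroup J] [Module k J]
    (B : ∀ z : C, R.minus.hom x z →ₗ[k] R.plus.hom z y →ₗ[k] J)
    (hB : ∀ (z : C) (a : R.A z) (m : R.minus.hom x z) (p : R.plus.hom z y),
      B z (a • m) p = B z m (MulOpposite.op a • p)) :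
    ∃ H : (x ⟶ y) →ₗ[k] J, ∀ (z : C) (m : R.minus.hom x z) (p : R.plus.hom z y),
      H (m.1 ≫ p.1) = B z m p := by
  classical
  let e := LinearEquiv.ofBijective _ (R.factorization x y)
  let T : (⨁ z : C, LinearSubcategory.BalTensor R.plus R.minus x y z) →ₗ[k] J :=
    DirectSum.toModule k C J fun z =>
      (LinearSubcategory.balRel R.plus R.minus x y z).liftQ (TensorProduct.lift (B z).flip) (by
        refine Submodule.span_le.2 ?_
        rintro _ ⟨p, a, m, rfl⟩
        change _ = _
        rw [map_sub, TensorProduct.lift.tmul, TensorProduct.lift.tmul, sub_eq_zero]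
        exact (hB z a m p).symm)
  refine ⟨T.comp e.symm.toLinearMap, fun z m p => ?_⟩
  have h1 : e (DirectSum.lof k C _ z (Submodule.Quotient.mk (p ⊗ₜ[k] m))) = m.1 ≫ p.1 :=
    (DirectSum.toModule_lof k z _).trans rfl
  rw [← h1]
  change T (e.symm (e _)) = _
  rw [e.symm_apply_apply]
  exact (DirectSum.toModule_lof k z _).trans rfl

/-- The composition `C(x, -) ⊗ C(-, y) ⟶ C(x, y)`, with the tensor product taken over the objects
of degree less than `β`, is a split monomorphism: every balanced family of bilinear maps comes from
a linear map on `C(x, y)`. -/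
lemma exists_linearMap_of_natural (β : Ordinal.{u}) {x y : C} {J : Type u} [AddCommGroup J]
    [Module k J] (h : ∀ z : C, R.deg z < β → ((x ⟶ z) →ₗ[k] (z ⟶ y) →ₗ[k] J))
    (hnat : ∀ (z z' : C) (hz : R.deg z < β) (hz' : R.deg z' < β) (g : x ⟶ z) (e : z ⟶ z')
      (f : z' ⟶ y), h z' hz' (g ≫ e) f = h z hz g (e ≫ f)) :
    ∃ H : (x ⟶ y) →ₗ[k] J,
      ∀ (z : C) (hz : R.deg z < β) (g : x ⟶ z) (f : z ⟶ y), H (g ≫ f) = h z hz g f := by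
  classical
  obtain ⟨H, hH⟩ := R.exists_linearMap_of_balanced (x := x) (y := y) (J := J)
    (fun z => if hz : R.deg z < β then
      ((h z hz).domRestrict₁₂ (R.minus.hom x z) (R.plus.hom z y)) else 0) (by
    intro z a m p
    by_cases hz : R.deg z < β
    · simp only [dif_pos hz]
      exact hnat z z hz hz m.1 (show z ⟶ z from a.1) p.1
    · simp only [dif_neg hz]
      rfl)
  have hH' : ∀ (z : C) (hz : R.deg z < β) (m : x ⟶ z) (p : z ⟶ y), m ∈ R.minus.hom x z →
      p ∈ R.plus.hom z y → H (m ≫ p) = h z hz m p := by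
    intro z hz m p hm hp
    have := hH z ⟨m, hm⟩ ⟨p, hp⟩
    rw [dif_pos hz] at this
    exact this
  refine ⟨H, fun z hz g f => ?_⟩
  refine R.factor_induction (motive := fun g => H (g ≫ f) = h z hz g f) g
    (by rw [zero_comp, map_zero, map_zero, LinearMap.zero_apply])
    (fun s t hs ht => by rw [Preadditive.add_comp, map_add, hs, ht, map_add, LinearMap.add_apply])
    (fun r t ht => by rw [Linear.smul_comp, map_smul, ht, map_smul, LinearMap.smul_apply])
    fun z' m p hm hp _ hz' => ?_
  have hz'β : R.deg z' < β := by
    rcases hz' with rfl | h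
    · exact hz
    · exact h.trans hz
  rw [Category.assoc, hnat z' z hz'β hz m p f]
  refine R.factor_induction (motive := fun g => H (m ≫ g) = h z' hz'β m g) (p ≫ f)
    (by rw [comp_zero, map_zero, map_zero])
    (fun s t hs ht => by rw [Preadditive.comp_add, map_add, hs, ht, map_add])
    (fun r t ht => by rw [Linear.comp_smul, map_smul, ht, map_smul])
    fun z'' m' p' hm' hp' hz'' _ => ?_
  have hz''β : R.deg z'' < β := by
    rcases hz'' with rfl | h
    · exact hz'β
    · exact h.trans hz'β
  rw [← Category.assoc, hH' z'' hz''β _ p' (R.minus.comp_mem hm hm') hp', hnat z' z'' hz'β hz''β]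

lemma mem_lower_of_deg_eq {x y : C} (hxy : x ≠ y) (hd : R.deg x = R.deg y) (f : x ⟶ y) :
    f ∈ R.lower (R.deg x) x y := by
  refine R.factor_induction (motive := fun f => f ∈ R.lower (R.deg x) x y) f
    (Submodule.zero_mem _) (fun _ _ => Submodule.add_mem _)
    (fun r _ => Submodule.smul_mem _ r) fun z m p _ _ h1 h2 => comp_mem_lower ?_ _ _
  rcases h1 with rfl | h1
  · rcases h2 with rfl | h2
    · exact absurd rfl hxy
    · exact absurd h2 (by rw [hd]; exact lt_irrefl _)
  · exact h1

/-- The projection of `C(x, y)` to `C⁻(x, y)` along the morphisms through objects of degree less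
than `d(y)`. -/
lemma exists_minusProj (x y : C) : ∃ π : (x ⟶ y) →ₗ[k] R.minus.hom x y,
    (∀ m : R.minus.hom x y, π m.1 = m) ∧ (∀ t ∈ R.lower (R.deg y) x y, π t = 0) ∧
    ∀ t, t - (π t).1 ∈ R.lower (R.deg y) x y := by
  classical
  -- On factorizations through `z = y` the map is composition, on all others it is zero.
  let B₀ : R.minus.hom x y →ₗ[k] R.plus.hom y y →ₗ[k] R.minus.hom x y :=
    LinearMap.mk₂ k (fun m p => ⟨m.1 ≫ p.1,
        R.minus.comp_mem m.2 (by rw [← R.plus_eq_minus]; exact p.2)⟩)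
      (fun _ _ _ => Subtype.ext (Preadditive.add_comp _ _ _ _ _ _))
      (fun _ _ _ => Subtype.ext (Linear.smul_comp _ _ _ _ _ _))
      (fun _ _ _ => Subtype.ext (Preadditive.comp_add _ _ _ _ _ _))
      (fun _ _ _ => Subtype.ext (Linear.comp_smul _ _ _ _ _ _))
  let B : ∀ z : C, R.minus.hom x z →ₗ[k] R.plus.hom z y →ₗ[k] R.minus.hom x y := fun z =>
    if hz : z = y then by subst hz; exact B₀ else 0
  obtain ⟨H, hH⟩ := R.exists_linearMap_of_balanced B (by
    intro z a m p
    by_cases hz : z = y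
    · subst hz
      simp only [B, dif_pos]
      exact Subtype.ext (Category.assoc m.1 (show z ⟶ z from a.1) p.1)
    · simp only [B, dif_neg hz]
      rfl)
  have hy : ∀ (m : x ⟶ y) (p : y ⟶ y), m ∈ R.minus.hom x y → p ∈ R.plus.hom y y →
      (H (m ≫ p)).1 = m ≫ p := by
    intro m p hm hp
    have h1 := hH y ⟨m, hm⟩ ⟨p, hp⟩
    simp only [B, dif_pos] at h1
    rw [h1]
    rfl
  have hz : ∀ (z : C) (m : x ⟶ z) (p : z ⟶ y), m ∈ R.minus.hom x z → p ∈ R.plus.hom z y →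
      R.deg z < R.deg y → H (m ≫ p) = 0 := by
    intro z m p hm hp hlt
    have h1 := hH z ⟨m, hm⟩ ⟨p, hp⟩
    have hne : z ≠ y := fun h => absurd hlt (by rw [h]; exact lt_irrefl _)
    simp only [B, dif_neg hne] at h1
    exact h1
  refine ⟨H, fun m => Subtype.ext ?_, fun t ht => ?_, fun t => ?_⟩
  · have := hy m.1 (𝟙 y) m.2 (R.plus.id_mem y)
    rwa [Category.comp_id] at this
  · exact R.lower_factor_induction (motive := fun t => H t = 0) ht (map_zero _)
      (fun s t hs ht => by rw [map_add, hs, ht, add_zero])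
      (fun r t ht => by rw [map_smul, ht, smul_zero]) hz
  · refine R.factor_induction (motive := fun t => t - (H t).1 ∈ R.lower (R.deg y) x y) t
      (by rw [map_zero]; exact (sub_zero (0 : x ⟶ y)).symm ▸ Submodule.zero_mem _)
      (fun s t hs ht => ?_) (fun r t ht => ?_) (fun z m p hm hp _ h2 => ?_)
    · rw [map_add, Submodule.coe_add, add_sub_add_comm]
      exact Submodule.add_mem _ hs ht
    · rw [map_smul, Submodule.coe_smul, ← smul_sub]
      exact Submodule.smul_mem _ r ht
    · rcases h2 with rfl | h2
      · rw [hy m p hm hp, sub_self]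
        exact Submodule.zero_mem _
      · rw [hz z m p hm hp h2]
        exact (sub_zero (m ≫ p)).symm ▸ comp_mem_lower h2 m p

/-- The projection of `C(x, y)` to `C⁺(x, y)` along the morphisms through objects of degree less
than `d(x)`. -/
lemma exists_plusProj (x y : C) : ∃ π : (x ⟶ y) →ₗ[k] R.plus.hom x y,
    (∀ m : R.plus.hom x y, π m.1 = m) ∧ (∀ t ∈ R.lower (R.deg x) x y, π t = 0) ∧
    ∀ t, t - (π t).1 ∈ R.lower (R.deg x) x y := by
  classical
  let B₀ : R.minus.hom x x →ₗ[k] R.plus.hom x y →ₗ[k] R.plus.hom x y :=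
    LinearMap.mk₂ k (fun m p => ⟨m.1 ≫ p.1,
        R.plus.comp_mem (by rw [R.plus_eq_minus]; exact m.2) p.2⟩)
      (fun _ _ _ => Subtype.ext (Preadditive.add_comp _ _ _ _ _ _))
      (fun _ _ _ => Subtype.ext (Linear.smul_comp _ _ _ _ _ _))
      (fun _ _ _ => Subtype.ext (Preadditive.comp_add _ _ _ _ _ _))
      (fun _ _ _ => Subtype.ext (Linear.comp_smul _ _ _ _ _ _))
  let B : ∀ z : C, R.minus.hom x z →ₗ[k] R.plus.hom z y →ₗ[k] R.plus.hom x y := fun z =>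
    if hz : z = x then by subst hz; exact B₀ else 0
  obtain ⟨H, hH⟩ := R.exists_linearMap_of_balanced B (by
    intro z a m p
    by_cases hz : z = x
    · subst hz
      simp only [B, dif_pos]
      exact Subtype.ext (Category.assoc m.1 (show z ⟶ z from a.1) p.1)
    · simp only [B, dif_neg hz]
      rfl)
  have hx : ∀ (m : x ⟶ x) (p : x ⟶ y), m ∈ R.minus.hom x x → p ∈ R.plus.hom x y →
      (H (m ≫ p)).1 = m ≫ p := by
    intro m p hm hp
    have h1 := hH x ⟨m, hm⟩ ⟨p, hp⟩
    simp only [B, dif_pos] at h1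
    rw [h1]
    rfl
  have hz : ∀ (z : C) (m : x ⟶ z) (p : z ⟶ y), m ∈ R.minus.hom x z → p ∈ R.plus.hom z y →
      R.deg z < R.deg x → H (m ≫ p) = 0 := by
    intro z m p hm hp hlt
    have h1 := hH z ⟨m, hm⟩ ⟨p, hp⟩
    have hne : z ≠ x := fun h => absurd hlt (by rw [h]; exact lt_irrefl _)
    simp only [B, dif_neg hne] at h1
    exact h1
  refine ⟨H, fun m => Subtype.ext ?_, fun t ht => ?_, fun t => ?_⟩
  · have := hx (𝟙 x) m.1 (R.minus.id_mem x) m.2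
    rwa [Category.id_comp] at this
  · exact R.lower_factor_induction (motive := fun t => H t = 0) ht (map_zero _)
      (fun s t hs ht => by rw [map_add, hs, ht, add_zero])
      (fun r t ht => by rw [map_smul, ht, smul_zero]) hz
  · refine R.factor_induction (motive := fun t => t - (H t).1 ∈ R.lower (R.deg x) x y) t
      (by rw [map_zero]; exact (sub_zero (0 : x ⟶ y)).symm ▸ Submodule.zero_mem _)
      (fun s t hs ht => ?_) (fun r t ht => ?_) (fun z m p hm hp h1 _ => ?_)
    · rw [map_add, Submodule.coe_add, add_sub_add_comm]
      exact Submodule.add_mem _ hs ht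
    · rw [map_smul, Submodule.coe_smul, ← smul_sub]
      exact Submodule.smul_mem _ r ht
    · rcases h1 with rfl | h1
      · rw [hx m p hm hp, sub_self]
        exact Submodule.zero_mem _
      · rw [hz z m p hm hp h1]
        exact (sub_zero (m ≫ p)).symm ▸ comp_mem_lower h1 m p

end Factorization

end ReedyStructure

/-! ### Modules over a linear category, objectwise -/

section ModuleCategory

variable {k : Type u} [CommRing k] {C : Type u} [SmallCategory C] [Preadditive C] [Linear k C]

namespace LMod

/-- The `C`-module with prescribed values and action. -/
def ofData (V : C → Type u) [∀ x, AddCommGroup (V x)] [∀ x, Module k (V x)]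
    (act : ∀ x y : C, (x ⟶ y) →ₗ[k] V x →ₗ[k] V y) (hid : ∀ x v, act x x (𝟙 x) v = v)
    (hcomp : ∀ (x y z : C) (f : x ⟶ y) (g : y ⟶ z) (v), act x z (f ≫ g) v =
      act y z g (act x y f v)) : LMod k C where
  obj :=
    { obj := fun x => ModuleCat.of k (V x)
      map := fun {x y} f => ModuleCat.ofHom (act x y f)
      map_id := fun x => ModuleCat.hom_ext (LinearMap.ext (hid x))
      map_comp := fun {x y z} f g => ModuleCat.hom_ext (LinearMap.ext (hcomp x y z f g)) }
  property := ⟨⟨fun {x y f g} => ModuleCat.hom_ext (map_add (act x y) f g)⟩,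
    ⟨fun {x y} f r => ModuleCat.hom_ext (map_smul (act x y) r f)⟩⟩

lemma act_id (Y : LMod k C) {x : C} (v : Y.val x) : Y.act (𝟙 x) v = v := by
  change (Y.obj.map (𝟙 x)).hom v = v
  rw [CategoryTheory.Functor.map_id]
  rfl

/-- The action `C(x, y) ⊗ Y(x) ⟶ Y(y)` as a bilinear map. -/
def actₗ (Y : LMod k C) (x y : C) : (x ⟶ y) →ₗ[k] Y.val x →ₗ[k] Y.val y where
  toFun f := Y.act f
  map_add' f g := LinearMap.ext (Y.act_add f g)
  map_smul' r f := LinearMap.ext (Y.act_smul r f)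

@[simp] lemma actₗ_apply (Y : LMod k C) {x y : C} (f : x ⟶ y) (v : Y.val x) :
    Y.actₗ x y f v = Y.act f v := rfl

lemma act_zero (Y : LMod k C) {x y : C} (v : Y.val x) : Y.act (0 : x ⟶ y) v = 0 := by
  rw [← actₗ_apply, map_zero, LinearMap.zero_apply]

/-- The component at `x` of a morphism of `C`-modules. -/
def app {X Y : LMod k C} (f : X ⟶ Y) (x : C) : X.val x →ₗ[k] Y.val x := (f.hom.app x).hom

lemma app_act {X Y : LMod k C} (f : X ⟶ Y) {x y : C} (g : x ⟶ y) (v : X.val x) :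
    app f y (X.act g v) = Y.act g (app f x v) :=
  congrArg (fun t => t.hom v) (f.hom.naturality g)

@[simp] lemma app_comp {X Y Z : LMod k C} (f : X ⟶ Y) (g : Y ⟶ Z) (x : C) (v : X.val x) :
    app (f ≫ g) x v = app g x (app f x v) := rfl

lemma hom_ext {X Y : LMod k C} {f g : X ⟶ Y} (h : ∀ x v, app f x v = app g x v) : f = g := by
  refine ObjectProperty.hom_ext _ (NatTrans.ext (funext fun x => ModuleCat.hom_ext ?_))
  exact LinearMap.ext (h x)

lemma app_congr {X Y : LMod k C} {f g : X ⟶ Y} (h : f = g) (x : C) (v : X.val x) :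
    app f x v = app g x v := by rw [h]

/-- The morphism of `C`-modules with prescribed components. -/
def homOfApp {X Y : LMod k C} (f : ∀ x, X.val x →ₗ[k] Y.val x)
    (hf : ∀ (x y : C) (g : x ⟶ y) (v : X.val x), f y (X.act g v) = Y.act g (f x v)) : X ⟶ Y :=
  ObjectProperty.homMk
    { app := fun x => ModuleCat.ofHom (f x)
      naturality := fun x y g => ModuleCat.hom_ext (LinearMap.ext (hf x y g)) }

/-- The submodule of a `C`-module given by a stable family of submodules of its values. -/
def sub (Y : LMod k C) (N : ∀ x, Submodule k (Y.val x))
    (hN : ∀ (x y : C) (f : x ⟶ y), ∀ v ∈ N x, Y.act f v ∈ N y) : LMod k C :=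
  ofData (fun x => N x)
    (fun x y => LinearMap.mk₂ k (fun f v => ⟨Y.act f v.1, hN x y f v.1 v.2⟩)
      (fun f g v => Subtype.ext (Y.act_add f g v.1))
      (fun r f v => Subtype.ext (Y.act_smul r f v.1))
      (fun f v w => Subtype.ext (map_add (Y.act f) v.1 w.1))
      (fun r f v => Subtype.ext (map_smul (Y.act f) r v.1)))
    (fun x v => Subtype.ext (Y.act_id v.1))
    (fun x y z f g v => Subtype.ext (Y.act_comp f g v.1))

/-- The quotient of a `C`-module by a stable family of submodules of its values. -/
def quot (Y : LMod k C) (N : ∀ x, Submodule k (Y.val x))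
    (hN : ∀ (x y : C) (f : x ⟶ y), ∀ v ∈ N x, Y.act f v ∈ N y) : LMod k C :=
  ofData (fun x => Y.val x ⧸ N x)
    (fun x y =>
      { toFun := fun f => (N x).mapQ (N y) (Y.act f) (hN x y f)
        map_add' := fun f g => LinearMap.ext fun q => by
          obtain ⟨v, rfl⟩ := Submodule.Quotient.mk_surjective _ q
          exact congrArg Submodule.Quotient.mk (Y.act_add f g v)
        map_smul' := fun r f => LinearMap.ext fun q => by
          obtain ⟨v, rfl⟩ := Submodule.Quotient.mk_surjective _ q
          exact congrArg Submodule.Quotient.mk (Y.act_smul r f v) })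
    (fun x q => by
      obtain ⟨v, rfl⟩ := Submodule.Quotient.mk_surjective _ q
      exact congrArg Submodule.Quotient.mk (Y.act_id v))
    (fun x y z f g q => by
      obtain ⟨v, rfl⟩ := Submodule.Quotient.mk_surjective _ q
      exact congrArg Submodule.Quotient.mk (Y.act_comp f g v))

/-- The direct sum of two `C`-modules. -/
def prod (X Y : LMod k C) : LMod k C :=
  ofData (fun x => X.val x × Y.val x)
    (fun x y => LinearMap.mk₂ k (fun f v => (X.act f v.1, Y.act f v.2))
      (fun f g v => Prod.ext (X.act_add f g v.1) (Y.act_add f g v.2))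
      (fun r f v => Prod.ext (X.act_smul r f v.1) (Y.act_smul r f v.2))
      (fun f v w => Prod.ext (map_add (X.act f) v.1 w.1) (map_add (Y.act f) v.2 w.2))
      (fun r f v => Prod.ext (map_smul (X.act f) r v.1) (map_smul (Y.act f) r v.2)))
    (fun x v => Prod.ext (X.act_id v.1) (Y.act_id v.2))
    (fun x y z f g v => Prod.ext (X.act_comp f g v.1) (Y.act_comp f g v.2))

variable (k) in
/-- The representable `C`-module `C(x, -)`. -/
def repr (x : C) : LMod k C :=
  ofData (fun y => (x ⟶ y)) (fun y z => (Linear.comp (S := k) x y z).flip)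
    (fun _ f => Category.comp_id f) (fun _ _ _ f g h => (Category.assoc h f g).symm)

/-- The inclusion of the objectwise kernel of a morphism. -/
def kerι {X Y : LMod k C} (f : X ⟶ Y) :
    X.sub (fun x => LinearMap.ker (app f x)) (fun x y g v hv => by
      rw [LinearMap.mem_ker] at hv ⊢
      rw [app_act, hv, map_zero]) ⟶ X :=
  homOfApp (fun x => (LinearMap.ker (app f x)).subtype) fun _ _ _ _ => rfl

/-- The projection to the objectwise cokernel of a morphism. -/
def cokerπ {X Y : LMod k C} (f : X ⟶ Y) :
    Y ⟶ Y.quot (fun x => LinearMap.range (app f x)) (fun x y g v hv => by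
      obtain ⟨w, rfl⟩ := hv
      exact ⟨X.act g w, app_act f g w⟩) :=
  homOfApp (fun x => (LinearMap.range (app f x)).mkQ) fun _ _ _ _ => rfl

lemma mono_iff {X Y : LMod k C} (f : X ⟶ Y) :
    Mono f ↔ ∀ x, Function.Injective (app f x) := by
  constructor
  · intro hf x
    have h : kerι f = 0 := by
      rw [← cancel_mono f, zero_comp]
      exact hom_ext fun x v => Subtype.property (p := fun v => app f x v = 0) v
    refine (injective_iff_map_eq_zero _).2 fun v hv => ?_
    let u : LinearMap.ker (app f x) := ⟨v, hv⟩
    exact app_congr h x u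
  · intro hf
    refine ⟨fun g h hgh => hom_ext fun x v => hf x ?_⟩
    exact congrArg (fun t => app t x v) hgh

lemma epi_iff {X Y : LMod k C} (f : X ⟶ Y) :
    Epi f ↔ ∀ x, Function.Surjective (app f x) := by
  constructor
  · intro hf x v
    have h : cokerπ f = 0 := by
      rw [← cancel_epi f, comp_zero]
      exact hom_ext fun x v => (Submodule.Quotient.mk_eq_zero _).2 ⟨v, rfl⟩
    exact (Submodule.Quotient.mk_eq_zero _).1 (congrArg (fun t => app t x v) h)
  · intro hf
    refine ⟨fun g h hgh => hom_ext fun x v => ?_⟩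
    obtain ⟨w, rfl⟩ := hf x v
    exact congrArg (fun t => app t x w) hgh

lemma shortExact_of_app {X Y Z : LMod k C} (f : X ⟶ Y) (g : Y ⟶ Z)
    (hf : ∀ x, Function.Injective (app f x)) (hg : ∀ x, Function.Surjective (app g x))
    (hfg : ∀ x v, app g x v = 0 ↔ ∃ w, app f x w = v) :
    ∃ w : f ≫ g = 0, (ShortComplex.mk f g w).ShortExact := by
  have w : f ≫ g = 0 := hom_ext fun x v => (hfg x _).2 ⟨v, rfl⟩
  have hmono := (mono_iff f).2 hf
  have hepi := (epi_iff g).2 hg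
  refine ⟨w, { exact := ShortComplex.exact_of_f_is_kernel _ ?_ }⟩
  have hl : ∀ {W : LMod k C} (t : W ⟶ Y), t ≫ g = 0 → ∀ x, ∃ l : W.val x →ₗ[k] X.val x,
      ∀ v, app f x (l v) = app t x v := by
    intro W t ht x
    have hr : ∀ v, app t x v ∈ LinearMap.range (app f x) := fun v =>
      (hfg x _).1 (congrArg (fun s => app s x v) ht)
    refine ⟨(LinearEquiv.ofInjective (app f x) (hf x)).symm.toLinearMap.comp
      ((app t x).codRestrict _ hr), fun v => ?_⟩
    exact congrArg Subtype.val
      ((LinearEquiv.ofInjective (app f x) (hf x)).apply_symm_apply ⟨app t x v, hr v⟩)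
  refine KernelFork.IsLimit.ofι f w
    (fun {W} t ht => homOfApp (fun x => (hl t ht x).choose) fun x y e v => hf y ?_)
    (fun {W} t ht => hom_ext fun x v => (hl t ht x).choose_spec v)
    (fun {W} t ht m hm => hom_ext fun x v => hf x ?_)
  · rw [app_act]
    exact ((hl t ht y).choose_spec _).trans
      ((app_act t e v).trans (congrArg (Y.act e) ((hl t ht x).choose_spec v).symm))
  · exact (congrArg (fun s => app s x v) hm).trans ((hl t ht x).choose_spec v).symm

lemma exists_of_app_eq_zero {S : ShortComplex (LMod k C)} (hS : S.ShortExact) {x : C}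
    {v : S.X₂.val x} (hv : app S.g x v = 0) : ∃ w, app S.f x w = v := by
  have := hS.mono_f
  obtain ⟨l, hl⟩ := KernelFork.IsLimit.lift' hS.exact.fIsKernel (kerι S.g)
    (hom_ext fun x v => Subtype.property (p := fun v => app S.g x v = 0) v)
  let u : LinearMap.ker (app S.g x) := ⟨v, hv⟩
  exact ⟨app l x u, app_congr hl x u⟩

lemma app_g_f {S : ShortComplex (LMod k C)} {x : C} (v : S.X₁.val x) :
    app S.g x (app S.f x v) = 0 := congrArg (fun t => app t x v) S.zero

end LMod

end ModuleCategory

/-! ### Functoriality of latching and matching objects -/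

section Functoriality

variable {k : Type u} [CommRing k] {C : Type u} [SmallCategory C] [Preadditive C] [Linear k C]

namespace ReedyStructure

open LMod

variable (R : ReedyStructure k C)

/-- The component at `x` of a morphism of `C`-modules, as a map of `A⁰_x`-modules. -/
def appA {X Y : LMod k C} (f : X ⟶ Y) (x : C) : X.val x →ₗ[R.A x] Y.val x where
  toFun := app f x
  map_add' := map_add _
  map_smul' a v := app_act f _ v

/-- A family of maps `X(y) ⟶ Y(y)`, for `d(y) < β`, that is natural on the full subcategory of the
objects of degree less than `β`. -/
def NaturalBelow (β : Ordinal.{u}) {X Y : LMod k C} (s : ∀ y, X.val y →ₗ[k] Y.val y) : Prop :=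
  ∀ (y z : C) (f : y ⟶ z), R.deg y < β → R.deg z < β → ∀ v, s z (X.act f v) = Y.act f (s y v)

variable {R} in
lemma naturalBelow_app (β : Ordinal.{u}) {X Y : LMod k C} (f : X ⟶ Y) :
    R.NaturalBelow β (app f) := fun _ _ g _ _ v => app_act f g v

section Latching

variable (Y : LMod k C) (x : C)

open Classical in
/-- The class of `φ ⊗ ξ` in the latching object. -/
def lmk (y : R.Below x) : (y.1 ⟶ x) →ₗ[k] Y.val y.1 →ₗ[k] R.Latching Y x :=
  (TensorProduct.mk k (y.1 ⟶ x) (Y.val y.1)).compr₂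
    (((R.latchingRel Y x).mkQ.restrictScalars k).comp
      ((DirectSum.lof (R.A x) _ (fun y : R.Below x => (y.1 ⟶ x) ⊗[k] Y.val y.1) y).restrictScalars
        k))

variable {Y x}

lemma lmk_comp (y z : R.Below x) (f : y.1 ⟶ z.1) (φ : z.1 ⟶ x) (ξ : Y.val y.1) :
    R.lmk Y x y (f ≫ φ) ξ = R.lmk Y x z φ (Y.act f ξ) :=
  (Submodule.Quotient.eq _).2 (Submodule.subset_span ⟨y, z, f, φ, ξ, rfl⟩)

lemma smul_lmk (a : R.A x) (y : R.Below x) (φ : y.1 ⟶ x) (ξ : Y.val y.1) :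
    a • R.lmk Y x y φ ξ = R.lmk Y x y (φ ≫ (show x ⟶ x from a.1)) ξ := by
  classical
  let ι := DirectSum.lof (R.A x) _ (fun y : R.Below x => (y.1 ⟶ x) ⊗[k] Y.val y.1) y
  have h : a • ι (φ ⊗ₜ[k] ξ) = ι (a • (φ ⊗ₜ[k] ξ)) := (map_smul ι a _).symm
  exact congrArg (R.latchingRel Y x).mkQ h

@[simp] lemma latchingMap_lmk (y : R.Below x) (φ : y.1 ⟶ x) (ξ : Y.val y.1) :
    R.latchingMap Y x (R.lmk Y x y φ ξ) = Y.act φ ξ := by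
  classical
  let T := DirectSum.toModule (R.A x) (R.Below x) (Y.val x) fun y => R.actTensor Y x y.1
  have hT : T (DirectSum.lof (R.A x) _ (fun y : R.Below x => (y.1 ⟶ x) ⊗[k] Y.val y.1) y
      (φ ⊗ₜ[k] ξ)) = Y.act φ ξ := (DirectSum.toModule_lof (R.A x) y _).trans rfl
  exact hT

lemma latching_induction {motive : R.Latching Y x → Prop} (t : R.Latching Y x) (h0 : motive 0)
    (hadd : ∀ s t, motive s → motive t → motive (s + t))
    (h : ∀ y φ ξ, motive (R.lmk Y x y φ ξ)) : motive t := by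
  classical
  obtain ⟨t, rfl⟩ := Submodule.Quotient.mk_surjective _ t
  induction t using DirectSum.induction_on with
  | zero => exact h0
  | add s t hs ht => exact hadd _ _ hs ht
  | of y t =>
    induction t using TensorProduct.induction_on with
    | zero => rw [map_zero]; exact h0
    | add s t hs ht => rw [map_add]; exact hadd _ _ hs ht
    | tmul φ ξ => exact h y φ ξ

lemma act_mem_range_latchingMap {y : C} (hy : R.deg y < R.deg x) (φ : y ⟶ x) (ξ : Y.val y) :
    Y.act φ ξ ∈ LinearMap.range (R.latchingMap Y x) :=
  ⟨R.lmk Y x ⟨y, hy⟩ φ ξ, R.latchingMap_lmk ⟨y, hy⟩ φ ξ⟩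

open Classical in
/-- The universal property of the latching object. -/
lemma exists_latchingDesc {N : Type u} [AddCommGroup N] [Module k N] [Module (R.A x) N]
    [SMulCommClass k (R.A x) N] [IsScalarTower k (R.A x) N]
    (b : ∀ y : R.Below x, (y.1 ⟶ x) →ₗ[R.A x] Y.val y.1 →ₗ[k] N)
    (hb : ∀ (y z : R.Below x) (f : y.1 ⟶ z.1) (φ : z.1 ⟶ x) (ξ : Y.val y.1),
      b y (f ≫ φ) ξ = b z φ (Y.act f ξ)) :
    ∃ L : R.Latching Y x →ₗ[R.A x] N, ∀ y φ ξ, L (R.lmk Y x y φ ξ) = b y φ ξ := by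
  let T := DirectSum.toModule (R.A x) (R.Below x) N fun y =>
    TensorProduct.AlgebraTensorModule.lift (b y)
  have hT : ∀ (y : R.Below x) (φ : y.1 ⟶ x) (ξ : Y.val y.1), T (DirectSum.lof (R.A x) _
      (fun y : R.Below x => (y.1 ⟶ x) ⊗[k] Y.val y.1) y (φ ⊗ₜ[k] ξ)) = b y φ ξ :=
    fun y φ ξ => (DirectSum.toModule_lof (R.A x) y _).trans rfl
  refine ⟨(R.latchingRel Y x).liftQ T ?_, hT⟩
  refine Submodule.span_le.2 ?_
  rintro t ⟨y, z, f, φ, ξ, rfl⟩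
  change T _ = 0
  rw [map_sub, sub_eq_zero]
  exact (hT y _ ξ).trans ((hb y z f φ ξ).trans (hT z _ _).symm)

lemma exists_latchingFunc {Z : LMod k C} (s : ∀ y, Y.val y →ₗ[k] Z.val y)
    (hs : R.NaturalBelow (R.deg x) s) : ∃ L : R.Latching Y x →ₗ[R.A x] R.Latching Z x,
      ∀ y φ ξ, L (R.lmk Y x y φ ξ) = R.lmk Z x y φ (s y.1 ξ) := by
  refine R.exists_latchingDesc (fun y =>
    { toFun := fun φ => (R.lmk Z x y φ).comp (s y.1)
      map_add' := fun φ ψ => by rw [map_add, LinearMap.add_comp]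
      map_smul' := fun a φ => LinearMap.ext fun v => (R.smul_lmk a y φ (s y.1 v)).symm }) ?_
  intro y z f φ ξ
  change R.lmk Z x y (f ≫ φ) (s y.1 ξ) = R.lmk Z x z φ (s z.1 (Y.act f ξ))
  rw [hs y.1 z.1 f y.2 z.2, lmk_comp]

variable (x) in
/-- The map of latching objects at `x` induced by a family that is natural below `d(x)`. -/
def latchingFunc {Z : LMod k C} (s : ∀ y, Y.val y →ₗ[k] Z.val y)
    (hs : R.NaturalBelow (R.deg x) s) : R.Latching Y x →ₗ[R.A x] R.Latching Z x :=
  (R.exists_latchingFunc s hs).choose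

@[simp] lemma latchingFunc_lmk {Z : LMod k C} (s : ∀ y, Y.val y →ₗ[k] Z.val y)
    (hs : R.NaturalBelow (R.deg x) s) (y : R.Below x) (φ : y.1 ⟶ x) (ξ : Y.val y.1) :
    R.latchingFunc x s hs (R.lmk Y x y φ ξ) = R.lmk Z x y φ (s y.1 ξ) :=
  (R.exists_latchingFunc s hs).choose_spec y φ ξ

lemma latchingMap_naturality {Z : LMod k C} (f : Y ⟶ Z) (t : R.Latching Y x) :
    R.latchingMap Z x (R.latchingFunc x (app f) (naturalBelow_app _ f) t) =
      app f x (R.latchingMap Y x t) := by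
  refine R.latching_induction (motive := fun t => R.latchingMap Z x (R.latchingFunc x (app f)
    (naturalBelow_app _ f) t) = app f x (R.latchingMap Y x t)) t ?_ ?_ ?_
  · simp only [map_zero]
  · intro s t hs ht
    simp only [map_add, hs, ht]
  · intro y φ ξ
    rw [latchingFunc_lmk, latchingMap_lmk, latchingMap_lmk, app_act]

end Latching

section Matching

variable {Y : LMod k C} {x : C}

lemma matching_ext {h h' : R.Matching Y x} (H : ∀ y φ, h.1 y φ = h'.1 y φ) : h = h' :=
  Subtype.ext (funext fun y => LinearMap.ext (H y))

lemma matching_act (h : R.Matching Y x) {y z : R.Below x} (f : y.1 ⟶ z.1) (φ : x ⟶ y.1) :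
    Y.act f (h.1 y φ) = h.1 z (φ ≫ f) := (h.2 y z f φ).symm

/-- The map of matching objects at `x` induced by a family that is natural below `d(x)`. -/
def matchingFunc {Z : LMod k C} (s : ∀ y, Y.val y →ₗ[k] Z.val y)
    (hs : R.NaturalBelow (R.deg x) s) : R.Matching Y x →ₗ[R.A x] R.Matching Z x where
  toFun h := ⟨fun y => (s y.1).comp (h.1 y), fun y z f φ => by
    change s z.1 (h.1 z (φ ≫ f)) = Z.act f (s y.1 (h.1 y φ))
    rw [h.2 y z f φ, hs y.1 z.1 f y.2 z.2]⟩
  map_add' g h := R.matching_ext fun y φ => map_add (s y.1) _ _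
  map_smul' a h := rfl

end Matching

end ReedyStructure

end Functoriality

/-! ### Lifting morphisms degree by degree -/

section Lifting

variable {k : Type u} [CommRing k] {C : Type u} [SmallCategory C] [Preadditive C] [Linear k C]

namespace ReedyStructure

open LMod

variable (R : ReedyStructure k C)

section RelativeMatching

variable {E B : LMod k C} (p : E ⟶ B) (x : C)

/-- The relative matching object `M_x E ×_{M_x B} B(x)` of a morphism `p : E ⟶ B`. -/
def RelMatching : Submodule (R.A x) (R.Matching E x × B.val x) :=
  LinearMap.eqLocus
    ((R.matchingFunc (app p) (naturalBelow_app _ p)).comp (LinearMap.fst (R.A x) _ _))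
    ((R.matchingMap B x).comp (LinearMap.snd (R.A x) _ _))

/-- The relative matching morphism `E(x) ⟶ M_x E ×_{M_x B} B(x)` of a morphism `p : E ⟶ B`. -/
def relMatchingMap : E.val x →ₗ[R.A x] R.RelMatching p x :=
  ((R.matchingMap E x).prod (R.appA p x)).codRestrict _ fun ξ =>
    R.matching_ext fun _ φ => app_act p φ ξ

variable {p x}

lemma mem_relMatching {t : R.Matching E x × B.val x} :
    t ∈ R.RelMatching p x ↔ ∀ y φ, app p y.1 (t.1.1 y φ) = B.act φ t.2 :=
  ⟨fun h y φ => congrArg (fun m => m.1 y φ) h, fun h => R.matching_ext h⟩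

@[simp] lemma relMatchingMap_snd (ξ : E.val x) :
    (R.relMatchingMap p x ξ).1.2 = app p x ξ := rfl

lemma relMatchingMap_eq_iff {ξ : E.val x} {t : R.RelMatching p x} :
    R.relMatchingMap p x ξ = t ↔ (∀ y φ, E.act φ ξ = t.1.1.1 y φ) ∧ app p x ξ = t.1.2 := by
  constructor
  · rintro rfl
    exact ⟨fun _ _ => rfl, rfl⟩
  · rintro ⟨h₁, h₂⟩
    exact Subtype.ext (Prod.ext (R.matching_ext h₁) h₂)

lemma mem_ker_relMatchingMap {ξ : E.val x} :
    ξ ∈ LinearMap.ker (R.relMatchingMap p x) ↔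
      (∀ (y : R.Below x) (φ : x ⟶ y.1), E.act φ ξ = 0) ∧ app p x ξ = 0 := by
  rw [LinearMap.mem_ker, relMatchingMap_eq_iff]
  rfl

/-- The relative matching morphism of an epimorphism is surjective if the matching morphism of its
kernel is. -/
lemma relMatchingMap_surjective {K : LMod k C} {i : K ⟶ E} (hi : ∀ y, Function.Injective (app i y))
    (hp : Function.Surjective (app p x)) (hip : ∀ y v, app p y v = 0 ↔ ∃ w, app i y w = v)
    (hK : Function.Surjective (R.matchingMap K x)) :
    Function.Surjective (R.relMatchingMap p x) := by
  rintro ⟨⟨μ, b⟩, hμ⟩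
  rw [mem_relMatching] at hμ
  obtain ⟨e, rfl⟩ := hp b
  -- The difference of `μ` and the image of `e` comes from the matching object of the kernel.
  have hd : ∀ (y : R.Below x) (φ : x ⟶ y.1), μ.1 y φ - E.act φ e ∈ LinearMap.range (app i y.1) := by
    intro y φ
    refine (hip y.1 _).1 ?_
    rw [map_sub, app_act, hμ y φ, sub_self]
  let δ : ∀ y : R.Below x, (x ⟶ y.1) →ₗ[k] K.val y.1 := fun y =>
    (LinearEquiv.ofInjective (app i y.1) (hi y.1)).symm.toLinearMap.comp
      ((μ.1 y - (R.matchingMap E x e).1 y).codRestrict _ (hd y))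
  have hδ : ∀ y φ, app i y.1 (δ y φ) = μ.1 y φ - E.act φ e := fun y φ =>
    congrArg Subtype.val ((LinearEquiv.ofInjective (app i y.1) (hi y.1)).apply_symm_apply
      ⟨_, hd y φ⟩)
  obtain ⟨κ, hκ⟩ := hK ⟨δ, fun y z f φ => hi z.1 (by
    rw [hδ, app_act, hδ, map_sub, R.matching_act, act_comp])⟩
  refine ⟨e + app i x κ, (R.relMatchingMap_eq_iff).2 ⟨fun y φ => ?_, ?_⟩⟩
  · have h1 : K.act φ κ = δ y φ := congrArg (fun m => m.1 y φ) hκ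
    rw [map_add, ← app_act, h1, hδ]
    exact add_sub_cancel _ _
  · rw [map_add, (hip x _).2 ⟨κ, rfl⟩, add_zero]

/-- The kernel of the relative matching morphism of an epimorphism is the kernel of the matching
morphism of its kernel. -/
def kerRelMatchingEquiv {K : LMod k C} (i : K ⟶ E) (hi : ∀ y, Function.Injective (app i y))
    (hip : ∀ y v, app p y v = 0 ↔ ∃ w, app i y w = v) :
    LinearMap.ker (R.matchingMap K x) ≃ₗ[R.A x] LinearMap.ker (R.relMatchingMap p x) :=
  LinearEquiv.ofBijective
    (((R.appA i x).comp (LinearMap.ker (R.matchingMap K x)).subtype).codRestrict _ (by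
      intro ξ
      refine (R.mem_ker_relMatchingMap).2 ⟨fun y φ => ?_, (hip x _).2 ⟨ξ.1, rfl⟩⟩
      have h1 : K.act φ ξ.1 = 0 := congrArg (fun m => m.1 y φ) ξ.2
      change E.act φ (app i x ξ.1) = 0
      rw [← app_act, h1, map_zero]))
    (by
      constructor
      · intro a b hab
        exact Subtype.ext (hi x (congrArg Subtype.val hab))
      · rintro ⟨ξ, hξ⟩
        obtain ⟨h1, h2⟩ := (R.mem_ker_relMatchingMap).1 hξ
        obtain ⟨w, rfl⟩ := (hip x ξ).1 h2
        refine ⟨⟨w, R.matching_ext fun y φ => hi y.1 ?_⟩, rfl⟩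
        exact (app_act i φ w).trans ((h1 y φ).trans (map_zero _).symm))

end RelativeMatching

/-- An `A⁰_x`-linear map between values at `x`, as a `k`-linear map. -/
def restrictK {X E : LMod k C} {x : C} (t : X.val x →ₗ[R.A x] E.val x) :
    X.val x →ₗ[k] E.val x where
  toFun := t
  map_add' := map_add t
  map_smul' r v := by
    have h := map_smul t (algebraMap k (R.A x) r) v
    rwa [algebraMap_smul (R.A x) r v, algebraMap_smul (R.A x) r (t v)] at h

variable {X E B : LMod k C} (p : E ⟶ B) (b : ∀ y, X.val y →ₗ[k] B.val y)

/-- The conditions on `t : X(x) ⟶ E(x)` under which it extends a lift `s` of `b` on the objects of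
degree less than `d(x)`. -/
structure IsLiftStep (x : C) (s : ∀ y, R.deg y < R.deg x → (X.val y →ₗ[k] E.val y))
    (t : X.val x →ₗ[k] E.val x) : Prop where
  smul (a : R.A x) (v : X.val x) : t (a • v) = a • t v
  lift (v : X.val x) : app p x (t v) = b x v
  up {y : C} (hy : R.deg y < R.deg x) (f : y ⟶ x) (v : X.val y) : t (X.act f v) = E.act f (s y hy v)
  down {y : C} (hy : R.deg y < R.deg x) (f : x ⟶ y) (v : X.val x) :
    s y hy (X.act f v) = E.act f (t v)

open Classical in
/-- A lift of `b` along `p`, chosen by recursion on the degree. -/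
def liftRec : ∀ x, X.val x →ₗ[k] E.val x :=
  (InvImage.wf R.deg Ordinal.lt_wf).fix fun x s =>
    if h : ∃ t, R.IsLiftStep p b x s t then h.choose else 0

variable {p b}

lemma isLiftStep_liftRec {x : C}
    (h : ∃ t, R.IsLiftStep p b x (fun y _ => R.liftRec p b y) t) :
    R.IsLiftStep p b x (fun y _ => R.liftRec p b y) (R.liftRec p b x) := by
  have h1 : R.liftRec p b x = h.choose := by
    conv_lhs => rw [liftRec, WellFounded.fix_eq]
    exact dif_pos h
  rw [h1]
  exact h.choose_spec

lemma naturalBelow_of_isLiftStep {β : Ordinal.{u}} {s : ∀ y, X.val y →ₗ[k] E.val y}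
    (h : ∀ y, R.deg y < β → R.IsLiftStep p b y (fun z _ => s z) (s y)) :
    R.NaturalBelow β s := by
  have hlow : ∀ (y z : C), R.deg y < β → R.deg y = R.deg z → ∀ f ∈ R.lower (R.deg y) y z,
      ∀ v, s z (X.act f v) = E.act f (s y v) := by
    intro y z hy hyz f hf v
    refine R.lower_induction (motive := fun f => s z (X.act f v) = E.act f (s y v)) hf
      (by rw [act_zero, act_zero, map_zero])
      (fun f g hf hg => by rw [act_add, act_add, map_add, hf, hg])
      (fun r f hf => by rw [act_smul, act_smul, map_smul, hf]) fun w g e hw => ?_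
    rw [act_comp, act_comp, (h z (hyz ▸ hy)).up (hyz ▸ hw), (h y hy).down hw]
  intro y z f hy hz v
  rcases lt_trichotomy (R.deg y) (R.deg z) with hlt | heq | hlt
  · exact (h z hz).up hlt f v
  · by_cases hyz : y = z
    · subst hyz
      obtain ⟨π, -, -, hπ⟩ := R.exists_minusProj y y
      have hmem : (π f).1 ∈ (R.plus.inter R.minus).hom y y :=
        ⟨by rw [R.plus_eq_minus]; exact (π f).2, (π f).2⟩
      let a : R.A y := ⟨(π f).1, hmem⟩
      have h1 := hlow y y hy rfl _ (hπ f) v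
      have h2 : s y (X.act (π f).1 v) = E.act (π f).1 (s y v) := (h y hy).smul a v
      have h3 : f = (f - (π f).1) + (π f).1 := (sub_add_cancel _ _).symm
      rw [h3, act_add, act_add, map_add, h1, h2]
    · exact hlow y z hy heq f (R.mem_lower_of_deg_eq hyz heq f) v
  · exact (h y hy).down hlt f v

set_option maxHeartbeats 1000000 in
/-- Let `X` have injective latching morphisms and `p : E ⟶ B` surjective relative matching
morphisms. If the cokernels of the former are orthogonal to the kernels of the latter, then
morphisms `X ⟶ B` lift along `p`; all this on the full subcategory of the objects of degree less
than `α`. -/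
theorem exists_lift_below (α : Ordinal.{u}) (hb : R.NaturalBelow α b)
    (hX : ∀ x, R.deg x < α → Function.Injective (R.latchingMap X x))
    (hp : ∀ x, R.deg x < α → Function.Surjective (R.relMatchingMap p x))
    (hext : ∀ x, R.deg x < α → ExtOneVanishes
      (ModuleCat.of (R.A x) (X.val x ⧸ LinearMap.range (R.latchingMap X x)))
      (ModuleCat.of (R.A x) (LinearMap.ker (R.relMatchingMap p x)))) :
    ∃ s : ∀ y, X.val y →ₗ[k] E.val y, R.NaturalBelow α s ∧
      ∀ y, R.deg y < α → ∀ v, app p y (s y v) = b y v := by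
  suffices h : ∀ x, R.deg x < α →
      R.IsLiftStep p b x (fun y _ => R.liftRec p b y) (R.liftRec p b x) from
    ⟨R.liftRec p b, R.naturalBelow_of_isLiftStep h, fun y hy => (h y hy).lift⟩
  intro x
  induction x using (InvImage.wf R.deg Ordinal.lt_wf).induction with
  | _ x ih =>
  intro hx
  have ih' : ∀ y, R.deg y < R.deg x →
      R.IsLiftStep p b y (fun y _ => R.liftRec p b y) (R.liftRec p b y) :=
    fun y hy => ih y hy (hy.trans hx)
  set s := R.liftRec p b with hs_def
  have hs : R.NaturalBelow (R.deg x) s := R.naturalBelow_of_isLiftStep ih'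
  refine R.isLiftStep_liftRec ?_
  rw [← hs_def]
  let u : R.Latching X x →ₗ[R.A x] E.val x := (R.latchingMap E x).comp (R.latchingFunc x s hs)
  let bA : X.val x →ₗ[R.A x] B.val x :=
    { toFun := b x
      map_add' := map_add (b x)
      map_smul' := fun a v => hb x x a.1 hx hx v }
  let w : X.val x →ₗ[R.A x] R.RelMatching p x :=
    (((R.matchingFunc s hs).comp (R.matchingMap X x)).prod bA).codRestrict _ fun v => by
      refine (R.mem_relMatching).2 fun y φ => ?_
      change app p y.1 (s y.1 (X.act φ v)) = B.act φ (b x v)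
      rw [(ih' y.1 y.2).lift, hb x y.1 φ hx (y.2.trans hx)]
  have huw : ∀ l, R.relMatchingMap p x (u l) = w (R.latchingMap X x l) := by
    intro l
    refine R.latching_induction
      (motive := fun l => R.relMatchingMap p x (u l) = w (R.latchingMap X x l)) l
      ((congrArg _ (map_zero u)).trans ((map_zero _).trans
        ((congrArg w (map_zero (R.latchingMap X x))).trans (map_zero w)).symm))
      (fun l l' h h' => ?_) (fun y φ ξ => ?_)
    · rw [map_add u, map_add (R.relMatchingMap p x), map_add (R.latchingMap X x), map_add w, h, h']
    have h1 : u (R.lmk X x y φ ξ) = E.act φ (s y.1 ξ) := by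
      change R.latchingMap E x (R.latchingFunc x s hs _) = _
      rw [latchingFunc_lmk, latchingMap_lmk]
    rw [h1, latchingMap_lmk, relMatchingMap_eq_iff]
    constructor
    · intro z ψ
      change E.act ψ (E.act φ (s y.1 ξ)) = s z.1 (X.act ψ (X.act φ ξ))
      rw [← act_comp, ← act_comp, hs y.1 z.1 _ y.2 z.2]
    · change app p x (E.act φ (s y.1 ξ)) = b x (X.act φ ξ)
      rw [app_act, (ih' y.1 y.2).lift, hb y.1 x φ (y.2.trans hx) hx]
  have hlift := @exists_diagonal_lift (R.A x) _ (R.Latching X x) (X.val x) (E.val x)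
    (R.RelMatching p x) _ _ _ _ _ _ _ _ (R.latchingMap X x) (hX x hx) (R.relMatchingMap p x)
    (hp x hx)
  obtain ⟨t, ht₁, ht₂⟩ := hlift (hext x hx) u w huw
  refine ⟨R.restrictK t,
    fun a v => map_smul t a v, fun v => ?_, fun {y} hy f v => ?_, fun {y} hy f v => ?_⟩
  · exact ((R.relMatchingMap_eq_iff).1 (ht₂ v)).2
  · have h1 := ht₁ (R.lmk X x ⟨y, hy⟩ f v)
    rw [latchingMap_lmk] at h1
    refine h1.trans ?_
    change R.latchingMap E x (R.latchingFunc x s hs _) = _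
    rw [latchingFunc_lmk, latchingMap_lmk]
  · exact (((R.relMatchingMap_eq_iff).1 (ht₂ v)).1 ⟨y, hy⟩ f).symm

/-- A version of `exists_lift_below` for all degrees at once. -/
theorem exists_lift (b : X ⟶ B) (hX : ∀ x, Function.Injective (R.latchingMap X x))
    (hp : ∀ x, Function.Surjective (R.relMatchingMap p x))
    (hext : ∀ x, ExtOneVanishes
      (ModuleCat.of (R.A x) (X.val x ⧸ LinearMap.range (R.latchingMap X x)))
      (ModuleCat.of (R.A x) (LinearMap.ker (R.relMatchingMap p x)))) :
    ∃ s : X ⟶ E, s ≫ p = b := by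
  obtain ⟨s, hs, hsp⟩ := R.exists_lift_below (p := p) (b := app b) R.lam (naturalBelow_app _ b)
    (fun x _ => hX x) (fun x _ => hp x) (fun x _ => hext x)
  exact ⟨homOfApp s fun x y g => hs x y g (R.deg_lt x) (R.deg_lt y),
    LMod.hom_ext fun x v => hsp x (R.deg_lt x) v⟩

end ReedyStructure

end Lifting

/-! ### Changing a module at one object -/

section Attaching

variable {k : Type u} [CommRing k] {C : Type u} [SmallCategory C] [Preadditive C] [Linear k C]

namespace ReedyStructure

open LMod

variable (R : ReedyStructure k C) {X N : LMod k C} {π : X ⟶ N} {x : C}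
variable {V : Type u} [AddCommGroup V] [Module k V] [Module (R.A x) V]

/-- The free `C`-module `C(x, -) ⊗ V`. -/
def free (x : C) (V : Type u) [AddCommGroup V] [Module k V] : LMod k C :=
  ofData (fun y => (x ⟶ y) ⊗[k] V)
    (fun y z =>
      { toFun := fun f => LinearMap.rTensor V (Linear.rightComp k x f)
        map_add' := fun f g => by
          rw [← LinearMap.rTensor_add]
          exact congrArg _ (LinearMap.ext fun h => Preadditive.comp_add _ _ _ _ _ _)
        map_smul' := fun r f => by
          rw [RingHom.id_apply, ← LinearMap.rTensor_smul]
          exact congrArg _ (LinearMap.ext fun h => Linear.comp_smul _ _ _ _ _ _) })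
    (fun y v => by
      have h : Linear.rightComp k x (𝟙 y) = LinearMap.id :=
        LinearMap.ext fun f => Category.comp_id f
      change LinearMap.rTensor V (Linear.rightComp k x (𝟙 y)) v = v
      rw [h, LinearMap.rTensor_id, LinearMap.id_apply])
    (fun y z w f g v => by
      have h : Linear.rightComp k x (f ≫ g) =
          (Linear.rightComp k x g).comp (Linear.rightComp k x f) :=
        LinearMap.ext fun e => (Category.assoc e f g).symm
      change LinearMap.rTensor V (Linear.rightComp k x (f ≫ g)) v = _
      rw [h, LinearMap.rTensor_comp]
      rfl)

section Construction

variable (i : X.val x →ₗ[R.A x] V) (q : V →ₗ[R.A x] R.RelMatching π x)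

/-- The relations on `X ⊕ C(x, -) ⊗ V` that identify `ξ` with `i(ξ)` for `ξ` in `X(x)`, prescribe
the action on `V` of the morphisms to objects of smaller degree through `q`, and make the tensor
product balanced over `A⁰_x`. -/
inductive AttachRel (y : C) : X.val y × ((x ⟶ y) ⊗[k] V) → Prop
  | incl (f : x ⟶ y) (ξ : X.val x) : AttachRel y (X.act f ξ, -(f ⊗ₜ[k] i ξ))
  | down (z : R.Below x) (g : x ⟶ z.1) (h : z.1 ⟶ y) (v : V) :
      AttachRel y (X.act h ((q v).1.1.1 z g), -((g ≫ h) ⊗ₜ[k] v))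
  | bal (a : R.A x) (f : x ⟶ y) (v : V) :
      AttachRel y (0, ((show x ⟶ x from a.1) ≫ f) ⊗ₜ[k] v - f ⊗ₜ[k] (a • v))

/-- The submodule spanned by the relations `AttachRel`. -/
def attachSub (y : C) : Submodule k (X.val y × ((x ⟶ y) ⊗[k] V)) :=
  Submodule.span k {t | R.AttachRel i q y t}

lemma attachSub_stable (y z : C) (f : y ⟶ z) :
    ∀ t ∈ R.attachSub i q y, (X.prod (free x V)).act f t ∈ R.attachSub i q z := by
  let T : X.val y × ((x ⟶ y) ⊗[k] V) →ₗ[k] X.val z × ((x ⟶ z) ⊗[k] V) :=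
    (X.act f).prodMap (LinearMap.rTensor V (Linear.rightComp k x f))
  have hT : ∀ ξ t, T (ξ, t) = (X.act f ξ, LinearMap.rTensor V (Linear.rightComp k x f) t) :=
    fun _ _ => rfl
  have hr : ∀ e : x ⟶ y, Linear.rightComp k x f e = e ≫ f := fun _ => rfl
  have h : R.attachSub i q y ≤ (R.attachSub i q z).comap T := by
    refine Submodule.span_le.2 ?_
    rintro _ (⟨g, ξ⟩ | ⟨w, g, h, v⟩ | ⟨a, g, v⟩)
    · rw [SetLike.mem_coe, Submodule.mem_comap, hT, ← act_comp, map_neg, LinearMap.rTensor_tmul, hr]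
      exact Submodule.subset_span (.incl _ _)
    · rw [SetLike.mem_coe, Submodule.mem_comap, hT, ← act_comp, map_neg, LinearMap.rTensor_tmul, hr,
        Category.assoc]
      exact Submodule.subset_span (.down _ _ _ _)
    · rw [SetLike.mem_coe, Submodule.mem_comap, hT, map_zero, map_sub, LinearMap.rTensor_tmul,
        LinearMap.rTensor_tmul, hr, hr, Category.assoc]
      exact Submodule.subset_span (.bal _ _ _)
  exact fun t ht => h ht

/-- The `C`-module obtained from `X` by replacing its value at `x` by `V`, and extending freely to
the objects of larger degree. -/
def attach : LMod k C :=
  (X.prod (free x V)).quot (R.attachSub i q) (R.attachSub_stable i q)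

end Construction

variable (i : X.val x →ₗ[R.A x] V) (q : V →ₗ[R.A x] R.RelMatching π x)

/-- The characteristic properties of the object obtained from `X` by replacing the value at `x`
by `V`. -/
structure IsAttached {X' : LMod k C} (j : X ⟶ X') (π' : X' ⟶ N) (κ : V →ₗ[R.A x] X'.val x) :
    Prop where
  comp_eq : j ≫ π' = π
  incl (ξ : X.val x) : κ (i ξ) = app j x ξ
  down (z : R.Below x) (g : x ⟶ z.1) (v : V) : X'.act g (κ v) = app j z.1 ((q v).1.1.1 z g)
  proj (v : V) : app π' x (κ v) = (q v).1.2
  /-- `X'` is generated by `X` and `V` -/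
  top_le (y : C) (W : Submodule k (X'.val y)) (h₁ : ∀ ξ, app j y ξ ∈ W)
    (h₂ : ∀ (f : x ⟶ y) v, X'.act f (κ v) ∈ W) (t : X'.val y) : t ∈ W
  exists_desc (y : C) (J : Type u) [AddCommGroup J] [Module k J] (α : X.val y →ₗ[k] J)
    (β : (x ⟶ y) →ₗ[k] V →ₗ[k] J) (h₁ : ∀ f ξ, α (X.act f ξ) = β f (i ξ))
    (h₂ : ∀ (z : R.Below x) (g : x ⟶ z.1) (h : z.1 ⟶ y) (v : V),
      α (X.act h ((q v).1.1.1 z g)) = β (g ≫ h) v)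
    (h₃ : ∀ (a : R.A x) (f : x ⟶ y) (v : V), β ((show x ⟶ x from a.1) ≫ f) v = β f (a • v)) :
    ∃ D : X'.val y →ₗ[k] J, (∀ ξ, D (app j y ξ) = α ξ) ∧ ∀ f v, D (X'.act f (κ v)) = β f v

lemma exists_attachDesc (y : C) {J : Type u} [AddCommGroup J] [Module k J] (α : X.val y →ₗ[k] J)
    (β : (x ⟶ y) →ₗ[k] V →ₗ[k] J) (h₁ : ∀ f ξ, α (X.act f ξ) = β f (i ξ))
    (h₂ : ∀ (z : R.Below x) (g : x ⟶ z.1) (h : z.1 ⟶ y) (v : V),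
      α (X.act h ((q v).1.1.1 z g)) = β (g ≫ h) v)
    (h₃ : ∀ (a : R.A x) (f : x ⟶ y) (v : V), β ((show x ⟶ x from a.1) ≫ f) v = β f (a • v)) :
    ∃ D : (X.val y × ((x ⟶ y) ⊗[k] V)) ⧸ R.attachSub i q y →ₗ[k] J,
      ∀ ξ t, D (Submodule.Quotient.mk (ξ, t)) = α ξ + TensorProduct.lift β t := by
  refine ⟨(R.attachSub i q y).liftQ (α.coprod (TensorProduct.lift β)) ?_, fun ξ t => rfl⟩
  refine Submodule.span_le.2 ?_
  rintro _ (⟨g, ξ⟩ | ⟨w, g, h, v⟩ | ⟨a, g, v⟩)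
  · rw [SetLike.mem_coe, LinearMap.mem_ker, LinearMap.coprod_apply, map_neg,
      TensorProduct.lift.tmul, h₁, add_neg_cancel]
  · rw [SetLike.mem_coe, LinearMap.mem_ker, LinearMap.coprod_apply, map_neg,
      TensorProduct.lift.tmul, h₂, add_neg_cancel]
  · rw [SetLike.mem_coe, LinearMap.mem_ker, LinearMap.coprod_apply, map_zero, zero_add, map_sub,
      TensorProduct.lift.tmul, TensorProduct.lift.tmul, h₃, sub_self]

lemma exists_isAttached [IsScalarTower k (R.A x) V]
    (hiq : ∀ ξ, q (i ξ) = R.relMatchingMap π x ξ) :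
    ∃ (X' : LMod k C) (j : X ⟶ X') (π' : X' ⟶ N) (κ : V →ₗ[R.A x] X'.val x),
      R.IsAttached i q j π' κ := by
  have hmk : ∀ (y : C) (s t : X.val y × ((x ⟶ y) ⊗[k] V)), R.AttachRel i q y (s - t) →
      (Submodule.Quotient.mk s : (X.val y × ((x ⟶ y) ⊗[k] V)) ⧸ R.attachSub i q y) =
        Submodule.Quotient.mk t :=
    fun y s t h => (Submodule.Quotient.eq _).2 (Submodule.subset_span h)
  have hincl : ∀ (y : C) (f : x ⟶ y) (ξ : X.val x),
      (Submodule.Quotient.mk (0, f ⊗ₜ[k] i ξ) :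
        (X.val y × ((x ⟶ y) ⊗[k] V)) ⧸ R.attachSub i q y) =
        Submodule.Quotient.mk (X.act f ξ, 0) := fun y f ξ => (hmk y _ _ (by
    rw [Prod.mk_sub_mk, sub_zero, zero_sub]
    exact .incl f ξ)).symm
  have hdown : ∀ (y : C) (z : R.Below x) (g : x ⟶ z.1) (h : z.1 ⟶ y) (v : V),
      (Submodule.Quotient.mk (0, (g ≫ h) ⊗ₜ[k] v) :
        (X.val y × ((x ⟶ y) ⊗[k] V)) ⧸ R.attachSub i q y) =
        Submodule.Quotient.mk (X.act h ((q v).1.1.1 z g), 0) := fun y z g h v => (hmk y _ _ (by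
    rw [Prod.mk_sub_mk, sub_zero, zero_sub]
    exact .down z g h v)).symm
  have hbal : ∀ (y : C) (a : R.A x) (f : x ⟶ y) (v : V),
      (Submodule.Quotient.mk (0, ((show x ⟶ x from a.1) ≫ f) ⊗ₜ[k] v) :
        (X.val y × ((x ⟶ y) ⊗[k] V)) ⧸ R.attachSub i q y) =
        Submodule.Quotient.mk (0, f ⊗ₜ[k] (a • v)) := fun y a f v => hmk y _ _ (by
    rw [Prod.mk_sub_mk, sub_zero]
    exact .bal a f v)
  let X' := R.attach i q
  let j : X ⟶ X' := homOfApp (fun y => (R.attachSub i q y).mkQ.comp (LinearMap.inl k _ _))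
    fun y z f ξ => congrArg (R.attachSub i q z).mkQ
      (Prod.ext rfl (map_zero (LinearMap.rTensor V (Linear.rightComp k x f))).symm)
  have hact : ∀ (y z : C) (f : y ⟶ z) (g : x ⟶ y) (v : V),
      X'.act f (Submodule.Quotient.mk (0, g ⊗ₜ[k] v) :
        (X.val y × ((x ⟶ y) ⊗[k] V)) ⧸ R.attachSub i q y) =
      (Submodule.Quotient.mk (0, (g ≫ f) ⊗ₜ[k] v) :
        (X.val z × ((x ⟶ z) ⊗[k] V)) ⧸ R.attachSub i q z) := fun y z f g v =>
    congrArg (R.attachSub i q z).mkQ (Prod.ext (map_zero (X.act f)) rfl)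
  let κ : V →ₗ[R.A x] X'.val x :=
    { toFun := fun v => (Submodule.Quotient.mk (0, 𝟙 x ⊗ₜ[k] v) :
        (X.val x × ((x ⟶ x) ⊗[k] V)) ⧸ R.attachSub i q x)
      map_add' := fun v w => congrArg (R.attachSub i q x).mkQ
        (Prod.ext (add_zero _).symm (TensorProduct.tmul_add _ v w))
      map_smul' := fun a v => by
        refine (hbal x a (𝟙 x) v).symm.trans ?_
        refine Eq.trans ?_ (hact x x (show x ⟶ x from a.1) (𝟙 x) v).symm
        rw [Category.comp_id, Category.id_comp] }
  have hκ : ∀ (y : C) (f : x ⟶ y) (v : V), X'.act f (κ v) =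
      (Submodule.Quotient.mk (0, f ⊗ₜ[k] v) :
        (X.val y × ((x ⟶ y) ⊗[k] V)) ⧸ R.attachSub i q y) := fun y f v => by
    refine (hact x y f (𝟙 x) v).trans ?_
    rw [Category.id_comp]
  let qA : V →ₗ[R.A x] N.val x :=
    (LinearMap.snd (R.A x) _ _).comp ((R.RelMatching π x).subtype.comp q)
  let qN : V →ₗ[k] N.val x :=
    { toFun := qA
      map_add' := map_add qA
      map_smul' := fun r v => by
        have h := map_smul qA (algebraMap k (R.A x) r) v
        rwa [algebraMap_smul (R.A x) r v, algebraMap_smul (R.A x) r (qA v)] at h }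
  have hπ := fun y : C => R.exists_attachDesc i q y (app π y)
    ((LinearMap.llcomp k V (N.val x) (N.val y)).flip qN ∘ₗ N.actₗ x y)
    (fun f ξ => by
      change app π y (X.act f ξ) = N.act f (q (i ξ)).1.2
      rw [app_act, hiq, relMatchingMap_snd])
    (fun z g h v => by
      change app π y (X.act h ((q v).1.1.1 z g)) = N.act (g ≫ h) (q v).1.2
      rw [app_act, (R.mem_relMatching).1 (q v).2, act_comp])
    (fun a f v => by
      change N.act ((show x ⟶ x from a.1) ≫ f) (q v).1.2 = N.act f (q (a • v)).1.2
      rw [act_comp]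
      exact congrArg (N.act f) (map_smul qA a v).symm)
  choose D hD using hπ
  let π' : X' ⟶ N := homOfApp (X := X') (fun y => D y) (by
    intro y z f t
    obtain ⟨⟨ξ, t⟩, rfl⟩ := Submodule.Quotient.mk_surjective _ t
    refine (hD z _ _).trans ?_
    refine Eq.trans ?_ (congrArg (N.act f) (hD y ξ t)).symm
    rw [map_add]
    refine congrArg₂ (· + ·) (app_act π f ξ) ?_
    change TensorProduct.lift _ (LinearMap.rTensor V (Linear.rightComp k x f) t) = _
    induction t using TensorProduct.induction_on with
    | zero => simp only [map_zero]
    | add s t hs ht => simp only [map_add, hs, ht]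
    | tmul g v =>
      exact act_comp N g f _)
  refine ⟨X', j, π', κ, ?_, ?_, ?_, ?_, ?_, ?_⟩
  · refine LMod.hom_ext fun y ξ => (hD y ξ 0).trans ?_
    rw [map_zero, add_zero]
  · intro ξ
    refine (hincl x (𝟙 x) ξ).trans ?_
    rw [act_id]
    rfl
  · intro z g v
    refine (hκ z.1 g v).trans ?_
    have h := hdown z.1 z g (𝟙 z.1) v
    rw [Category.comp_id, act_id] at h
    exact h
  · intro v
    refine (hD x 0 _).trans ?_
    rw [map_zero, zero_add]
    exact act_id N _
  · intro y W h₁ h₂ t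
    let W' : Submodule k ((X.val y × ((x ⟶ y) ⊗[k] V)) ⧸ R.attachSub i q y) := W
    have h₁' : ∀ ξ, (R.attachSub i q y).mkQ (ξ, 0) ∈ W' := h₁
    have h₂' : ∀ (f : x ⟶ y) v, (R.attachSub i q y).mkQ (0, f ⊗ₜ[k] v) ∈ W' := fun f v => by
      have h := h₂ f v
      rw [hκ] at h
      exact h
    have h3 : ∀ t : (x ⟶ y) ⊗[k] V, (R.attachSub i q y).mkQ (0, t) ∈ W' := by
      intro t
      induction t using TensorProduct.induction_on with
      | zero => exact (map_zero (R.attachSub i q y).mkQ).symm ▸ W'.zero_mem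
      | add s t hs ht =>
        have h4 : ((0 : X.val y), s + t) = (0, s) + (0, t) := Prod.ext (add_zero _).symm rfl
        rw [h4, map_add]
        exact W'.add_mem hs ht
      | tmul f v => exact h₂' f v
    obtain ⟨⟨ξ, t⟩, rfl⟩ := (R.attachSub i q y).mkQ_surjective t
    have h4 : (ξ, t) = (ξ, 0) + (0, t) := Prod.ext (add_zero _).symm (zero_add _).symm
    have h5 : (R.attachSub i q y).mkQ (ξ, t) ∈ W' := by
      rw [h4, map_add]
      exact W'.add_mem (h₁' ξ) (h3 t)
    exact h5
  · intro y J _ _ α β h₁ h₂ h₃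
    obtain ⟨D', hD'⟩ := R.exists_attachDesc i q y α β h₁ h₂ h₃
    refine ⟨D', fun ξ => ?_, fun f v => ?_⟩
    · refine (hD' ξ 0).trans ?_
      rw [map_zero, add_zero]
    · refine (congrArg D' (hκ y f v)).trans ((hD' 0 _).trans ?_)
      rw [map_zero, zero_add, TensorProduct.lift.tmul]

end ReedyStructure

end Attaching

section AttachingProperties

variable {k : Type u} [CommRing k] {C : Type u} [SmallCategory C] [Preadditive C] [Linear k C]

namespace ReedyStructure

open LMod

variable (R : ReedyStructure k C) {X X' N : LMod k C} {π : X ⟶ N} {x : C}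

section

variable {V : Type u} [AddCommGroup V] [Module k V] [Module (R.A x) V]
variable {i : X.val x →ₗ[R.A x] V} {q : V →ₗ[R.A x] R.RelMatching π x}
variable {j : X ⟶ X'} {π' : X' ⟶ N} {κ : V →ₗ[R.A x] X'.val x}

variable (q) in
/-- The component of a map to the relative matching object in the matching object. -/
def relMatchingFst : V →ₗ[R.A x] R.Matching X x :=
  (LinearMap.fst (R.A x) _ _).comp ((R.RelMatching π x).subtype.comp q)

variable (q) in
/-- The components of a map to the relative matching object are `k`-linear. -/
def relMatchingComp [IsScalarTower k (R.A x) V] (z : R.Below x) :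
    V →ₗ[k] (x ⟶ z.1) →ₗ[k] X.val z.1 where
  toFun v := (R.relMatchingFst q v).1 z
  map_add' v w := by rw [map_add]; rfl
  map_smul' r v := by
    refine LinearMap.ext fun φ => ?_
    have h1 : R.relMatchingFst q (r • v) = algebraMap k (R.A x) r • R.relMatchingFst q v := by
      rw [← LinearMap.map_smul (R.relMatchingFst q), algebraMap_smul]
    have h2 : (show x ⟶ x from (algebraMap k (R.A x) r).1) = r • 𝟙 x :=
      Algebra.algebraMap_eq_smul_one (A := End x) r
    rw [h1]
    change (R.relMatchingFst q v).1 z ((show x ⟶ x from (algebraMap k (R.A x) r).1) ≫ φ) = _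
    rw [h2, Linear.smul_comp, Category.id_comp, map_smul]
    rfl

variable (q) in
/-- A map to the relative matching object at `x` determines an action of the morphisms through
objects of degree less than `d(x)`. -/
lemma exists_lowerAct [IsScalarTower k (R.A x) V] (y : C) :
    ∃ H : (x ⟶ y) →ₗ[k] V →ₗ[k] X.val y,
    ∀ (z : R.Below x) (g : x ⟶ z.1) (h : z.1 ⟶ y) (v : V),
      H (g ≫ h) v = X.act h ((q v).1.1.1 z g) := by
  obtain ⟨H, hH⟩ := R.exists_linearMap_of_natural (R.deg x) (x := x) (y := y)
    (J := V →ₗ[k] X.val y)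
    (fun z hz => LinearMap.mk₂ k
      (fun g h => (X.act h).comp ((R.relMatchingComp q ⟨z, hz⟩).flip g))
      (fun g g' h => by rw [map_add, LinearMap.comp_add])
      (fun r g h => by rw [map_smul, LinearMap.comp_smul])
      (fun g h h' => LinearMap.ext fun v => X.act_add h h' _)
      (fun r g h => LinearMap.ext fun v => X.act_smul r h _))
    (fun z z' hz hz' g e f => LinearMap.ext fun v => by
      change X.act f ((q v).1.1.1 ⟨z', hz'⟩ (g ≫ e)) = X.act (e ≫ f) ((q v).1.1.1 ⟨z, hz⟩ g)
      rw [act_comp]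
      exact congrArg (X.act f) ((q v).1.1.2 ⟨z, hz⟩ ⟨z', hz'⟩ e g))
  exact ⟨H, fun z g h v => LinearMap.congr_fun (hH z.1 z.2 g h) v⟩

lemma lowerAct_incl (hiq : ∀ ξ, q (i ξ) = R.relMatchingMap π x ξ) {y : C}
    {H : (x ⟶ y) →ₗ[k] V →ₗ[k] X.val y} (hH : ∀ (z : R.Below x) (g : x ⟶ z.1) (h : z.1 ⟶ y) (v : V),
      H (g ≫ h) v = X.act h ((q v).1.1.1 z g)) {f : x ⟶ y} (hf : f ∈ R.lower (R.deg x) x y)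
    (ξ : X.val x) : X.act f ξ = H f (i ξ) := by
  refine R.lower_induction (motive := fun f => X.act f ξ = H f (i ξ)) hf
    (by rw [act_zero, map_zero, LinearMap.zero_apply])
    (fun f g hf hg => by rw [act_add, map_add, LinearMap.add_apply, hf, hg])
    (fun r f hf => by rw [act_smul, map_smul, LinearMap.smul_apply, hf]) fun z g h hz => ?_
  rw [hH ⟨z, hz⟩, hiq, act_comp]
  rfl

lemma lowerAct_bal {y : C}
    {H : (x ⟶ y) →ₗ[k] V →ₗ[k] X.val y} (hH : ∀ (z : R.Below x) (g : x ⟶ z.1) (h : z.1 ⟶ y) (v : V),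
      H (g ≫ h) v = X.act h ((q v).1.1.1 z g)) {f : x ⟶ y} (hf : f ∈ R.lower (R.deg x) x y)
    (a : R.A x) (v : V) : H ((show x ⟶ x from a.1) ≫ f) v = H f (a • v) := by
  refine R.lower_induction (motive := fun f => H ((show x ⟶ x from a.1) ≫ f) v = H f (a • v)) hf
    (by rw [comp_zero, map_zero, LinearMap.zero_apply, LinearMap.zero_apply])
    (fun f g hf hg => by
      rw [Preadditive.comp_add, map_add, map_add, LinearMap.add_apply, LinearMap.add_apply, hf, hg])
    (fun r f hf => by
      rw [Linear.comp_smul, LinearMap.map_smul H, LinearMap.map_smul H, LinearMap.smul_apply,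
        LinearMap.smul_apply, hf])
    fun z g h hz => ?_
  rw [← Category.assoc, hH ⟨z, hz⟩, hH ⟨z, hz⟩]
  refine congrArg (X.act h) ?_
  have h1 := LinearMap.map_smul (R.relMatchingFst q) a v
  exact (congrArg (fun t : R.Matching X x => t.1 ⟨z, hz⟩ g) h1).symm

namespace IsAttached

variable {R}
variable (h : R.IsAttached i q j π' κ)

include h

lemma act_lower {y : C} {f : x ⟶ y} (hf : f ∈ R.lower (R.deg x) x y) (v : V) :
    ∃ ξ, app j y ξ = X'.act f (κ v) := by
  refine R.lower_induction (motive := fun f => ∃ ξ, app j y ξ = X'.act f (κ v)) hf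
    ⟨0, by rw [act_zero, map_zero]⟩ ?_ ?_ ?_
  · rintro f g ⟨ξ, hξ⟩ ⟨η, hη⟩
    exact ⟨ξ + η, by rw [map_add, hξ, hη, act_add]⟩
  · rintro r f ⟨ξ, hξ⟩
    exact ⟨r • ξ, by rw [map_smul, hξ, act_smul]⟩
  · intro z g e hz
    exact ⟨X.act e ((q v).1.1.1 ⟨z, hz⟩ g), by rw [app_act, act_comp, h.down ⟨z, hz⟩]⟩

/-- The attaching does not change the values at the other objects of degree at most `d(x)`. -/
lemma bijective_app [IsScalarTower k (R.A x) V]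
    (hiq : ∀ ξ, q (i ξ) = R.relMatchingMap π x ξ) {y : C} (hyx : y ≠ x)
    (hd : R.deg y ≤ R.deg x) : Function.Bijective (app j y) := by
  have hlow : ∀ f : x ⟶ y, f ∈ R.lower (R.deg x) x y := by
    intro f
    rcases hd.lt_or_eq with hlt | heq
    · have := comp_mem_lower hlt f (𝟙 y)
      rwa [Category.comp_id] at this
    · exact R.mem_lower_of_deg_eq hyx.symm heq.symm f
  obtain ⟨H, hH⟩ := R.exists_lowerAct q y
  obtain ⟨D, hD₁, -⟩ := h.exists_desc y (X.val y) LinearMap.id H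
    (fun f ξ => R.lowerAct_incl hiq hH (hlow f) ξ) (fun z g e v => (hH z g e v).symm)
    (fun a f v => R.lowerAct_bal hH (hlow f) a v)
  refine ⟨Function.LeftInverse.injective (g := D) hD₁, fun t => ?_⟩
  refine h.top_le y (LinearMap.range (app j y)) (fun ξ => ⟨ξ, rfl⟩) (fun f v => ?_) t
  exact h.act_lower (hlow f) v

/-- The value at `x` becomes `V`. -/
lemma bijective_incl [IsScalarTower k (R.A x) V]
    (hiq : ∀ ξ, q (i ξ) = R.relMatchingMap π x ξ) : Function.Bijective κ := by
  obtain ⟨H, hH⟩ := R.exists_lowerAct q x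
  obtain ⟨μ, hμ₁, hμ₂, hμ₃⟩ := R.exists_minusProj x x
  have hA : ∀ f : x ⟶ x, (μ f).1 ∈ (R.plus.inter R.minus).hom x x := fun f =>
    ⟨by rw [R.plus_eq_minus]; exact (μ f).2, (μ f).2⟩
  have hv : ∀ {s t : R.minus.hom x x} {b c : R.A x}, s = t → s.1 = (show x ⟶ x from b.1) ∧
    t.1 = (show x ⟶ x from c.1) → b = c := fun h h' => Subtype.ext (h'.1.symm.trans
      ((congrArg (fun t : R.minus.hom x x => t.1) h).trans h'.2))
  -- Split an endomorphism `f` of `x` into its component `a f` in `A⁰_x` and a rest in `lower`.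
  let a : (x ⟶ x) →ₗ[k] R.A x :=
    { toFun := fun f => ⟨(μ f).1, hA f⟩
      map_add' := fun f g => hv (map_add μ f g) ⟨rfl, rfl⟩
      map_smul' := fun r f => hv (map_smul μ r f) ⟨rfl, rfl⟩ }
  have ha_low : ∀ f ∈ R.lower (R.deg x) x x, a f = 0 := fun f hf =>
    hv (hμ₂ f hf) ⟨rfl, rfl⟩
  have ha_A : ∀ b : R.A x, a (show x ⟶ x from b.1) = b := fun b =>
    hv (hμ₁ ⟨b.1, b.2.2⟩) ⟨rfl, rfl⟩
  have hsplit : ∀ f : x ⟶ x, ∃ (b : R.A x) (g : x ⟶ x), g ∈ R.lower (R.deg x) x x ∧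
      f = (show x ⟶ x from b.1) + g := fun f =>
    ⟨a f, f - (μ f).1, hμ₃ f, (add_sub_cancel (μ f).1 f).symm⟩
  let ρ : (x ⟶ x) →ₗ[k] (x ⟶ x) := LinearMap.id - (R.minus.hom x x).subtype.comp μ
  have hρ_low : ∀ f ∈ R.lower (R.deg x) x x, ρ f = f := fun f hf => by
    change f - (μ f).1 = f
    rw [hμ₂ f hf]
    exact sub_zero f
  have hρ_A : ∀ b : R.A x, ρ (show x ⟶ x from b.1) = 0 := fun b => by
    change (show x ⟶ x from b.1) - (μ (show x ⟶ x from b.1)).1 = 0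
    rw [show μ (show x ⟶ x from b.1) = ⟨b.1, b.2.2⟩ from hμ₁ ⟨b.1, b.2.2⟩]
    exact sub_self (show x ⟶ x from b.1)
  let iK : X.val x →ₗ[k] V :=
    { toFun := i
      map_add' := map_add i
      map_smul' := fun r v => by
        have h := map_smul i (algebraMap k (R.A x) r) v
        rwa [algebraMap_smul (R.A x) r v, algebraMap_smul (R.A x) r (i v)] at h }
  let actV : R.A x →ₗ[k] V →ₗ[k] V :=
    LinearMap.mk₂ k (fun b v => b • v) (fun b c v => add_smul b c v)
      (fun r b v => smul_assoc r b v) (fun b v w => smul_add b v w)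
      (fun r b v => by
        rw [← algebraMap_smul (R.A x) r v, ← algebraMap_smul (R.A x) r (b • v), ← mul_smul,
          ← mul_smul, Algebra.commutes])
  obtain ⟨β, hβ⟩ : ∃ β : (x ⟶ x) →ₗ[k] V →ₗ[k] V, ∀ f v, β f v = a f • v + i (H (ρ f) v) :=
    ⟨actV.comp a + (LinearMap.llcomp k V (X.val x) V iK).comp (H.comp ρ), fun _ _ => rfl⟩
  have hβ_A : ∀ (b : R.A x) v, β (show x ⟶ x from b.1) v = b • v := fun b v => by
    rw [hβ, ha_A b, hρ_A b, map_zero, LinearMap.zero_apply,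
      map_zero, add_zero]
  have hβ_low : ∀ f ∈ R.lower (R.deg x) x x, ∀ v, β f v = i (H f v) := fun f hf v => by
    rw [hβ, ha_low f hf, hρ_low f hf, zero_smul, zero_add]
  obtain ⟨D, hD₁, hD₂⟩ := h.exists_desc x V iK β
    (fun f ξ => by
      obtain ⟨b, g, hg, rfl⟩ := hsplit f
      rw [act_add, map_add, map_add, LinearMap.add_apply, hβ_A, hβ_low g hg]
      refine congrArg₂ (· + ·) (map_smul i b ξ) ?_
      exact congrArg i (R.lowerAct_incl hiq hH hg ξ))
    (fun z g e v => by
      rw [hβ_low _ (comp_mem_lower z.2 g e), hH]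
      rfl)
    (fun c f v => by
      obtain ⟨b, g, hg, rfl⟩ := hsplit f
      have h1 : β ((show x ⟶ x from c.1) ≫ (show x ⟶ x from b.1)) v = (b * c) • v := hβ_A (b * c) v
      rw [Preadditive.comp_add, map_add, map_add, LinearMap.add_apply, LinearMap.add_apply, h1,
        hβ_low _ (comp_lower hg _), hβ_A, hβ_low g hg, R.lowerAct_bal hH hg, mul_smul])
  constructor
  · refine Function.LeftInverse.injective (g := D) fun v => ?_
    have h1 := hD₂ (𝟙 x) v
    rw [act_id] at h1
    exact h1.trans ((hβ_A 1 v).trans (one_smul _ v))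
  · intro t
    let W : Submodule k (X'.val x) :=
      { carrier := Set.range κ
        add_mem' := by
          rintro _ _ ⟨v, rfl⟩ ⟨w, rfl⟩
          exact ⟨v + w, map_add κ v w⟩
        zero_mem' := ⟨0, map_zero κ⟩
        smul_mem' := by
          rintro r _ ⟨v, rfl⟩
          refine ⟨algebraMap k (R.A x) r • v, ?_⟩
          rw [map_smul]
          exact algebraMap_smul (R.A x) r (κ v) }
    have hW : ∀ ξ, app j x ξ ∈ W := fun ξ => ⟨i ξ, h.incl ξ⟩
    refine h.top_le x W hW (fun f v => ?_) t
    obtain ⟨b, g, hg, rfl⟩ := hsplit f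
    obtain ⟨ξ, hξ⟩ := h.act_lower hg v
    rw [act_add, ← hξ]
    exact W.add_mem ⟨b • v, map_smul κ b v⟩ (hW ξ)

/-- At the objects of larger degree, the attaching is free: bijectivity of the latching morphism is
preserved. -/
lemma bijective_latchingMap [IsScalarTower k (R.A x) V] {y : C}
    (hy : R.deg x < R.deg y)
    (hl : Function.Bijective (R.latchingMap X y)) : Function.Bijective (R.latchingMap X' y) := by
  let e := LinearEquiv.ofBijective (R.latchingMap X y) hl
  let L := R.latchingFunc y (app j) (naturalBelow_app _ j)
  have he : ∀ t, e.symm (R.latchingMap X y t) = t := fun t => e.symm_apply_apply t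
  let α : X.val y →ₗ[k] R.Latching X' y :=
    { toFun := fun ξ => L (e.symm ξ)
      map_add' := fun ξ η => by rw [map_add, map_add]
      map_smul' := fun r ξ => by
        rw [RingHom.id_apply, ← algebraMap_smul (R.A y) r ξ, map_smul, map_smul, algebraMap_smul] }
  have hα : ∀ (z : R.Below y) (φ : z.1 ⟶ y) (ξ : X.val z.1),
      α (X.act φ ξ) = R.lmk X' y z φ (app j z.1 ξ) := fun z φ ξ => by
    change L (e.symm (X.act φ ξ)) = _
    rw [← latchingMap_lmk R z φ ξ, he, latchingFunc_lmk]
  let κK : V →ₗ[k] X'.val x :=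
    { toFun := κ
      map_add' := map_add κ
      map_smul' := fun r v => by
        have h := map_smul κ (algebraMap k (R.A x) r) v
        rwa [algebraMap_smul (R.A x) r v, algebraMap_smul (R.A x) r (κ v)] at h }
  let β : (x ⟶ y) →ₗ[k] V →ₗ[k] R.Latching X' y :=
    (LinearMap.lcomp k (R.Latching X' y) κK).comp (R.lmk X' y ⟨x, hy⟩)
  have hβ : ∀ f v, β f v = R.lmk X' y ⟨x, hy⟩ f (κ v) := fun _ _ => rfl
  obtain ⟨D, hD₁, hD₂⟩ := h.exists_desc y (R.Latching X' y) α β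
    (fun f ξ => by rw [hβ, h.incl]; exact hα ⟨x, hy⟩ f ξ)
    (fun z g e v => by
      refine (hα ⟨z.1, z.2.trans hy⟩ e _).trans ?_
      rw [hβ, ← h.down z g v]
      exact (R.lmk_comp ⟨x, hy⟩ ⟨z.1, z.2.trans hy⟩ g e (κ v)).symm)
    (fun a f v => by
      rw [hβ, hβ, map_smul]
      exact R.lmk_comp ⟨x, hy⟩ ⟨x, hy⟩ (show x ⟶ x from a.1) f (κ v))
  have hDl : ∀ t, D (R.latchingMap X' y t) = t := by
    intro t
    refine R.latching_induction (motive := fun t => D (R.latchingMap X' y t) = t) t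
      (by rw [map_zero, map_zero]) (fun s t hs ht => by rw [map_add, map_add, hs, ht]) ?_
    intro z φ w
    rw [latchingMap_lmk]
    refine h.top_le z.1 (LinearMap.eqLocus (D.comp (X'.act φ)) (R.lmk X' y z φ)) (fun ξ => ?_)
      (fun f v => ?_) w
    · change D (X'.act φ (app j z.1 ξ)) = _
      rw [← app_act, hD₁, hα]
    · change D (X'.act φ (X'.act f (κ v))) = _
      rw [← act_comp, hD₂, hβ]
      exact R.lmk_comp ⟨x, hy⟩ z f φ (κ v)
  refine ⟨Function.LeftInverse.injective hDl, fun t => ?_⟩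
  refine h.top_le y ((LinearMap.range (R.latchingMap X' y)).restrictScalars k) (fun ξ => ?_)
    (fun f v => ?_) t
  · obtain ⟨t, rfl⟩ := hl.2 ξ
    exact ⟨L t, R.latchingMap_naturality j t⟩
  · exact R.act_mem_range_latchingMap hy f (κ v)

end IsAttached

end

end ReedyStructure

end AttachingProperties

/-! ### Good objects over a given module -/

section Good

variable {k : Type u} [CommRing k] {C : Type u} [SmallCategory C] [Preadditive C] [Linear k C]

namespace ReedyStructure

open LMod

variable (R : ReedyStructure k C) (𝒞 𝒟 : ∀ x : C, ObjectProperty (ModuleCat.{u} (R.A x)))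

/-- A morphism `π : X ⟶ N` is good at `x` if `X` satisfies the condition of `Φ(𝒞)` at `x`, and `π`
satisfies the relative version of the condition of `Ψ(𝒟)`. -/
structure IsGood {X N : LMod k C} (π : X ⟶ N) (x : C) : Prop where
  injective : Function.Injective (R.latchingMap X x)
  coker : 𝒞 x (ModuleCat.of (R.A x) (X.val x ⧸ LinearMap.range (R.latchingMap X x)))
  surjective : Function.Surjective (R.relMatchingMap π x)
  ker : 𝒟 x (ModuleCat.of (R.A x) (LinearMap.ker (R.relMatchingMap π x)))

/-- A morphism is settled at `x` if it is good at `x` and at all objects of smaller degree. -/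
def IsSettled {X N : LMod k C} (π : X ⟶ N) (x : C) : Prop :=
  ∀ y, R.deg y < R.deg x ∨ y = x → R.IsGood 𝒞 𝒟 π y

variable {R 𝒞 𝒟}

lemma latchingFunc_surjective {X X' : LMod k C} {x : C} (j : X ⟶ X')
    (hb : ∀ y, R.deg y < R.deg x → Function.Bijective (app j y)) :
    Function.Surjective (R.latchingFunc x (app j) (naturalBelow_app _ j)) := by
  intro t
  refine R.latching_induction (motive := fun t => ∃ s, R.latchingFunc x (app j)
    (naturalBelow_app _ j) s = t) t ⟨0, map_zero _⟩ ?_ ?_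
  · rintro _ _ ⟨s, rfl⟩ ⟨t, rfl⟩
    exact ⟨s + t, map_add _ s t⟩
  · intro y φ w
    obtain ⟨ξ, rfl⟩ := (hb y.1 y.2).2 w
    exact ⟨R.lmk X x y φ ξ, R.latchingFunc_lmk _ _ y φ ξ⟩

/-- Bijectivity of the latching morphism at `x` is preserved by a morphism that is bijective at `x`
and at the objects of smaller degree. -/
lemma bijective_latchingMap_of_bijective {X X' : LMod k C} {x : C} (j : X ⟶ X')
    (hb : ∀ y, R.deg y < R.deg x ∨ y = x → Function.Bijective (app j y))
    (hl : Function.Bijective (R.latchingMap X x)) : Function.Bijective (R.latchingMap X' x) := by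
  have hL := latchingFunc_surjective j fun y hy => hb y (.inl hy)
  refine ⟨(injective_iff_map_eq_zero _).2 fun t ht => ?_, fun w => ?_⟩
  · obtain ⟨s, rfl⟩ := hL t
    rw [latchingMap_naturality] at ht
    have h1 : R.latchingMap X x s = 0 := (hb x (.inr rfl)).1 (ht.trans (map_zero _).symm)
    rw [hl.1 (h1.trans (map_zero _).symm), map_zero]
  · obtain ⟨ξ, rfl⟩ := (hb x (.inr rfl)).2 w
    obtain ⟨s, rfl⟩ := hl.2 ξ
    exact ⟨_, R.latchingMap_naturality j s⟩

/-- If `j : X ⟶ X'` is bijective at the objects of degree less than `d(x)`, then `X'` is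
good at `x` as soon as the map from `L_x X` to the relative matching object of `π` at `x` factors
through `X'(x)` as an injection with cokernel in `𝒞_x` followed by a surjection with kernel in
`𝒟_x`: the latching and relative matching objects at `x` do not see the difference. -/
lemma isGood_of_factorization (h : ∀ x, IsCompleteCotorsionPair (𝒞 x) (𝒟 x))
    {X X' N : LMod k C} {x : C} {π : X ⟶ N} {π' : X' ⟶ N} (j : X ⟶ X') (hj : j ≫ π' = π)
    (hb : ∀ y, R.deg y < R.deg x → Function.Bijective (app j y))
    {V : Type u} [AddCommGroup V] [Module (R.A x) V] (i : X.val x →ₗ[R.A x] V)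
    (q : V →ₗ[R.A x] R.RelMatching π x) (κ : V →ₗ[R.A x] X'.val x) (hκ : Function.Bijective κ)
    (hκi : ∀ ξ, κ (i ξ) = app j x ξ)
    (hdown : ∀ (z : R.Below x) (g : x ⟶ z.1) (v : V),
      X'.act g (κ v) = app j z.1 ((q v).1.1.1 z g))
    (hπ : ∀ v, app π' x (κ v) = (q v).1.2)
    (hl : Function.Injective (i.comp (R.latchingMap X x)))
    (hc : 𝒞 x (ModuleCat.of (R.A x) (V ⧸ LinearMap.range (i.comp (R.latchingMap X x)))))
    (hq : Function.Surjective q) (hk : 𝒟 x (ModuleCat.of (R.A x) (LinearMap.ker q))) :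
    R.IsGood 𝒞 𝒟 π' x := by
  have hL := latchingFunc_surjective j hb
  have hLl : ∀ t, R.latchingMap X' x (R.latchingFunc x (app j) (naturalBelow_app _ j) t) =
      κ (i.comp (R.latchingMap X x) t) := fun t => by
    rw [latchingMap_naturality, LinearMap.comp_apply, hκi]
  let e := LinearEquiv.ofBijective κ hκ
  have he : ∀ v, e v = κ v := fun _ => rfl
  constructor
  · refine (injective_iff_map_eq_zero _).2 fun t ht => ?_
    obtain ⟨s, rfl⟩ := hL t
    rw [hLl] at ht
    have h1 : i.comp (R.latchingMap X x) s = 0 := hκ.1 (ht.trans (map_zero κ).symm)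
    rw [hl (h1.trans (map_zero _).symm), map_zero]
  · have hr : (LinearMap.range (i.comp (R.latchingMap X x))).map (e : V →ₗ[R.A x] X'.val x) =
        LinearMap.range (R.latchingMap X' x) := by
      apply le_antisymm
      · rintro _ ⟨_, ⟨t, rfl⟩, rfl⟩
        exact ⟨_, hLl t⟩
      · rintro _ ⟨t, rfl⟩
        obtain ⟨s, rfl⟩ := hL t
        exact ⟨_, ⟨s, rfl⟩, (hLl s).symm⟩
    exact (h x).left_of_iso hc (Submodule.Quotient.equiv _ _ e hr).toModuleIso
  · rintro ⟨⟨m, n⟩, hmn⟩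
    rw [mem_relMatching] at hmn
    have hex : ∀ (z : R.Below x) (f : x ⟶ z.1), ∃ ξ, app j z.1 ξ = m.1 z f := fun z f =>
      (hb z.1 z.2).2 _
    let eb : ∀ z : R.Below x, X.val z.1 ≃ₗ[k] X'.val z.1 := fun z =>
      LinearEquiv.ofBijective (app j z.1) (hb z.1 z.2)
    have heb : ∀ (z : R.Below x) w, app j z.1 ((eb z).symm w) = w := fun z w =>
      (eb z).apply_symm_apply w
    let m' : R.Matching X x := ⟨fun z => (eb z).symm.toLinearMap.comp (m.1 z), fun y z f φ => by
      refine (hb z.1 z.2).1 ?_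
      rw [app_act]
      refine (heb z _).trans ((m.2 y z f φ).trans ?_)
      exact congrArg (X'.act f) (heb y _).symm⟩
    have hm' : ∀ z φ, app j z.1 (m'.1 z φ) = m.1 z φ := fun z φ => heb z _
    obtain ⟨v, hv⟩ := hq ⟨(m', n), R.mem_relMatching.2 fun z φ => by
      change app π z.1 (m'.1 z φ) = N.act φ n
      rw [← hmn z φ, ← app_congr hj, app_comp, hm']⟩
    refine ⟨κ v, R.relMatchingMap_eq_iff.2 ⟨fun z φ => ?_, ?_⟩⟩
    · rw [hdown, hv]
      exact hm' z φ
    · rw [hπ, hv]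
  · have hr : (LinearMap.ker q).map (e : V →ₗ[R.A x] X'.val x) =
        LinearMap.ker (R.relMatchingMap π' x) := by
      have hmem : ∀ v, κ v ∈ LinearMap.ker (R.relMatchingMap π' x) ↔ v ∈ LinearMap.ker q := by
        intro v
        rw [mem_ker_relMatchingMap, LinearMap.mem_ker]
        constructor
        · rintro ⟨h1, h2⟩
          refine Subtype.ext (Prod.ext (R.matching_ext fun z φ => (hb z.1 z.2).1 ?_) ?_)
          · rw [← hdown, h1]
            exact (map_zero _).symm
          · rw [← hπ, h2]
            rfl
        · intro hv
          refine ⟨fun z φ => ?_, ?_⟩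
          · rw [hdown, hv]
            exact map_zero _
          · rw [hπ, hv]
            rfl
      apply le_antisymm
      · rintro _ ⟨v, hv, rfl⟩
        exact (hmem v).2 hv
      · intro w hw
        obtain ⟨v, rfl⟩ := hκ.2 w
        exact ⟨v, (hmem v).1 hw, rfl⟩
    exact (h x).right_of_iso hk
      ((e.submoduleMap _).trans (LinearEquiv.ofEq _ _ hr)).toModuleIso

lemma IsGood.of_bijective (h : ∀ x, IsCompleteCotorsionPair (𝒞 x) (𝒟 x))
    {X X' N : LMod k C} {x : C} {π : X ⟶ N} {π' : X' ⟶ N} (j : X ⟶ X') (hj : j ≫ π' = π)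
    (hb : ∀ y, R.deg y < R.deg x ∨ y = x → Function.Bijective (app j y))
    (hg : R.IsGood 𝒞 𝒟 π x) : R.IsGood 𝒞 𝒟 π' x :=
  isGood_of_factorization h j hj (fun y hy => hb y (.inl hy)) LinearMap.id (R.relMatchingMap π x)
    (R.appA j x) (hb x (.inr rfl)) (fun _ => rfl) (fun z g v => (app_act j g v).symm)
    (fun v => (app_congr hj x v)) hg.injective hg.coker hg.surjective hg.ker

lemma IsSettled.of_bijective (h : ∀ x, IsCompleteCotorsionPair (𝒞 x) (𝒟 x))
    {X X' N : LMod k C} {x : C} {π : X ⟶ N} {π' : X' ⟶ N} (j : X ⟶ X') (hj : j ≫ π' = π)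
    (hb : ∀ y, R.deg y < R.deg x ∨ y = x → Function.Bijective (app j y))
    (hs : R.IsSettled 𝒞 𝒟 π x) : R.IsSettled 𝒞 𝒟 π' x := by
  intro y hy
  refine (hs y hy).of_bijective h j hj fun z hz => hb z ?_
  rcases hy with hy | rfl
  · rcases hz with hz | rfl
    · exact .inl (hz.trans hy)
    · exact .inl hy
  · exact hz

lemma IsSettled.mono {X N : LMod k C} {x y : C} {π : X ⟶ N} (hs : R.IsSettled 𝒞 𝒟 π x)
    (hy : R.deg y < R.deg x) : R.IsSettled 𝒞 𝒟 π y := by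
  rintro z (hz | rfl)
  · exact hs z (.inl (hz.trans hy))
  · exact hs _ (.inl hy)

variable (R 𝒞 𝒟) in
/-- At the objects where it is not settled yet, `X` is freely generated by its values at objects
of smaller degree. -/
def FreeAtUnsettled {X N : LMod k C} (π : X ⟶ N) : Prop :=
  ∀ x, ¬ R.IsSettled 𝒞 𝒟 π x → Function.Bijective (R.latchingMap X x)

/-- An unsettled object of least degree can be settled by changing the value of `X` there, without
changes at the settled objects. -/
lemma exists_settle (h : ∀ x, IsCompleteCotorsionPair (𝒞 x) (𝒟 x)) {X N : LMod k C} {π : X ⟶ N}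
    (hf : R.FreeAtUnsettled 𝒞 𝒟 π) (hu : ∃ x, ¬ R.IsSettled 𝒞 𝒟 π x) :
    ∃ (X' : LMod k C) (j : X ⟶ X') (π' : X' ⟶ N), j ≫ π' = π ∧ R.FreeAtUnsettled 𝒞 𝒟 π' ∧
      (∀ y, R.IsSettled 𝒞 𝒟 π y → Function.Bijective (app j y) ∧ R.IsSettled 𝒞 𝒟 π' y) ∧
      ∃ x, ¬ R.IsSettled 𝒞 𝒟 π x ∧ R.IsSettled 𝒞 𝒟 π' x := by
  obtain ⟨x, hx, hmin⟩ := exists_minimalFor_of_wellFoundedLT (fun x => ¬ R.IsSettled 𝒞 𝒟 π x)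
    R.deg hu
  have hmin' : ∀ y, R.deg y < R.deg x → R.IsSettled 𝒞 𝒟 π y := fun y hy => by
    by_contra hy'
    exact absurd (hmin hy' hy.le) (not_le.2 hy)
  obtain ⟨V, i, q, hiq, hi, hc, hq, hk⟩ := (h x).exists_factorization
    (L := X.val x) (P := R.RelMatching π x) (R.relMatchingMap π x)
  let : Module k V := Module.compHom V (algebraMap k (R.A x))
  have : IsScalarTower k (R.A x) V := IsScalarTower.of_algebraMap_smul fun r v => rfl
  obtain ⟨X', j, π', κ, hX'⟩ := R.exists_isAttached i q hiq
  have hlx := hf x hx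
  have hb : ∀ y, R.deg y ≤ R.deg x → y ≠ x → Function.Bijective (app j y) := fun y hy hyx =>
    hX'.bijective_app hiq hyx hy
  have hblt : ∀ y, R.deg y < R.deg x → Function.Bijective (app j y) := fun y hy =>
    hb y hy.le (by rintro rfl; exact lt_irrefl _ hy)
  have hset : ∀ y, R.IsSettled 𝒞 𝒟 π y → R.deg y ≤ R.deg x ∧ y ≠ x := fun y hy =>
    ⟨le_of_not_gt fun hlt => hx (hy.mono hlt), by rintro rfl; exact hx hy⟩
  have hold : ∀ y, R.IsSettled 𝒞 𝒟 π y → Function.Bijective (app j y) ∧ R.IsSettled 𝒞 𝒟 π' y := by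
    intro y hy
    obtain ⟨h1, h2⟩ := hset y hy
    refine ⟨hb y h1 h2, hy.of_bijective h j hX'.comp_eq ?_⟩
    rintro z (hz | rfl)
    · exact hblt z (hz.trans_le h1)
    · exact hb _ h1 h2
  -- As `X` is free at the unsettled object `x`, its latching morphism there is surjective.
  have hr : LinearMap.range (i.comp (R.latchingMap X x)) = LinearMap.range i := by
    rw [LinearMap.range_comp, LinearMap.range_eq_top.2 hlx.2, Submodule.map_top]
  have hnew : R.IsSettled 𝒞 𝒟 π' x := by
    rintro y (hy | rfl)
    · exact (hold y (hmin' y hy)).2 y (.inr rfl)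
    · refine isGood_of_factorization h j hX'.comp_eq hblt i q κ (hX'.bijective_incl hiq) hX'.incl
        hX'.down hX'.proj (hi.comp hlx.1) ?_ hq hk
      rw [hr]
      exact hc
  refine ⟨X', j, π', hX'.comp_eq, fun y hy => ?_, hold, x, hx, hnew⟩
  have hyx : y ≠ x := by rintro rfl; exact hy hnew
  have hy' : ¬ R.IsSettled 𝒞 𝒟 π y := fun hs => hy (hold y hs).2
  rcases le_or_gt (R.deg y) (R.deg x) with hle | hlt
  · refine bijective_latchingMap_of_bijective j ?_ (hf y hy')
    rintro z (hz | rfl)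
    · exact hblt z (hz.trans_le hle)
    · exact hb _ hle hyx
  · exact hX'.bijective_latchingMap hlt (hf y hy')

end ReedyStructure

end Good

/-! ### Colimits of modules -/

section Colimits

variable {k : Type u} [CommRing k] {C : Type u} [SmallCategory C] [Preadditive C] [Linear k C]

namespace LMod

instance (J : Type u) [Category.{u} J] :
    (isLinearFunctor k C).IsClosedUnderColimitsOfShape J where
  colimitsOfShape_le := by
    rintro X ⟨p⟩
    have hj := p.prop_diag_obj
    have hl := fun y : C =>
      isColimitOfPreserves ((evaluation C (ModuleCat.{u} k)).obj y) p.isColimit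
    have h₁ := fun j => (hj j).1
    have h₂ := fun j => (hj j).2
    refine ⟨⟨fun {x y a b} => ?_⟩, ⟨fun {x y} a r => ?_⟩⟩
    · refine (hl x).hom_ext fun j => ?_
      have hn : ∀ c : x ⟶ y, (p.ι.app j).app x ≫ X.map c =
          (p.diag.obj j).map c ≫ (p.ι.app j).app y := fun c => ((p.ι.app j).naturality c).symm
      change (p.ι.app j).app x ≫ X.map (a + b) = (p.ι.app j).app x ≫ (X.map a + X.map b)
      rw [Preadditive.comp_add, hn, hn, hn, Functor.map_add, Preadditive.add_comp]
    · refine (hl x).hom_ext fun j => ?_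
      have hn : ∀ c : x ⟶ y, (p.ι.app j).app x ≫ X.map c =
          (p.diag.obj j).map c ≫ (p.ι.app j).app y := fun c => ((p.ι.app j).naturality c).symm
      change (p.ι.app j).app x ≫ X.map (r • a) = (p.ι.app j).app x ≫ (r • X.map a)
      rw [Linear.comp_smul, hn, hn, Functor.map_smul, Linear.smul_comp]

instance : HasColimitsOfSize.{u, u} (LMod k C) where
  has_colimits_of_shape J _ := inferInstance

/-- Evaluation at `x`, as a functor to `k`-modules. -/
abbrev evalAt (x : C) : LMod k C ⥤ ModuleCat.{u} k :=
  (isLinearFunctor k C).ι ⋙ (evaluation C (ModuleCat.{u} k)).obj x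

section

variable {J : Type u} [Category.{u} J] {F : J ⥤ LMod k C} {c : Cocone F} (hc : IsColimit c)

include hc

lemma colimit_hom_ext (x : C) {V : Type u} [AddCommGroup V] [Module k V]
    {s t : c.pt.val x →ₗ[k] V} (h : ∀ i ξ, s (app (c.ι.app i) x ξ) = t (app (c.ι.app i) x ξ))
    (v : c.pt.val x) : s v = t v := by
  have h1 : ModuleCat.ofHom s = ModuleCat.ofHom t :=
    (isColimitOfPreserves (evalAt x) hc).hom_ext fun i => ModuleCat.hom_ext (LinearMap.ext (h i))
  exact congrArg (fun t => t.hom v) h1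

lemma exists_colimit_desc (x : C) {V : Type u} [AddCommGroup V] [Module k V]
    (s : ∀ i, (F.obj i).val x →ₗ[k] V)
    (hs : ∀ (i j : J) (f : i ⟶ j) ξ, s j (app (F.map f) x ξ) = s i ξ) :
    ∃ t : c.pt.val x →ₗ[k] V, ∀ i ξ, t (app (c.ι.app i) x ξ) = s i ξ := by
  let d : Cocone (F ⋙ evalAt x) :=
    { pt := ModuleCat.of k V
      ι :=
        { app := fun i => ModuleCat.ofHom (s i)
          naturality := fun i j f => ModuleCat.hom_ext (LinearMap.ext (hs i j f)) } }
  let hl := isColimitOfPreserves (evalAt x) hc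
  exact ⟨(hl.desc d).hom, fun i ξ => congrArg (fun t => t.hom ξ) (hl.fac d i)⟩

/-- The components at `x` of the morphisms to the colimit of a diagram that is eventually constant
at `x`. -/
lemma bijective_app_colimit [IsFiltered J] (x : C) (i : J)
    (hi : ∀ (j : J) (f : i ⟶ j), Function.Bijective (app (F.map f) x)) :
    Function.Bijective (app (c.ι.app i) x) := by
  have h : (F ⋙ evalAt x).IsEventuallyConstantFrom i := fun j f =>
    (ConcreteCategory.isIso_iff_bijective ((F ⋙ evalAt x).map f)).2 (hi j f)
  have h1 := h.isIso_ι_of_isColimit (isColimitOfPreserves (evalAt x) hc)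
  exact (ConcreteCategory.isIso_iff_bijective _).1 h1

set_option maxHeartbeats 1000000 in
/-- Bijectivity of latching morphisms is preserved by colimits. -/
lemma bijective_latchingMap_colimit (R : ReedyStructure k C) (x : C)
    (h : ∀ i, Function.Bijective (R.latchingMap (F.obj i) x)) :
    Function.Bijective (R.latchingMap c.pt x) := by
  let e := fun i => LinearEquiv.ofBijective (R.latchingMap (F.obj i) x) (h i)
  let L := fun i => R.latchingFunc x (app (c.ι.app i)) (R.naturalBelow_app _ (c.ι.app i))
  have he : ∀ i t, (e i).symm (R.latchingMap (F.obj i) x t) = t := fun i t =>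
    (e i).symm_apply_apply t
  have hL : ∀ i y φ ξ, L i (R.lmk (F.obj i) x y φ ξ) = R.lmk c.pt x y φ (app (c.ι.app i) y.1 ξ) :=
    fun i y φ ξ => R.latchingFunc_lmk _ _ y φ ξ
  obtain ⟨D, hD⟩ := exists_colimit_desc hc x (V := R.Latching c.pt x)
    (fun i =>
      { toFun := fun ξ => L i ((e i).symm ξ)
        map_add' := fun ξ η => by rw [map_add, map_add]
        map_smul' := fun r ξ => by
          rw [RingHom.id_apply, ← algebraMap_smul (R.A x) r ξ, map_smul, map_smul,
            algebraMap_smul] })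
    (by
      intro i j f ξ
      obtain ⟨t, rfl⟩ := (h i).2 ξ
      change L j ((e j).symm (app (F.map f) x (R.latchingMap (F.obj i) x t))) =
        L i ((e i).symm (R.latchingMap (F.obj i) x t))
      rw [← ReedyStructure.latchingMap_naturality, he, he]
      refine R.latching_induction (motive := fun t => L j (R.latchingFunc x (app (F.map f))
        (R.naturalBelow_app _ (F.map f)) t) = L i t) t ?_ ?_ ?_
      · simp only [map_zero]
      · intro s t hs ht
        simp only [map_add, hs, ht]
      · intro y φ ξ
        rw [ReedyStructure.latchingFunc_lmk, hL, hL, ← app_comp, c.w])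
  have hDl : ∀ t, D (R.latchingMap c.pt x t) = t := by
    intro t
    refine R.latching_induction (motive := fun t => D (R.latchingMap c.pt x t) = t) t
      (by rw [map_zero, map_zero]) (fun s t hs ht => by rw [map_add, map_add, hs, ht]) ?_
    intro y φ w
    rw [ReedyStructure.latchingMap_lmk]
    refine colimit_hom_ext hc y.1 (s := D.comp (c.pt.act φ)) (t := R.lmk c.pt x y φ)
      (fun i ξ => ?_) w
    change D (c.pt.act φ (app (c.ι.app i) y.1 ξ)) = _
    rw [← app_act, hD]
    change L i ((e i).symm ((F.obj i).act φ ξ)) = _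
    rw [← R.latchingMap_lmk y φ ξ, he, hL]
  refine ⟨Function.LeftInverse.injective hDl, fun w => ?_⟩
  let W : Submodule k (c.pt.val x) := (LinearMap.range (R.latchingMap c.pt x)).restrictScalars k
  have hW : W.mkQ w = (0 : c.pt.val x →ₗ[k] _ ⧸ W) w := by
    refine colimit_hom_ext hc x (s := W.mkQ) (t := 0) (fun i ξ => ?_) w
    refine (Submodule.Quotient.mk_eq_zero W).2 ?_
    obtain ⟨t, rfl⟩ := (h i).2 ξ
    exact ⟨_, R.latchingMap_naturality (c.ι.app i) t⟩
  exact (Submodule.Quotient.mk_eq_zero W).1 hW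

end

lemma bijective_latchingMap_of_isZero (R : ReedyStructure k C) {X : LMod k C} (hX : IsZero X)
    (x : C) : Function.Bijective (R.latchingMap X x) := by
  have h0 : ∀ (y : C) (v : X.val y), v = 0 := fun y v =>
    app_congr (hX.eq_of_src (𝟙 X) 0) y v
  have h1 : ∀ t : R.Latching X x, t = 0 := fun t =>
    R.latching_induction (motive := fun t => t = 0) t rfl
      (fun s t hs ht => by rw [hs, ht, add_zero])
      fun y φ ξ => by rw [h0 y.1 ξ, map_zero]
  exact ⟨fun s t _ => (h1 s).trans (h1 t).symm, fun v => ⟨0, (map_zero _).trans (h0 x v).symm⟩⟩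

end LMod

end Colimits

/-! ### Transfinite construction of good objects -/

section Iteration

variable {k : Type u} [CommRing k] {C : Type u} [SmallCategory C] [Preadditive C] [Linear k C]

namespace ReedyStructure

open LMod SmallObject ZeroObject

variable {R : ReedyStructure k C} {𝒞 𝒟 : ∀ x : C, ObjectProperty (ModuleCat.{u} (R.A x))}
variable {N : LMod k C}

variable (R 𝒞 𝒟) in
/-- `IsSettled` for objects over `N`. -/
def OverSettled (X : Over N) (x : C) : Prop :=
  R.IsSettled 𝒞 𝒟 (X := X.left) (N := N) X.hom x

variable (R 𝒞 𝒟) in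
/-- `FreeAtUnsettled` for objects over `N`. -/
def OverFree (X : Over N) : Prop :=
  R.FreeAtUnsettled 𝒞 𝒟 (X := X.left) (N := N) X.hom

lemma exists_overSettle (h : ∀ x, IsCompleteCotorsionPair (𝒞 x) (𝒟 x)) (X : Over N) :
    ∃ (X' : Over N) (f : X ⟶ X'), R.OverFree 𝒞 𝒟 X → R.OverFree 𝒞 𝒟 X' ∧
      (∀ y, R.OverSettled 𝒞 𝒟 X y →
        Function.Bijective (app f.left y) ∧ R.OverSettled 𝒞 𝒟 X' y) ∧
      ((∃ x, ¬ R.OverSettled 𝒞 𝒟 X x) →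
        ∃ x, ¬ R.OverSettled 𝒞 𝒟 X x ∧ R.OverSettled 𝒞 𝒟 X' x) := by
  by_cases hX : R.OverFree 𝒞 𝒟 X ∧ ∃ x, ¬ R.OverSettled 𝒞 𝒟 X x
  · obtain ⟨X', j, π', hj, h1, h2, h3⟩ := exists_settle h hX.1 hX.2
    exact ⟨Over.mk π', Over.homMk j hj, fun _ => ⟨h1, h2, fun _ => h3⟩⟩
  · exact ⟨X, 𝟙 X, fun hf => ⟨hf, fun y hy => ⟨Function.bijective_id, hy⟩,
      fun hu => absurd ⟨hf, hu⟩ hX⟩⟩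

lemma OverSettled.of_bijective (h : ∀ x, IsCompleteCotorsionPair (𝒞 x) (𝒟 x)) {X X' : Over N}
    {x : C} (f : X ⟶ X') (hb : ∀ y, R.deg y < R.deg x ∨ y = x → Function.Bijective (app f.left y))
    (hs : R.OverSettled 𝒞 𝒟 X x) : R.OverSettled 𝒞 𝒟 X' x :=
  IsSettled.of_bijective h f.left (Over.w f) hb hs

lemma bijective_app_of_isIso {X Y : LMod k C} (f : X ⟶ Y) [IsIso f] (y : C) :
    Function.Bijective (app f y) := by
  refine Function.bijective_iff_has_inverse.2 ⟨app (inv f) y, fun v => ?_, fun v => ?_⟩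
  · exact app_congr (IsIso.hom_inv_id f) y v
  · exact app_congr (IsIso.inv_hom_id f) y v

lemma bijective_left_of_isIso {X X' : Over N} (f : X ⟶ X') [IsIso f] (y : C) :
    Function.Bijective (app f.left y) :=
  bijective_app_of_isIso ((Over.forget N).map f) y

lemma OverSettled.of_iso (h : ∀ x, IsCompleteCotorsionPair (𝒞 x) (𝒟 x)) {X X' : Over N}
    {x : C} (e : X ≅ X') (hs : R.OverSettled 𝒞 𝒟 X x) : R.OverSettled 𝒞 𝒟 X' x :=
  hs.of_bijective h e.hom fun y _ => bijective_left_of_isIso _ y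

lemma OverFree.of_iso (h : ∀ x, IsCompleteCotorsionPair (𝒞 x) (𝒟 x)) {X X' : Over N}
    (e : X ≅ X') (hs : R.OverFree 𝒞 𝒟 X) : R.OverFree 𝒞 𝒟 X' := fun x hx =>
  bijective_latchingMap_of_bijective e.hom.left (fun y _ => bijective_left_of_isIso _ y)
    (hs x fun hx' => hx (OverSettled.of_iso h e hx'))

section Functor

variable {J : Type u} [LinearOrder J]

variable (R 𝒞 𝒟) in
/-- The properties of a transfinite sequence of objects over `N` that hold up to the index `j`:
the `j`-th object is freely generated at the unsettled objects of `C`, and what has been settled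
does not change any more. -/
def SettledUpTo (F : J ⥤ Over N) (j : J) : Prop :=
  R.OverFree 𝒞 𝒟 (F.obj j) ∧ ∀ (i : J) (hij : i ≤ j) (y : C), R.OverSettled 𝒞 𝒟 (F.obj i) y →
    Function.Bijective (app (F.map (homOfLE hij)).left y) ∧ R.OverSettled 𝒞 𝒟 (F.obj j) y

lemma settledUpTo_of_isSuccLimit (h : ∀ x, IsCompleteCotorsionPair (𝒞 x) (𝒟 x))
    (F : J ⥤ Over N) [F.IsWellOrderContinuous] {j : J} (hj : Order.IsSuccLimit j)
    (ih : ∀ i < j, R.SettledUpTo 𝒞 𝒟 F i) : R.SettledUpTo 𝒞 𝒟 F j := by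
  have hc := isColimitOfPreserves (Over.forget N) (F.isColimitOfIsWellOrderContinuous j hj)
  have : Nonempty (Set.Iio j) := by
    obtain ⟨i, hi⟩ := not_isMin_iff.1 hj.not_isMin
    exact ⟨⟨i, hi⟩⟩
  have hmain : ∀ (i : J) (hij : i < j) (y : C), R.OverSettled 𝒞 𝒟 (F.obj i) y →
      Function.Bijective (app (F.map (homOfLE hij.le)).left y) := by
    intro i hij y hy
    refine bijective_app_colimit hc y ⟨i, hij⟩ fun i' f => ?_
    exact ((ih i'.1 i'.2).2 i (leOfHom f) y hy).1
  have hset : ∀ (i : J) (hij : i < j) (y : C), R.OverSettled 𝒞 𝒟 (F.obj i) y →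
      R.OverSettled 𝒞 𝒟 (F.obj j) y := by
    intro i hij y hy
    refine hy.of_bijective h (F.map (homOfLE hij.le)) fun z hz => hmain i hij z ?_
    rcases hz with hz | rfl
    · exact IsSettled.mono hy hz
    · exact hy
  refine ⟨fun x hx => ?_, fun i hij y hy => ?_⟩
  · refine bijective_latchingMap_colimit hc R x fun i => (ih i.1 i.2).1 x fun hi => hx ?_
    exact hset i.1 i.2 x hi
  · rcases hij.lt_or_eq with hlt | rfl
    · exact ⟨hmain i hlt y hy, hset i hlt y hy⟩
    · refine ⟨?_, hy⟩
      have : IsIso (F.map (homOfLE hij)) := by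
        rw [Subsingleton.elim (homOfLE hij) (𝟙 _)]
        infer_instance
      exact bijective_left_of_isIso _ y

lemma settledUpTo_succ [SuccOrder J] (h : ∀ x, IsCompleteCotorsionPair (𝒞 x) (𝒟 x))
    (F : J ⥤ Over N) {j : J} (ih : R.SettledUpTo 𝒞 𝒟 F j)
    (hfree : R.OverFree 𝒞 𝒟 (F.obj (Order.succ j)))
    (hsucc : ∀ y, R.OverSettled 𝒞 𝒟 (F.obj j) y →
      Function.Bijective (app (F.map (homOfLE (Order.le_succ j))).left y) ∧
        R.OverSettled 𝒞 𝒟 (F.obj (Order.succ j)) y) :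
    R.SettledUpTo 𝒞 𝒟 F (Order.succ j) := by
  refine ⟨hfree, fun i hij y hy => ?_⟩
  rcases Order.le_succ_iff_eq_or_le.1 hij with rfl | hle
  · refine ⟨?_, hy⟩
    have : IsIso (F.map (homOfLE hij)) := by
      rw [Subsingleton.elim (homOfLE hij) (𝟙 _)]
      infer_instance
    exact bijective_left_of_isIso _ y
  · obtain ⟨h1, h2⟩ := ih.2 i hle y hy
    obtain ⟨h3, h4⟩ := hsucc y h2
    refine ⟨?_, h4⟩
    have h5 : F.map (homOfLE hij) = F.map (homOfLE hle) ≫ F.map (homOfLE (Order.le_succ j)) := by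
      rw [← F.map_comp]
      rfl
    rw [h5]
    exact h3.comp h1

end Functor

/-- Every module is the target of a morphism that is good everywhere. It is reached in a transfinite
iteration of `exists_overSettle`, which stops because each step settles a new object of `C`. -/
theorem exists_good (h : ∀ x, IsCompleteCotorsionPair (𝒞 x) (𝒟 x)) (N : LMod k C) :
    ∃ (X : LMod k C) (π : X ⟶ N), ∀ x, R.IsGood 𝒞 𝒟 π x := by
  choose S f hS using exists_overSettle (R := R) (N := N) h
  let Φ : SuccStruct (Over N) := ⟨Over.mk (0 : (0 : LMod k C) ⟶ N), S, f⟩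
  -- The index set is a limit ordinal of larger cardinality than the set of objects.
  let κ : Cardinal.{u} := Order.succ (max Cardinal.aleph0 (Cardinal.mk C))
  have hκ : Cardinal.aleph0 ≤ κ := (le_max_left _ _).trans (Order.le_succ _)
  have hκC : Cardinal.mk C < κ := (le_max_right _ _).trans_lt (Order.lt_succ _)
  let J := κ.ord.ToType
  have : NoMaxOrder J := Cardinal.noMaxOrder hκ
  have : Nonempty J := Cardinal.mk_ne_zero_iff.1 (by
    rw [Cardinal.mk_ord_toType]
    exact (Cardinal.aleph0_pos.trans_le hκ).ne')
  let : OrderBot J := WellFoundedLT.toOrderBot J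
  let F := Φ.iterationFunctor J
  have hsucc : ∀ j, R.OverFree 𝒞 𝒟 (F.obj j) → R.OverFree 𝒞 𝒟 (F.obj (Order.succ j)) ∧
      (∀ y, R.OverSettled 𝒞 𝒟 (F.obj j) y →
        Function.Bijective (app (F.map (homOfLE (Order.le_succ j))).left y) ∧
          R.OverSettled 𝒞 𝒟 (F.obj (Order.succ j)) y) ∧
      ((∃ x, ¬ R.OverSettled 𝒞 𝒟 (F.obj j) x) → ∃ x, ¬ R.OverSettled 𝒞 𝒟 (F.obj j) x ∧
        R.OverSettled 𝒞 𝒟 (F.obj (Order.succ j)) x) := by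
    intro j hj
    obtain ⟨h1, h2, h3⟩ := hS _ hj
    have hmap := Φ.iterationFunctor_map_succ j (not_isMax j)
    refine ⟨OverFree.of_iso h (Φ.iterationFunctorObjSuccIso j (not_isMax j)).symm h1,
      fun y hy => ⟨?_, ?_⟩, fun hu => ?_⟩
    · change Function.Bijective (app ((Φ.iterationFunctor J).map _).left y)
      rw [hmap]
      exact (bijective_left_of_isIso
        ((Φ.iterationFunctorObjSuccIso j (not_isMax j)).inv) y).comp (h2 y hy).1
    · exact OverSettled.of_iso h (Φ.iterationFunctorObjSuccIso j (not_isMax j)).symm (h2 y hy).2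
    · obtain ⟨x, hx, hx'⟩ := h3 hu
      exact ⟨x, hx, OverSettled.of_iso h (Φ.iterationFunctorObjSuccIso j (not_isMax j)).symm hx'⟩
  have hF : ∀ j, R.SettledUpTo 𝒞 𝒟 F j := by
    intro j
    induction j using SuccOrder.limitRecOn with
    | isMin j hj =>
      obtain rfl := hj.eq_bot
      refine ⟨OverFree.of_iso h (Φ.iterationFunctorObjBotIso J).symm fun x _ =>
        bijective_latchingMap_of_isZero R (isZero_zero _) x, fun i hij y hy => ?_⟩
      obtain rfl := le_bot_iff.1 hij
      refine ⟨?_, hy⟩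
      have : IsIso (F.map (homOfLE hij)) := by
        rw [Subsingleton.elim (homOfLE hij) (𝟙 _)]
        infer_instance
      exact bijective_left_of_isIso _ y
    | succ j hj ih =>
      obtain ⟨h1, h2, -⟩ := hsucc j ih.1
      exact settledUpTo_succ h F ih h1 h2
    | isSuccLimit j hj ih => exact settledUpTo_of_isSuccLimit h F hj ih
  -- If something stays unsettled forever, then every step settles a new object of `C`.
  by_contra! hno
  have hu : ∀ j, ∃ x, ¬ R.OverSettled 𝒞 𝒟 (F.obj j) x := by
    intro j
    obtain ⟨x, hx⟩ := hno (F.obj j).left (F.obj j).hom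
    exact ⟨x, fun hx' => hx (hx' x (.inr rfl))⟩
  choose s hs hs' using fun j => (hsucc j (hF j).1).2.2 (hu j)
  have hlt : ∀ i j, i < j → s i ≠ s j := fun i j hij he =>
    hs j (he ▸ ((hF j).2 _ (Order.succ_le_of_lt hij) _ (hs' i)).2)
  have hinj : Function.Injective s := fun i j hij => by
    rcases lt_trichotomy i j with hl | rfl | hl
    · exact absurd hij (hlt i j hl)
    · rfl
    · exact absurd hij.symm (hlt j i hl)
  have hle := Cardinal.mk_le_of_injective hinj
  rw [Cardinal.mk_ord_toType] at hle
  exact absurd hle (not_le.2 hκC)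

end ReedyStructure

end Iteration

/-! ### Representable modules and special precovers -/

section Representables

variable {k : Type u} [CommRing k] {C : Type u} [SmallCategory C] [Preadditive C] [Linear k C]

namespace ReedyStructure

open LMod

variable (R : ReedyStructure k C)

lemma latchingMap_repr_injective (x y : C) :
    Function.Injective (R.latchingMap (repr k x) y) := by
  obtain ⟨H, hH⟩ := R.exists_linearMap_of_natural (R.deg y) (x := x) (y := y)
    (J := R.Latching (repr k x) y) (fun z hz => (R.lmk (repr k x) y ⟨z, hz⟩).flip)
    (fun z z' hz hz' g e f => (R.lmk_comp (Y := repr k x) ⟨z, hz⟩ ⟨z', hz'⟩ e f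
      (show (repr k x).val z from g)).symm)
  refine Function.LeftInverse.injective (g := H) fun t => ?_
  refine R.latching_induction (motive := fun t => H (R.latchingMap (repr k x) y t) = t) t
    ((congrArg H (map_zero _)).trans (map_zero H)) (fun s t hs ht => ?_) fun z φ g => ?_
  · refine (congrArg H (map_add (R.latchingMap (repr k x) y) s t)).trans ?_
    exact (map_add H _ _).trans (congrArg₂ (· + ·) hs ht)
  · exact (congrArg H (R.latchingMap_lmk z φ g)).trans (hH z.1 z.2 g φ)

/-- The range of the latching morphism of `C(x, -)` at `y` consists of the morphisms through
objects of degree less than `d(y)`. -/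
lemma mem_range_latchingMap_repr {x y : C} (f : x ⟶ y) :
    f ∈ LinearMap.range (R.latchingMap (repr k x) y) ↔ f ∈ R.lower (R.deg y) x y := by
  constructor
  · rintro ⟨t, rfl⟩
    refine R.latching_induction
      (motive := fun t => R.latchingMap (repr k x) y t ∈ R.lower (R.deg y) x y) t ?_ ?_ ?_
    · exact (congrArg (· ∈ R.lower (R.deg y) x y) (map_zero (R.latchingMap (repr k x) y))).mpr
        (Submodule.zero_mem _)
    · intro s t hs ht
      exact (congrArg (· ∈ R.lower (R.deg y) x y) (map_add (R.latchingMap (repr k x) y) s t)).mpr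
        (Submodule.add_mem _ hs ht)
    · intro z φ g
      exact (congrArg (· ∈ R.lower (R.deg y) x y) (R.latchingMap_lmk z φ g)).mpr
        (comp_mem_lower z.2 g φ)
  · intro hf
    refine R.lower_induction
      (motive := fun f => f ∈ LinearMap.range (R.latchingMap (repr k x) y)) hf
      (Submodule.zero_mem _) (fun f g => Submodule.add_mem _) (fun r f hf => ?_) fun z g h hz => ?_
    · exact ((LinearMap.range (R.latchingMap (repr k x) y)).restrictScalars k).smul_mem r hf
    · exact R.act_mem_range_latchingMap (Y := repr k x) hz h g

variable {R} in
lemma projective_minus (hminus : R.MinusLeftProjective) (x y : C) :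
    Module.Projective (R.A y) (R.minus.hom x y) := by
  classical
  have := hminus y
  exact Module.Projective.of_split (DirectSum.lof (R.A y) C (fun x => R.minus.hom x y) x)
    (DirectSum.component (R.A y) C (fun x => R.minus.hom x y) x)
    (LinearMap.ext fun m => DirectSum.component.lof_self (M := fun x => R.minus.hom x y)
      (R.A y) x m)

/-- The cokernel of the latching morphism of `C(x, -)` at `y` is `C⁻(x, y)`. -/
lemma projective_coker_latchingMap_repr (hminus : R.MinusLeftProjective) (x y : C) :
    Module.Projective (R.A y)
      ((repr k x).val y ⧸ LinearMap.range (R.latchingMap (repr k x) y)) := by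
  have := projective_minus hminus x y
  obtain ⟨μ, hμ₁, hμ₂, hμ₃⟩ := R.exists_minusProj x y
  let ι : R.minus.hom x y →ₗ[R.A y] (repr k x).val y :=
    { toFun := fun m => m.1
      map_add' := fun m n => rfl
      map_smul' := fun a m => rfl }
  let φ : R.minus.hom x y →ₗ[R.A y]
      (repr k x).val y ⧸ LinearMap.range (R.latchingMap (repr k x) y) :=
    (LinearMap.range (R.latchingMap (repr k x) y)).mkQ.comp ι
  refine Module.Projective.of_equiv (LinearEquiv.ofBijective φ ⟨?_, fun t => ?_⟩)
  · refine (injective_iff_map_eq_zero φ).2 fun m hm => ?_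
    have h1 : (show (repr k x).val y from m.1) ∈
        LinearMap.range (R.latchingMap (repr k x) y) := (Submodule.Quotient.mk_eq_zero _).1 hm
    rw [← hμ₁ m, hμ₂ _ ((R.mem_range_latchingMap_repr _).1 h1)]
  · obtain ⟨f, rfl⟩ := Submodule.Quotient.mk_surjective _ t
    refine ⟨μ f, ((Submodule.Quotient.eq _).2 ?_).symm⟩
    exact (R.mem_range_latchingMap_repr _).2 (hμ₃ f)

variable {R}

/-- Matching objects are values of the functor of natural transformations out of a representable
functor, so that the elements of matching objects lift along a morphism with surjective relative
matching morphisms. -/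
lemma exists_matching_lift (hminus : R.MinusLeftProjective) {E B : LMod k C} {p : E ⟶ B} {x : C}
    (hp : ∀ y, R.deg y < R.deg x → Function.Surjective (R.relMatchingMap p y))
    (μ : R.Matching B x) : ∃ μ' : R.Matching E x, ∀ y φ, app p y.1 (μ'.1 y φ) = μ.1 y φ := by
  classical
  let b : ∀ y, (repr k x).val y →ₗ[k] B.val y := fun y =>
    if hy : R.deg y < R.deg x then μ.1 ⟨y, hy⟩ else 0
  have hb : ∀ y (hy : R.deg y < R.deg x) (φ : x ⟶ y), b y φ = μ.1 ⟨y, hy⟩ φ := by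
    intro y hy φ
    have h1 : b y = μ.1 ⟨y, hy⟩ := dif_pos hy
    exact LinearMap.congr_fun h1 φ
  obtain ⟨s, hs, hsp⟩ := R.exists_lift_below (X := repr k x) (p := p) (b := b) (R.deg x)
    (fun y z f hy hz φ => by
      refine (hb z hz (φ ≫ f)).trans ((μ.2 ⟨y, hy⟩ ⟨z, hz⟩ f φ).trans ?_)
      exact congrArg (B.act f) (hb y hy φ).symm)
    (fun y _ => R.latchingMap_repr_injective x y) hp
    (fun y _ => by
      have := R.projective_coker_latchingMap_repr hminus x y
      have := ModuleCat.projective_of_module_projective (ModuleCat.of (R.A y)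
        ((repr k x).val y ⧸ LinearMap.range (R.latchingMap (repr k x) y)))
      exact extOneVanishes_of_projective _ _)
  exact ⟨⟨fun y => s y.1, fun y z f φ => hs y.1 z.1 f y.2 z.2 φ⟩,
    fun y φ => (hsp y.1 y.2 φ).trans (hb y.1 y.2 φ)⟩

/-- A morphism with surjective relative matching morphisms is surjective. -/
lemma app_surjective (hminus : R.MinusLeftProjective) {E B : LMod k C} {p : E ⟶ B}
    (hp : ∀ y, Function.Surjective (R.relMatchingMap p y)) (x : C) :
    Function.Surjective (app p x) := by
  intro v
  obtain ⟨μ, hμ⟩ := exists_matching_lift hminus (p := p) (fun y _ => hp y) (R.matchingMap B x v)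
  obtain ⟨ξ, hξ⟩ := hp x ⟨(μ, v), R.mem_relMatching.2 hμ⟩
  exact ⟨ξ, (R.relMatchingMap_eq_iff.1 hξ).2⟩

/-- The matching morphism of the kernel of a morphism is surjective if the relative matching
morphism is. -/
lemma matchingMap_surjective_of_kernel {K E B : LMod k C} {p : E ⟶ B} {i : K ⟶ E} {x : C}
    (hi : ∀ y, Function.Injective (app i y))
    (hip : ∀ y v, app p y v = 0 ↔ ∃ w, app i y w = v)
    (hp : Function.Surjective (R.relMatchingMap p x)) :
    Function.Surjective (R.matchingMap K x) := by
  intro μ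
  obtain ⟨ξ, hξ⟩ := hp ⟨(R.matchingFunc (app i) (naturalBelow_app _ i) μ, 0),
    R.mem_relMatching.2 fun y φ => ((hip y.1 _).2 ⟨μ.1 y φ, rfl⟩).trans (map_zero _).symm⟩
  obtain ⟨h1, h2⟩ := R.relMatchingMap_eq_iff.1 hξ
  obtain ⟨w, rfl⟩ := (hip x ξ).1 h2
  exact ⟨w, R.matching_ext fun y φ => hi y.1 ((app_act i φ w).trans (h1 y φ))⟩

variable {𝒞 𝒟 : ∀ x : C, ObjectProperty (ModuleCat.{u} (R.A x))}

lemma psi_of_kernel (h : ∀ x, IsCompleteCotorsionPair (𝒞 x) (𝒟 x)) {K E B : LMod k C} {p : E ⟶ B}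
    {i : K ⟶ E} (hi : ∀ y, Function.Injective (app i y))
    (hip : ∀ y v, app p y v = 0 ↔ ∃ w, app i y w = v) (hg : ∀ x, R.IsGood 𝒞 𝒟 p x) :
    R.Psi 𝒟 K := by
  intro x
  refine ⟨matchingMap_surjective_of_kernel hi hip (hg x).surjective, ?_⟩
  let e : LinearMap.ker (R.matchingMap K x) ≃ₗ[R.A x] LinearMap.ker (R.relMatchingMap p x) :=
    R.kerRelMatchingEquiv i hi hip
  exact (h x).right_of_iso (hg x).ker (LinearEquiv.toModuleIso (R := R.A x)
    (X₁ := LinearMap.ker (R.relMatchingMap p x)) (X₂ := LinearMap.ker (R.matchingMap K x)) e.symm)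

/-- Special precovers with respect to `Φ(𝒞)` and `Ψ(𝒟)`. -/
theorem exists_precover (hminus : R.MinusLeftProjective)
    (h : ∀ x, IsCompleteCotorsionPair (𝒞 x) (𝒟 x)) (N : LMod k C) :
    ∃ (K X : LMod k C) (i : K ⟶ X) (p : X ⟶ N), (∀ y, Function.Injective (app i y)) ∧
      (∀ y, Function.Surjective (app p y)) ∧ (∀ y v, app p y v = 0 ↔ ∃ w, app i y w = v) ∧
      R.Phi 𝒞 X ∧ R.Psi 𝒟 K := by
  obtain ⟨X, π, hg⟩ := exists_good (R := R) h N
  have hi : ∀ y, Function.Injective (app (kerι π) y) := fun y => Subtype.val_injective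
  have hip : ∀ y v, app π y v = 0 ↔ ∃ w, app (kerι π) y w = v := fun y v =>
    ⟨fun hv => by
      let u : LinearMap.ker (app π y) := ⟨v, hv⟩
      exact ⟨u, rfl⟩, by
      rintro ⟨w, rfl⟩
      exact Subtype.property (p := fun v => app π y v = 0) w⟩
  refine ⟨_, X, kerι π, π, hi, app_surjective hminus fun y => (hg y).surjective, hip,
    fun x => ⟨(hg x).injective, (hg x).coker⟩, psi_of_kernel h hi hip hg⟩

end ReedyStructure

end Representables

/-! ### Extending balanced bilinear maps -/

section Balanced

variable {k : Type u} [CommRing k] {A : Type u} [Ring A] [Algebra k A]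

/-- For a projective right `A`-module `P` and an injective `k`-module `J`, the `A`-module
`Hom(P, J)` is injective: balanced maps on `M × P` extend along injections `M ⟶ M'`. -/
lemma exists_balanced_extension {P : Type u} [AddCommGroup P] [Module k P] [Module Aᵐᵒᵖ P]
    [IsScalarTower k Aᵐᵒᵖ P] [Module.Projective Aᵐᵒᵖ P] (J : ModuleCat.{u} k) [Injective J]
    {M M' : Type u} [AddCommGroup M] [Module k M] [Module A M] [IsScalarTower k A M]
    [AddCommGroup M'] [Module k M'] [Module A M'] [IsScalarTower k A M']
    (n : M →ₗ[A] M') (hn : Function.Injective n) (b : M →ₗ[k] P →ₗ[k] J)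
    (hb : ∀ (a : A) m p, b (a • m) p = b m (MulOpposite.op a • p)) :
    ∃ B : M' →ₗ[k] P →ₗ[k] J, (∀ m p, B (n m) p = b m p) ∧
      ∀ (a : A) m p, B (a • m) p = B m (MulOpposite.op a • p) := by
  obtain ⟨s, hs⟩ := Module.Projective.out (R := Aᵐᵒᵖ) (P := P)
  let nk : M →ₗ[k] M' := n.restrictScalars k
  have hext : ∀ q : P, ∃ ψ : M' →ₗ[k] J, ∀ m, ψ (n m) = b m q := by
    intro q
    have : Mono (ModuleCat.ofHom nk) := (ModuleCat.mono_iff_injective _).2 hn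
    let β : ModuleCat.of k M ⟶ J := ModuleCat.ofHom (b.flip q)
    exact ⟨(Injective.factorThru β (ModuleCat.ofHom nk)).hom, fun m =>
      congrArg (fun t => t.hom m) (Injective.comp_factorThru β (ModuleCat.ofHom nk))⟩
  choose ψ hψ using hext
  -- Write `p = ∑ q • c_q(p)` by projectivity; then `b m p = ∑ b (c_q(p) m) q`.
  let act : M' →ₗ[k] Aᵐᵒᵖ →ₗ[k] M' := LinearMap.mk₂ k (fun m c => c.unop • m)
    (fun m m' c => smul_add _ _ _) (fun r m c => smul_comm _ _ _) (fun m c c' => add_smul _ _ _)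
    (fun r m c => smul_assoc r c.unop m)
  let S : P →ₗ[k] P →₀ Aᵐᵒᵖ := s.restrictScalars k
  let Bm : M' →ₗ[k] (P →₀ Aᵐᵒᵖ) →ₗ[k] J := LinearMap.mk₂ k
    (fun m c => c.sum fun q t => ψ q (act m t))
    (fun m m' c => by
      simp only [map_add, LinearMap.add_apply]
      exact Finsupp.sum_add)
    (fun r m c => by
      simp only [map_smul, LinearMap.smul_apply]
      exact Finsupp.smul_sum.symm)
    (fun m c c' => Finsupp.sum_add_index' (fun q => by rw [map_zero, map_zero])
      (fun q t t' => by rw [map_add, map_add]))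
    (fun r m c => by
      rw [Finsupp.sum_smul_index' (fun q => by rw [map_zero, map_zero])]
      simp only [map_smul]
      exact Finsupp.smul_sum.symm)
  have hBm : ∀ m c, Bm m c = c.sum fun q t => ψ q (t.unop • m) := fun _ _ => rfl
  refine ⟨Bm.compl₂ S, fun m p => ?_, fun a m p => ?_⟩
  · change Bm (n m) (s p) = b m p
    rw [hBm]
    have h1 : ∀ q (t : Aᵐᵒᵖ), ψ q (t.unop • n m) = b m (t • q) := fun q t => by
      rw [← map_smul n, hψ, hb]
      rfl
    simp only [h1]
    conv_rhs => rw [← hs p, Finsupp.linearCombination_apply]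
    exact (map_finsuppSum (b m) _ _).symm
  · change Bm (a • m) (s p) = Bm m (s (MulOpposite.op a • p))
    rw [hBm, hBm, map_smul, Finsupp.sum_smul_index' (fun q => by
      rw [MulOpposite.unop_zero, zero_smul, map_zero])]
    refine Finsupp.sum_congr fun q _ => ?_
    rw [smul_eq_mul, MulOpposite.unop_mul, MulOpposite.unop_op, mul_smul]

end Balanced

/-! ### Cofree modules -/

section Cofree

variable {k : Type u} [CommRing k] {C : Type u} [SmallCategory C] [Preadditive C] [Linear k C]

namespace LMod

/-- The product of the coinduced `C`-modules `Hom(C(-, x), J_x)`. -/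
def cofree (J : C → ModuleCat.{u} k) : LMod k C :=
  ofData (fun y => ∀ x : C, (y ⟶ x) →ₗ[k] J x)
    (fun y z => LinearMap.mk₂ k
      (fun f ξ x => (ξ x).comp (Linear.leftComp k x f))
      (fun f g ξ => funext fun x => LinearMap.ext fun e =>
        (congrArg (ξ x) (Preadditive.add_comp _ _ _ f g e)).trans (map_add (ξ x) _ _))
      (fun r f ξ => funext fun x => LinearMap.ext fun e =>
        (congrArg (ξ x) (Linear.smul_comp _ _ _ r f e)).trans (map_smul (ξ x) _ _))
      (fun f ξ η => rfl)
      (fun r f ξ => rfl))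
    (fun y ξ => funext fun x => LinearMap.ext fun e => congrArg (ξ x) (Category.id_comp e))
    (fun y z w f g ξ => funext fun x => LinearMap.ext fun e =>
      congrArg (ξ x) (Category.assoc f g e))

variable (J : C → ModuleCat.{u} k)

/-- The elements of the values of a cofree module, as families of linear maps. -/
def cofreeVal (y : C) : (cofree J).val y ≃ₗ[k] (∀ x : C, (y ⟶ x) →ₗ[k] J x) :=
  LinearEquiv.refl k _

lemma cofreeVal_act {y z : C} (f : y ⟶ z) (ξ : (cofree J).val y) (x : C) (e : z ⟶ x) :
    cofreeVal J z ((cofree J).act f ξ) x e = cofreeVal J y ξ x (f ≫ e) := rfl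

/-- Morphisms to a cofree module are families of linear maps to the `J_x`. -/
def toCofree {J : C → ModuleCat.{u} k} {N : LMod k C} (t : ∀ x, N.val x →ₗ[k] J x) :
    N ⟶ cofree J :=
  homOfApp (fun y => (cofreeVal J y).symm.toLinearMap.comp
      (LinearMap.pi fun x => (N.actₗ y x).flip.compr₂ (t x)))
    (fun y z f v => funext fun x => LinearMap.ext fun e =>
      congrArg (t x) (N.act_comp f e v).symm)

lemma cofreeVal_toCofree {J : C → ModuleCat.{u} k} {N : LMod k C} (t : ∀ x, N.val x →ₗ[k] J x)
    (y : C) (v : N.val y) (x : C) (f : y ⟶ x) :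
    cofreeVal J y (app (toCofree t) y v) x f = t x (N.act f v) := rfl

instance injective_cofree [∀ x, Injective (J x)] : Injective (cofree J) where
  factors {X Y} g f hf := by
    rw [mono_iff] at hf
    let g₁ : ∀ x, X.val x →ₗ[k] J x := fun x =>
      (LinearMap.applyₗ (𝟙 x)).comp ((LinearMap.proj x).comp
        ((cofreeVal J x).toLinearMap.comp (app g x)))
    have hg₁ : ∀ x v, g₁ x v = cofreeVal J x (app g x v) x (𝟙 x) := fun _ _ => rfl
    have hext : ∀ x, ∃ t : Y.val x →ₗ[k] J x, ∀ v, t (app f x v) = g₁ x v := by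
      intro x
      have : Mono (ModuleCat.ofHom (app f x)) := (ModuleCat.mono_iff_injective _).2 (hf x)
      let β : ModuleCat.of k (X.val x) ⟶ J x := ModuleCat.ofHom (g₁ x)
      exact ⟨(Injective.factorThru β (ModuleCat.ofHom (app f x))).hom, fun v =>
        congrArg (fun t => t.hom v) (Injective.comp_factorThru β (ModuleCat.ofHom (app f x)))⟩
    choose t ht using hext
    refine ⟨toCofree t, LMod.hom_ext fun y v => (cofreeVal J y).injective ?_⟩
    refine funext fun x => LinearMap.ext fun e => ?_
    rw [app_comp, cofreeVal_toCofree, ← app_act, ht, hg₁, app_act, cofreeVal_act, Category.comp_id]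

/-- Every module embeds into a cofree module on injective `k`-modules. -/
lemma exists_cofree (N : LMod k C) : ∃ J : C → ModuleCat.{u} k, (∀ x, Injective (J x)) ∧
    ∃ j : N ⟶ cofree J, ∀ y, Function.Injective (app j y) := by
  refine ⟨fun x => Injective.under (N.obj.obj x), fun x => inferInstance,
    toCofree fun x => (Injective.ι (N.obj.obj x)).hom, fun y v w hvw => ?_⟩
  have h1 := (ModuleCat.mono_iff_injective (Injective.ι (N.obj.obj y))).1 inferInstance
  have h2 := congrArg (fun ξ => cofreeVal _ y ξ y (𝟙 y)) hvw
  simp only [cofreeVal_toCofree, act_id] at h2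
  exact h1 h2

end LMod

namespace ReedyStructure

open LMod

variable (R : ReedyStructure k C) (J : C → ModuleCat.{u} k)

lemma matchingMap_cofree_surjective (y : C) :
    Function.Surjective (R.matchingMap (cofree J) y) := by
  intro μ
  have hex : ∀ x, ∃ H : (y ⟶ x) →ₗ[k] J x, ∀ (z : C) (hz : R.deg z < R.deg y) (g : y ⟶ z)
      (f : z ⟶ x), H (g ≫ f) = cofreeVal J z (μ.1 ⟨z, hz⟩ g) x f := by
    intro x
    refine R.exists_linearMap_of_natural (R.deg y) (x := y) (y := x) (J := J x)
      (fun z hz => (LinearMap.proj x).comp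
        ((cofreeVal J z).toLinearMap.comp (μ.1 ⟨z, hz⟩))) ?_
    intro z z' hz hz' g e f
    change cofreeVal J z' (μ.1 ⟨z', hz'⟩ (g ≫ e)) x f = cofreeVal J z (μ.1 ⟨z, hz⟩ g) x (e ≫ f)
    rw [← cofreeVal_act]
    exact congrArg (fun t => cofreeVal J z' t x f) (μ.2 ⟨z, hz⟩ ⟨z', hz'⟩ e g)
  choose H hH using hex
  refine ⟨(cofreeVal J y).symm H, R.matching_ext fun z φ => (cofreeVal J z.1).injective ?_⟩
  refine funext fun x => LinearMap.ext fun f => ?_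
  exact hH x z.1 z.2 φ f

instance towerPlus (x y : C) : IsScalarTower k (R.A x)ᵐᵒᵖ (R.plus.hom x y) where
  smul_assoc r a g := Subtype.ext (Linear.smul_comp _ _ _ r (show x ⟶ x from a.unop.1) g.1)

variable {R} in
lemma projective_plus (hplus : R.PlusRightProjective) (x y : C) :
    Module.Projective (R.A x)ᵐᵒᵖ (R.plus.hom x y) := by
  classical
  have := hplus x
  exact Module.Projective.of_split (DirectSum.lof (R.A x)ᵐᵒᵖ C (fun y => R.plus.hom x y) y)
    (DirectSum.component (R.A x)ᵐᵒᵖ C (fun y => R.plus.hom x y) y)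
    (LinearMap.ext fun m => DirectSum.component.lof_self (M := fun y => R.plus.hom x y)
      (R.A x)ᵐᵒᵖ y m)

lemma mem_ker_matchingMap_cofree {y : C} {ξ : (cofree J).val y} :
    ξ ∈ LinearMap.ker (R.matchingMap (cofree J) y) ↔
      ∀ (x : C), ∀ f ∈ R.lower (R.deg y) y x, cofreeVal J y ξ x f = 0 := by
  constructor
  · intro h x f hf
    refine R.lower_induction (motive := fun f => cofreeVal J y ξ x f = 0) hf (map_zero _)
      (fun f g hf hg => by rw [map_add, hf, hg, add_zero])
      (fun r f hf => by rw [map_smul, hf, smul_zero]) fun z g e hz => ?_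
    have h1 : (cofree J).act g ξ = 0 := congrArg (fun m => m.1 ⟨z, hz⟩ g) h
    rw [← cofreeVal_act, h1]
    rfl
  · intro h
    refine R.matching_ext fun z φ => (cofreeVal J z.1).injective ?_
    refine funext fun x => LinearMap.ext fun f => ?_
    exact h x _ (comp_mem_lower z.2 φ f)

set_option maxHeartbeats 1000000 in
/-- The kernel of the matching morphism of a cofree module at `y` is the product of the modules
`Hom(C⁺(y, x), J_x)`, which are injective. -/
lemma injective_ker_matchingMap_cofree (hplus : R.PlusRightProjective) [∀ x, Injective (J x)]
    (y : C) : Injective (ModuleCat.of (R.A y)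
      (LinearMap.ker (R.matchingMap (cofree J) y))) where
  factors {M M'} g n hn := by
    rw [ModuleCat.mono_iff_injective] at hn
    let : Module k M := Module.compHom M (algebraMap k (R.A y))
    have : IsScalarTower k (R.A y) M := IsScalarTower.of_algebraMap_smul fun r v => rfl
    let : Module k M' := Module.compHom M' (algebraMap k (R.A y))
    have : IsScalarTower k (R.A y) M' := IsScalarTower.of_algebraMap_smul fun r v => rfl
    let gA : M →ₗ[R.A y] (cofree J).val y :=
      (LinearMap.ker (R.matchingMap (cofree J) y)).subtype.comp g.hom
    let gk : M →ₗ[k] (cofree J).val y :=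
      { toFun := gA
        map_add' := map_add gA
        map_smul' := fun r v => by
          have h := map_smul gA (algebraMap k (R.A y) r) v
          rwa [algebraMap_smul (R.A y) r v, algebraMap_smul (R.A y) r (gA v)] at h }
    have hg : ∀ m x, ∀ f ∈ R.lower (R.deg y) y x, cofreeVal J y (gA m) x f = 0 := fun m =>
      (R.mem_ker_matchingMap_cofree J).1 (g.hom m).2
    have hB : ∀ x, ∃ B : M' →ₗ[k] R.plus.hom y x →ₗ[k] J x,
        (∀ m p, B (n.hom m) p = cofreeVal J y (gA m) x p.1) ∧
        ∀ (a : R.A y) m p, B (a • m) p = B m (MulOpposite.op a • p) := by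
      intro x
      have := projective_plus hplus y x
      refine exists_balanced_extension (A := R.A y) (P := R.plus.hom y x) (J x) n.hom hn
        ((LinearMap.lcomp k (J x) (R.plus.hom y x).subtype).comp
          ((LinearMap.proj x).comp ((cofreeVal J y).toLinearMap.comp gk))) ?_
      intro a m p
      exact congrArg (fun ξ => cofreeVal J y ξ x p.1) (map_smul gA a m)
    choose B hB₁ hB₂ using hB
    choose μ hμ₁ hμ₂ hμ₃ using fun x => R.exists_plusProj y x
    let G : M' → (cofree J).val y := fun m => (cofreeVal J y).symm fun x => (B x m).comp (μ x)
    have hG : ∀ m x f, cofreeVal J y (G m) x f = B x m (μ x f) := fun _ _ _ => rfl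
    have hμa : ∀ x (a : R.A y) (f : y ⟶ x), μ x ((show y ⟶ y from a.1) ≫ f) =
        MulOpposite.op a • μ x f := by
      intro x a f
      have h1 : (show y ⟶ y from a.1) ≫ f = (MulOpposite.op a • μ x f).1 +
          (show y ⟶ y from a.1) ≫ (f - (μ x f).1) := by
        rw [Preadditive.comp_sub]
        exact (add_sub_cancel _ _).symm
      rw [h1, map_add, hμ₁, hμ₂ x _ (comp_lower (hμ₃ x f) _), add_zero]
    let GA : M' →ₗ[R.A y] (cofree J).val y :=
      { toFun := G
        map_add' := fun m m' => (cofreeVal J y).injective (funext fun x => LinearMap.ext fun f => by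
          rw [map_add, hG, map_add]
          rfl)
        map_smul' := fun a m => (cofreeVal J y).injective (funext fun x => LinearMap.ext fun f => by
          rw [hG, hB₂, ← hμa]
          rfl) }
    have hker : ∀ m, GA m ∈ LinearMap.ker (R.matchingMap (cofree J) y) := fun m =>
      (R.mem_ker_matchingMap_cofree J).2 fun x f hf => by
        change B x m (μ x f) = 0
        rw [hμ₂ x f hf, map_zero]
    refine ⟨ModuleCat.ofHom (GA.codRestrict _ hker), ModuleCat.hom_ext (LinearMap.ext fun m => ?_)⟩
    refine Subtype.ext ((cofreeVal J y).injective (funext fun x => LinearMap.ext fun f => ?_))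
    change B x (n.hom m) (μ x f) = cofreeVal J y (gA m) x f
    have h2 := hg m x _ (hμ₃ x f)
    rw [map_sub, sub_eq_zero] at h2
    rw [hB₁, h2]

variable {R J} in
/-- Cofree modules on injective `k`-modules lie in `Ψ(𝒟)`. -/
lemma psi_cofree (hplus : R.PlusRightProjective) [∀ x, Injective (J x)]
    {𝒞 𝒟 : ∀ x : C, ObjectProperty (ModuleCat.{u} (R.A x))}
    (h : ∀ x, IsCompleteCotorsionPair (𝒞 x) (𝒟 x)) : R.Psi 𝒟 (cofree J) := fun y =>
  ⟨R.matchingMap_cofree_surjective J y, ((h y).right_iff _).2 fun X _ =>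
    have := R.injective_ker_matchingMap_cofree J hplus y
    extOneVanishes_of_injective _ _⟩

end ReedyStructure

end Cofree

/-! ### The classes `Φ(𝒞)` and `Ψ(𝒟)` -/

section Classes

variable {k : Type u} [CommRing k] {C : Type u} [SmallCategory C] [Preadditive C] [Linear k C]

namespace ReedyStructure

open LMod

variable {R : ReedyStructure k C} {𝒞 𝒟 : ∀ x : C, ObjectProperty (ModuleCat.{u} (R.A x))}

/-- The restriction of a morphism to the kernels of the matching morphisms. -/
def kerMap (R : ReedyStructure k C) {X Y : LMod k C} (f : X ⟶ Y) (x : C) :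
    LinearMap.ker (R.matchingMap X x) →ₗ[R.A x] LinearMap.ker (R.matchingMap Y x) :=
  ((R.appA f x).comp (LinearMap.ker (R.matchingMap X x)).subtype).codRestrict _ fun ξ => by
    refine R.matching_ext fun y φ => ?_
    have h1 : X.act φ ξ.1 = 0 := congrArg (fun m => m.1 y φ) ξ.2
    change Y.act φ (app f x ξ.1) = 0
    rw [← app_act, h1, map_zero]

/-- `kerMap` as a morphism in the category of `A⁰_x`-modules. -/
def kerHom (R : ReedyStructure k C) {X Y : LMod k C} (f : X ⟶ Y) (x : C) :
    ModuleCat.of (R.A x) (LinearMap.ker (R.matchingMap X x)) ⟶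
      ModuleCat.of (R.A x) (LinearMap.ker (R.matchingMap Y x)) :=
  ModuleCat.ofHom (R.kerMap f x)

lemma Psi.of_retract (h : ∀ x, IsCompleteCotorsionPair (𝒞 x) (𝒟 x)) {Y Y' : LMod k C}
    (hY : R.Psi 𝒟 Y) (i : Y' ⟶ Y) (r : Y ⟶ Y') (hir : i ≫ r = 𝟙 Y') : R.Psi 𝒟 Y' := by
  have hri : ∀ x v, app r x (app i x v) = v := fun x v => app_congr hir x v
  intro x
  constructor
  · intro μ
    obtain ⟨ξ, hξ⟩ := (hY x).1 (R.matchingFunc (app i) (naturalBelow_app _ i) μ)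
    refine ⟨app r x ξ, R.matching_ext fun y φ => ?_⟩
    have h1 : Y.act φ ξ = app i y.1 (μ.1 y φ) := congrArg (fun m => m.1 y φ) hξ
    change Y'.act φ (app r x ξ) = μ.1 y φ
    rw [← app_act, h1, hri]
  · exact (h x).right_of_retract (hY x).2 (R.kerHom i x) (R.kerHom r x)
      (ModuleCat.hom_ext (LinearMap.ext fun v => Subtype.ext (hri x v.1)))

lemma Phi.of_retract (h : ∀ x, IsCompleteCotorsionPair (𝒞 x) (𝒟 x)) {X X' : LMod k C}
    (hX : R.Phi 𝒞 X) (i : X' ⟶ X) (r : X ⟶ X') (hir : i ≫ r = 𝟙 X') : R.Phi 𝒞 X' := by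
  have hri : ∀ x v, app r x (app i x v) = v := fun x v => app_congr hir x v
  intro x
  have hrange : ∀ {Z W : LMod k C} (f : Z ⟶ W), LinearMap.range (R.latchingMap Z x) ≤
      (LinearMap.range (R.latchingMap W x)).comap (R.appA f x) := by
    rintro Z W f _ ⟨t, rfl⟩
    exact ⟨_, R.latchingMap_naturality f t⟩
  constructor
  · refine (injective_iff_map_eq_zero _).2 fun t ht => ?_
    have h1 : R.latchingFunc x (app r) (naturalBelow_app _ r)
        (R.latchingFunc x (app i) (naturalBelow_app _ i) t) = t := by
      refine R.latching_induction (motive := fun t => R.latchingFunc x (app r)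
        (naturalBelow_app _ r) (R.latchingFunc x (app i) (naturalBelow_app _ i) t) = t) t
        (by simp only [map_zero]) (fun s t hs ht => by simp only [map_add, hs, ht])
        fun y φ ξ => ?_
      rw [latchingFunc_lmk, latchingFunc_lmk, hri]
    have h2 : R.latchingFunc x (app i) (naturalBelow_app _ i) t = 0 := by
      refine (hX x).1 ?_
      rw [latchingMap_naturality, ht, map_zero, map_zero]
    rw [← h1, h2, map_zero]
  · refine (h x).left_of_retract (hX x).2
      (ModuleCat.ofHom (Submodule.mapQ _ _ (R.appA i x) (hrange i)))
      (ModuleCat.ofHom (Submodule.mapQ _ _ (R.appA r x) (hrange r)))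
      (ModuleCat.hom_ext (LinearMap.ext fun t => ?_))
    obtain ⟨v, rfl⟩ := Submodule.Quotient.mk_surjective _ t
    exact congrArg (LinearMap.range (R.latchingMap X' x)).mkQ (hri x v)

section ShortExact

variable {Y₁ Y₂ Y₃ : LMod k C} {i : Y₁ ⟶ Y₂} {p : Y₂ ⟶ Y₃}
  (hi : ∀ y, Function.Injective (app i y)) (hp : ∀ y, Function.Surjective (app p y))
  (hip : ∀ y v, app p y v = 0 ↔ ∃ w, app i y w = v)

include hi hp hip

/-- A short exact sequence induces a short exact sequence of kernels of matching morphisms, if the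
matching morphism of its first term is surjective. -/
lemma exists_shortExact_ker {x : C} (h₁ : Function.Surjective (R.matchingMap Y₁ x)) :
    ∃ w : R.kerHom i x ≫ R.kerHom p x = 0, (ShortComplex.mk _ _ w).ShortExact := by
  have hinj : Function.Injective (R.kerMap i x) := fun v w hvw =>
    Subtype.ext (hi x (congrArg Subtype.val hvw))
  have hsurj : Function.Surjective (R.kerMap p x) := by
    rintro ⟨ζ, hζ⟩
    obtain ⟨ξ, hξ⟩ := R.relMatchingMap_surjective hi (hp x) hip h₁ ⟨(0, ζ),
      R.mem_relMatching.2 fun y φ => (map_zero _).trans (congrArg (fun m => m.1 y φ) hζ).symm⟩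
    obtain ⟨h2, h3⟩ := R.relMatchingMap_eq_iff.1 hξ
    exact ⟨⟨ξ, R.matching_ext h2⟩, Subtype.ext h3⟩
  have hexact : ∀ ξ, R.kerMap p x ξ = 0 ↔ ∃ w, R.kerMap i x w = ξ := by
    intro ξ
    constructor
    · intro hξ
      obtain ⟨w, hw⟩ := (hip x ξ.1).1 (congrArg Subtype.val hξ)
      refine ⟨⟨w, R.matching_ext fun y φ => hi y.1 ?_⟩, Subtype.ext hw⟩
      have h2 : Y₂.act φ ξ.1 = 0 := congrArg (fun m => m.1 y φ) ξ.2
      change app i y.1 (Y₁.act φ w) = app i y.1 0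
      rw [app_act, hw, h2, map_zero]
    · rintro ⟨w, rfl⟩
      exact Subtype.ext ((hip x _).2 ⟨w.1, rfl⟩)
  exact shortExact_of_linearMap (A := R.A x) (X := LinearMap.ker (R.matchingMap Y₁ x))
    (Y := LinearMap.ker (R.matchingMap Y₂ x)) (Z := LinearMap.ker (R.matchingMap Y₃ x))
    (R.kerMap i x) (R.kerMap p x) hinj hsurj hexact

/-- The class `Ψ(𝒟)` is closed under extensions. -/
lemma Psi.of_extension (h : ∀ x, IsCompleteCotorsionPair (𝒞 x) (𝒟 x)) (h₁ : R.Psi 𝒟 Y₁)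
    (h₃ : R.Psi 𝒟 Y₃) : R.Psi 𝒟 Y₂ := by
  intro x
  refine ⟨fun μ => ?_, ?_⟩
  · obtain ⟨ζ, hζ⟩ := (h₃ x).1 (R.matchingFunc (app p) (naturalBelow_app _ p) μ)
    obtain ⟨ξ, hξ⟩ := R.relMatchingMap_surjective hi (hp x) hip (h₁ x).1 ⟨(μ, ζ),
      R.mem_relMatching.2 fun y φ => (congrArg (fun m => m.1 y φ) hζ).symm⟩
    exact ⟨ξ, R.matching_ext (R.relMatchingMap_eq_iff.1 hξ).1⟩
  · obtain ⟨w, hw⟩ := exists_shortExact_ker hi hp hip (h₁ x).1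
    exact (h x).right_of_shortExact hw (h₁ x).2 (h₃ x).2

/-- If the classes `𝒟_x` are closed under cokernels of monomorphisms, then so is `Ψ(𝒟)`. -/
lemma Psi.of_cokernel (hminus : R.MinusLeftProjective)
    (h : ∀ x, IsHereditary (𝒞 x) (𝒟 x)) (h₁ : R.Psi 𝒟 Y₁) (h₂ : R.Psi 𝒟 Y₂) : R.Psi 𝒟 Y₃ := by
  intro x
  refine ⟨fun μ => ?_, ?_⟩
  · obtain ⟨μ', hμ'⟩ := exists_matching_lift hminus (p := p)
      (fun y _ => R.relMatchingMap_surjective hi (hp y) hip (h₁ y).1) μ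
    obtain ⟨ξ, hξ⟩ := (h₂ x).1 μ'
    refine ⟨app p x ξ, R.matching_ext fun y φ => ?_⟩
    have h3 : Y₂.act φ ξ = μ'.1 y φ := congrArg (fun m => m.1 y φ) hξ
    change Y₃.act φ (app p x ξ) = μ.1 y φ
    rw [← app_act, h3, hμ']
  · obtain ⟨w, hw⟩ := exists_shortExact_ker hi hp hip (h₁ x).1
    exact (h x).coresolving _ hw (h₁ x).2 (h₂ x).2

/-- Morphisms from an object of `Φ(𝒞)` lift along an epimorphism with kernel in `Ψ(𝒟)`. -/
lemma Phi.exists_lift (h : ∀ x, IsCompleteCotorsionPair (𝒞 x) (𝒟 x)) (h₁ : R.Psi 𝒟 Y₁)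
    {X : LMod k C} (hX : R.Phi 𝒞 X) (b : X ⟶ Y₃) : ∃ s : X ⟶ Y₂, s ≫ p = b := by
  refine R.exists_lift b (fun x => (hX x).1)
    (fun x => R.relMatchingMap_surjective hi (hp x) hip (h₁ x).1) fun x => ?_
  have hk : 𝒟 x (ModuleCat.of (R.A x) (LinearMap.ker (R.relMatchingMap p x))) :=
    (h x).right_of_iso (h₁ x).2 (LinearEquiv.toModuleIso (R := R.A x)
      (X₁ := LinearMap.ker (R.matchingMap Y₁ x)) (X₂ := LinearMap.ker (R.relMatchingMap p x))
      (R.kerRelMatchingEquiv i hi hip))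
  exact (h x).vanishes (hX x).2 hk

end ShortExact

/-- The cokernel sequence of a monomorphism. -/
lemma exists_cokernel {Y I : LMod k C} (j : Y ⟶ I) (hj : ∀ y, Function.Injective (app j y)) :
    ∃ (Z : LMod k C) (q : I ⟶ Z), (∀ y, Function.Surjective (app q y)) ∧
      ∀ y v, app q y v = 0 ↔ ∃ w, app j y w = v :=
  ⟨_, cokerπ j, fun y => Submodule.Quotient.mk_surjective _,
    fun y v => Submodule.Quotient.mk_eq_zero (LinearMap.range (app j y))⟩

lemma Phi.extOneVanishes (hplus : R.PlusRightProjective)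
    (h : ∀ x, IsCompleteCotorsionPair (𝒞 x) (𝒟 x)) {X Y : LMod k C} (hX : R.Phi 𝒞 X)
    (hY : R.Psi 𝒟 Y) : ExtOneVanishes X Y := by
  obtain ⟨J, hJ, j, hj⟩ := exists_cofree Y
  obtain ⟨Z, q, hq, hjq⟩ := exists_cokernel j hj
  obtain ⟨w, hw⟩ := shortExact_of_app j q hj hq hjq
  have : Injective (ShortComplex.mk j q w).X₂ := injective_cofree J
  exact extOneVanishes_of_lifts hw fun φ => Phi.exists_lift hj hq hjq h hY hX φ

/-- Special preenvelopes with respect to `Φ(𝒞)` and `Ψ(𝒟)`, obtained from special precovers by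
pulling back an injective copresentation. -/
theorem exists_preenvelope (hplus : R.PlusRightProjective) (hminus : R.MinusLeftProjective)
    (h : ∀ x, IsCompleteCotorsionPair (𝒞 x) (𝒟 x)) (N : LMod k C) :
    ∃ (E X : LMod k C) (i : N ⟶ E) (p : E ⟶ X), (∀ y, Function.Injective (app i y)) ∧
      (∀ y, Function.Surjective (app p y)) ∧ (∀ y v, app p y v = 0 ↔ ∃ w, app i y w = v) ∧
      R.Phi 𝒞 X ∧ R.Psi 𝒟 E := by
  obtain ⟨J, hJ, j, hj⟩ := exists_cofree N
  obtain ⟨Z, q, hq, hjq⟩ := exists_cokernel j hj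
  obtain ⟨K, X, e, π, he, hπ, heπ, hX, hK⟩ := exists_precover hminus h Z
  let S : ∀ y, Submodule k (X.val y × (cofree J).val y) := fun y =>
    LinearMap.eqLocus ((app π y).comp (LinearMap.fst k _ _)) ((app q y).comp (LinearMap.snd k _ _))
  have hS : ∀ y (t : X.val y × (cofree J).val y), t ∈ S y ↔ app π y t.1 = app q y t.2 :=
    fun _ _ => Iff.rfl
  let E : LMod k C := (X.prod (cofree J)).sub S fun y z f t ht => by
    refine (hS z _).2 ((app_act π f _).trans (Eq.trans ?_ (app_act q f _).symm))
    exact congrArg (Z.act f) ((hS y t).1 ht)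
  let p₁ : E ⟶ X := homOfApp (fun y => (LinearMap.fst k _ _).comp (S y).subtype)
    fun _ _ _ _ => rfl
  let p₂ : E ⟶ cofree J := homOfApp (fun y => (LinearMap.snd k _ _).comp (S y).subtype)
    fun _ _ _ _ => rfl
  let i₁ : N ⟶ E := homOfApp (fun y => ((LinearMap.inr k (X.val y) _).comp (app j y)).codRestrict
      (S y) fun v => (hS y _).2 ((map_zero _).trans ((hjq y _).2 ⟨v, rfl⟩).symm))
    fun y z f v => Subtype.ext (Prod.ext (map_zero _).symm (app_act j f v))
  let i₂ : K ⟶ E := homOfApp (fun y => ((LinearMap.inl k _ ((cofree J).val y)).comp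
      (app e y)).codRestrict (S y) fun v => (hS y _).2
        (((heπ y _).2 ⟨v, rfl⟩).trans (map_zero _).symm))
    fun y z f v => Subtype.ext (Prod.ext (app_act e f v) (map_zero _).symm)
  have hp : ∀ y (t : S y), app p₁ y t = 0 ↔ ∃ w, app i₁ y w = t := by
    rintro y ⟨⟨a, b⟩, hab⟩
    constructor
    · rintro (rfl : a = 0)
      obtain ⟨w, rfl⟩ := (hjq y b).1 (((hS y _).1 hab).symm.trans (map_zero _))
      exact ⟨w, rfl⟩
    · rintro ⟨w, hw⟩
      exact (congrArg (fun t : S y => t.1.1) hw).symm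
  have hp' : ∀ y (t : S y), app p₂ y t = 0 ↔ ∃ w, app i₂ y w = t := by
    rintro y ⟨⟨a, b⟩, hab⟩
    constructor
    · rintro (rfl : b = 0)
      obtain ⟨w, rfl⟩ := (heπ y a).1 (((hS y _).1 hab).trans (map_zero _))
      exact ⟨w, rfl⟩
    · rintro ⟨w, hw⟩
      exact (congrArg (fun t : S y => t.1.2) hw).symm
  refine ⟨E, X, i₁, p₁, fun y v w hvw => hj y (congrArg (fun t : S y => t.1.2) hvw), fun y a => ?_,
    hp, hX, Psi.of_extension (i := i₂) (p := p₂)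
      (fun y v w hvw => he y (congrArg (fun t : S y => t.1.1) hvw)) (fun y b => ?_) hp' h hK
      (psi_cofree hplus h)⟩
  · obtain ⟨b, hb⟩ := hq y (app π y a)
    let t : S y := ⟨(a, b), (hS y _).2 hb.symm⟩
    exact ⟨t, rfl⟩
  · obtain ⟨a, ha⟩ := hπ y (app q y b)
    let t : S y := ⟨(a, b), (hS y _).2 ha⟩
    exact ⟨t, rfl⟩

theorem isCompleteCotorsionPair (hplus : R.PlusRightProjective) (hminus : R.MinusLeftProjective)
    (h : ∀ x, IsCompleteCotorsionPair (𝒞 x) (𝒟 x)) :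
    IsCompleteCotorsionPair (R.Phi 𝒞) (R.Psi 𝒟) where
  right_iff M := by
    refine ⟨fun hM X hX => Phi.extOneVanishes hplus h hX hM, fun hM => ?_⟩
    obtain ⟨E, X, i, p, hi, hp, hip, hX, hE⟩ := exists_preenvelope hplus hminus h M
    obtain ⟨w, hw⟩ := shortExact_of_app i p hi hp hip
    obtain ⟨r, hr⟩ := (hM X hX).exists_extension hw (𝟙 M)
    exact Psi.of_retract h hE i r hr
  left_iff M := by
    refine ⟨fun hM Y hY => Phi.extOneVanishes hplus h hM hY, fun hM => ?_⟩
    obtain ⟨K, X, i, p, hi, hp, hip, hX, hK⟩ := exists_precover hminus h M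
    obtain ⟨w, hw⟩ := shortExact_of_app i p hi hp hip
    obtain ⟨s, hs⟩ := (hM K hK).exists_lift hw (𝟙 M)
    exact Phi.of_retract h hX s p hs
  exists_left M := by
    obtain ⟨K, X, i, p, hi, hp, hip, hX, hK⟩ := exists_precover hminus h M
    obtain ⟨w, hw⟩ := shortExact_of_app i p hi hp hip
    exact ⟨K, X, i, p, w, hw, hX, hK⟩
  exists_right M := by
    obtain ⟨E, X, i, p, hi, hp, hip, hX, hE⟩ := exists_preenvelope hplus hminus h M
    obtain ⟨w, hw⟩ := shortExact_of_app i p hi hp hip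
    exact ⟨E, X, i, p, w, hw, hX, hE⟩

theorem isHereditary (hplus : R.PlusRightProjective) (hminus : R.MinusLeftProjective)
    (h : ∀ x, IsCompleteCotorsionPair (𝒞 x) (𝒟 x)) (hh : ∀ x, IsHereditary (𝒞 x) (𝒟 x)) :
    IsHereditary (R.Phi 𝒞) (R.Psi 𝒟) where
  resolving S hS h₂ h₃ := by
    refine ((isCompleteCotorsionPair hplus hminus h).left_iff _).2 fun Y hY => ?_
    -- A morphism from the kernel to the cosyzygy `Z` of `Y` extends to `S.X₂`, because `Z` is in
    -- `Ψ(𝒟)`, and the extension lifts to the injective object.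
    obtain ⟨J, hJ, j, hj⟩ := exists_cofree Y
    obtain ⟨Z, q, hq, hjq⟩ := exists_cokernel j hj
    obtain ⟨w, hw⟩ := shortExact_of_app j q hj hq hjq
    have : Injective (ShortComplex.mk j q w).X₂ := injective_cofree J
    have hZ : R.Psi 𝒟 Z := Psi.of_cokernel hj hq hjq hminus hh hY (psi_cofree hplus h)
    refine extOneVanishes_of_lifts hw fun φ => ?_
    obtain ⟨ψ, hψ⟩ := (Phi.extOneVanishes hplus h h₃ hZ).exists_extension hS φ
    obtain ⟨s, hs⟩ := Phi.exists_lift hj hq hjq h hY h₂ ψ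
    exact ⟨S.f ≫ s, by rw [Category.assoc]; exact (congrArg (S.f ≫ ·) hs).trans hψ⟩
  coresolving S hS h₁ h₂ := by
    have := hS.mono_f
    have := hS.epi_g
    exact Psi.of_cokernel ((mono_iff S.f).1 inferInstance) ((epi_iff S.g).1 inferInstance)
      (fun y v => ⟨exists_of_app_eq_zero hS, by
        rintro ⟨w, rfl⟩
        exact app_g_f w⟩) hminus hh h₁ h₂

end ReedyStructure

end Classes

end ReedyGlue

end

theorem mainTheorem6 (k : Type u) [CommRing k] (C : Type u) [SmallCategory C] [Preadditive C]
    [Linear k C] (R : ReedyGlue.ReedyStructure k C)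
    (hplus : R.PlusRightProjective) (hminus : R.MinusLeftProjective)
    (𝒞 𝒟 : ∀ x : C, ObjectProperty (ModuleCat.{u} (R.A x)))
    (h : ∀ x : C, ReedyGlue.IsCompleteCotorsionPair (𝒞 x) (𝒟 x)) :
    ReedyGlue.IsCompleteCotorsionPair (R.Phi 𝒞) (R.Psi 𝒟) ∧
      ((∀ x : C, ReedyGlue.IsHereditary (𝒞 x) (𝒟 x)) →
        ReedyGlue.IsHereditary (R.Phi 𝒞) (R.Psi 𝒟)) :=
  ⟨ReedyGlue.ReedyStructure.isCompleteCotorsionPair hplus hminus h, fun hh =>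
    ReedyGlue.ReedyStructure.isHereditary hplus hminus h hh⟩
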